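/- Call a mixed graph $G=(V,E,A)$ simple if it has at most one undirected edge in $E$ for each pair of distinct vertices, at most one arc in $A$ for each ordered pair of distinct vertices, and no loops (an undirected edge and arcs between the same two vertices may coexist). Let $c:E\cup A\to\mathbb R$ be a weight function. Walks traverse arcs forwards and undirected edges in either direction; a path is a walk without repeated vertices; a cycle is a nonempty closed walk that repeats no edge or arc and no vertex except that its first vertex is its last. The weight function is conservative if no cycle has negative total weight. The distance $d(s,t)$ is the minimum weight of a path from $s$ to $t$ ($+\infty$ if there is none). The strongly connected components of $G$ are the classes of mutually reachable vertices, and a weak block of such a component is a block (a maximal connected subgraph without a cut vertex) of the underlying undirected graph of the sub-mixed-graph that the component induces. The negative trees contained in a weak block are the connected components, having at least one edge, of the graph formed by the undirected edges of negative weight with both ends in that block. The all-pairs shortest path problem asks, given $(G,c)$, to decide whether $c$ is conservative and, if it is, to compute $d(s,t)$ for all ordered pairs $(s,t)$ of vertices. Theorem. There are an algorithm and an absolute constant $C$ such that, for every simple mixed graph $G$ on $n\ge 1$ vertices with real weights $c$ and every $k_2\ge 0$ such that every weak block of every strongly connected component of $G$ contains at most $k_2$ negative trees, the algorithm solves the all-pairs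 shortest path problem for $(G,c)$ in at most $C\cdot 2^{k_2}\cdot n^4$ steps. Here the algorithm is one fixed program (it does not depend on $n$, and $k_2$ is not part of its input) for a random access machine with unit-cost operations: it handles integers less than $C\cdot 2^{k_2}\cdot n^4$ with $+$, truncated $-$, $\cdot$, division rounding down and comparisons, real numbers with $+$, $-$ and comparisons only, and arrays of both with computed indices. The input is given by $n$, the two adjacency matrices of $E$ and $A$, and the corresponding matrices of weights. -/

import Mathlib

/-! ## Weighted mixed graphs -/

/-- A simple weighted mixed graph: a set of undirected edges (at most one for each pair of distinct
vertices) and a set of arcs (at most one for each ordered pair of distinct vertices), with real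
weights. Only the weights of edges and arcs that are present matter. -/
structure MixedGraph (V : Type) where
  edges : SimpleGraph V
  arcs : Digraph V
  arcs_loopless : ∀ v, ¬ arcs.Adj v v
  edgeWeight : Sym2 V → ℝ
  arcWeight : V × V → ℝ

namespace MixedGraph

variable {V : Type}

/-- `G.Joins l u v`: the undirected edge or arc `l` of `G` can be traversed from `u` to `v`. -/
def Joins (G : MixedGraph V) : Sym2 V ⊕ V × V → V → V → Prop
  | .inl e, u, v => G.edges.Adj u v ∧ e = s(u, v)
  | .inr a, u, v => G.arcs.Adj u v ∧ a = (u, v)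

/-- The weight function on undirected edges and arcs. -/
def weight (G : MixedGraph V) : Sym2 V ⊕ V × V → ℝ
  | .inl e => G.edgeWeight e
  | .inr a => G.arcWeight a

/-- Walks in a mixed graph: sequences of consecutive edges and arcs. -/
inductive Walk (G : MixedGraph V) : V → V → Type
  | nil (v : V) : Walk G v v
  | cons {u v w : V} (l : Sym2 V ⊕ V × V) (h : G.Joins l u v) (p : Walk G v w) : Walk G u w

namespace Walk

variable {G : MixedGraph V}

/-- The vertices `v₀, …, v_ℓ` of a walk, in order. -/
def support : {u v : V} → Walk G u v → List V
  | _, _, nil v => [v]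
  | u, _, cons _ _ p => u :: p.support

/-- The edges and arcs of a walk, in order. -/
def links : {u v : V} → Walk G u v → List (Sym2 V ⊕ V × V)
  | _, _, nil _ => []
  | _, _, cons l _ p => l :: p.links

/-- The total weight of a walk. -/
def weight {u v : V} (p : Walk G u v) : ℝ := (p.links.map G.weight).sum

/-- All vertices are distinct. -/
def IsPath {u v : V} (p : Walk G u v) : Prop := p.support.Nodup

/-- A nonempty closed walk whose vertices are distinct except that the first one equals the last
one, and which does not traverse the same edge or arc twice (so going back and forth along one
undirected edge is not a cycle). -/
def IsCycle {v : V} (p : Walk G v v) : Prop :=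
  p.links ≠ [] ∧ p.support.tail.Nodup ∧ p.links.Nodup

end Walk

/-- No cycle has negative total weight. -/
def Conservative (G : MixedGraph V) : Prop :=
  ∀ (v : V) (p : G.Walk v v), p.IsCycle → 0 ≤ p.weight

/-- There is a path from `s` to `t`. -/
def Reachable (G : MixedGraph V) (s t : V) : Prop :=
  ∃ p : G.Walk s t, p.IsPath

/-- `d` is the distance of `t` from `s`: the weight of a shortest path from `s` to `t`. -/
def IsDistance (G : MixedGraph V) (s t : V) (d : ℝ) : Prop :=
  IsLeast {w : ℝ | ∃ p : G.Walk s t, p.IsPath ∧ p.weight = w} d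

/-- The underlying undirected graph. -/
def underlying (G : MixedGraph V) : SimpleGraph V :=
  SimpleGraph.fromRel fun u v => G.edges.Adj u v ∨ G.arcs.Adj u v

/-- The vertex sets of the strongly connected components. -/
def IsStrongComponent (G : MixedGraph V) (K : Set V) : Prop :=
  ∃ v, K = {u | G.Reachable u v ∧ G.Reachable v u}

/-- `H[B]` is connected and has no cut vertex. -/
def IsNonseparable (H : SimpleGraph V) (B : Set V) : Prop :=
  (H.induce B).Connected ∧ ∀ v ∈ B, (H.induce (B \ {v})).Preconnected

/-- `B` is the vertex set of a weak block of the sub-mixed-graph induced by `K`, that is, of a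
block (maximal connected subgraph without cut vertex) of its underlying undirected graph. -/
def IsWeakBlock (G : MixedGraph V) (K B : Set V) : Prop :=
  Maximal (fun S : Set V => S ⊆ K ∧ IsNonseparable G.underlying S) B

/-- The graph of undirected edges of negative weight. -/
def negEdges (G : MixedGraph V) : SimpleGraph V where
  Adj u v := G.edges.Adj u v ∧ G.edgeWeight s(u, v) < 0
  symm := ⟨fun u v h => ⟨h.1.symm, by rw [Sym2.eq_swap]; exact h.2⟩⟩
  loopless := ⟨fun v h => G.edges.irrefl h.1⟩

/-- The number of negative trees in the sub-mixed-graph induced by `B`: the nontrivial components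
(those with at least one edge) formed by its negative undirected edges. -/
noncomputable def numNegTrees (G : MixedGraph V) (B : Set V) : ℕ :=
  {T : (G.negEdges.induce B).ConnectedComponent | T.supp.Nontrivial}.ncard

end MixedGraph

/-! ## A random access machine with structured programs

Memory consists of integer variables, integer arrays, real variables and real arrays. A program is
a fixed finite text, so it names only finitely many variables and arrays; arrays are accessed at
computed positions. Integers are words: every integer evaluated must be smaller than a bound `W`.
Reals can only be added, subtracted and compared, each exactly and in one step. -/

namespace RAM

/-- Memory contents; the index of a variable or the first index of an array is its name. -/
structure State where
  natVar : ℕ → ℕ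
  natArr : ℕ → ℕ → ℕ
  realVar : ℕ → ℝ
  realArr : ℕ → ℕ → ℝ

/-- Integer expressions (subtraction is truncated at `0`, division rounds down). -/
inductive NatExpr
  | lit (c : ℕ)
  | var (x : ℕ)
  | get (a : ℕ) (i : NatExpr)
  | add (e f : NatExpr)
  | sub (e f : NatExpr)
  | mul (e f : NatExpr)
  | div (e f : NatExpr)

namespace NatExpr

def eval (s : State) : NatExpr → ℕ
  | lit c => c
  | var x => s.natVar x
  | get a i => s.natArr a (i.eval s)
  | add e f => e.eval s + f.eval s
  | sub e f => e.eval s - f.eval s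
  | mul e f => e.eval s * f.eval s
  | div e f => e.eval s / f.eval s

/-- The values of all subexpressions fit in a machine word. -/
def Fits (W : ℕ) (s : State) : NatExpr → Prop
  | lit c => c < W
  | var x => s.natVar x < W
  | get a i => i.Fits W s ∧ s.natArr a (i.eval s) < W
  | add e f => e.Fits W s ∧ f.Fits W s ∧ e.eval s + f.eval s < W
  | sub e f => e.Fits W s ∧ f.Fits W s
  | mul e f => e.Fits W s ∧ f.Fits W s ∧ e.eval s * f.eval s < W
  | div e f => e.Fits W s ∧ f.Fits W s

/-- The number of elementary operations needed for the evaluation. -/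
def cost : NatExpr → ℕ
  | lit _ => 1
  | var _ => 1
  | get _ i => i.cost + 1
  | add e f => e.cost + f.cost + 1
  | sub e f => e.cost + f.cost + 1
  | mul e f => e.cost + f.cost + 1
  | div e f => e.cost + f.cost + 1

end NatExpr

/-- Real expressions. -/
inductive RealExpr
  | zero
  | var (x : ℕ)
  | get (a : ℕ) (i : NatExpr)
  | add (e f : RealExpr)
  | sub (e f : RealExpr)

namespace RealExpr

noncomputable def eval (s : State) : RealExpr → ℝ
  | zero => 0
  | var x => s.realVar x
  | get a i => s.realArr a (i.eval s)
  | add e f => e.eval s + f.eval s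
  | sub e f => e.eval s - f.eval s

/-- All integers evaluated fit in a machine word. -/
def Fits (W : ℕ) (s : State) : RealExpr → Prop
  | zero => True
  | var _ => True
  | get _ i => i.Fits W s
  | add e f => e.Fits W s ∧ f.Fits W s
  | sub e f => e.Fits W s ∧ f.Fits W s

/-- The number of elementary operations needed for the evaluation. -/
def cost : RealExpr → ℕ
  | zero => 1
  | var _ => 1
  | get _ i => i.cost + 1
  | add e f => e.cost + f.cost + 1
  | sub e f => e.cost + f.cost + 1

end RealExpr

/-- Tests. -/
inductive Test
  | natEq (e f : NatExpr)
  | natLt (e f : NatExpr)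
  | realLt (e f : RealExpr)
  | not (b : Test)
  | and (b c : Test)

namespace Test

def Holds (s : State) : Test → Prop
  | natEq e f => e.eval s = f.eval s
  | natLt e f => e.eval s < f.eval s
  | realLt e f => e.eval s < f.eval s
  | not b => ¬ b.Holds s
  | and b c => b.Holds s ∧ c.Holds s

/-- All integers evaluated fit in a machine word. -/
def Fits (W : ℕ) (s : State) : Test → Prop
  | natEq e f => e.Fits W s ∧ f.Fits W s
  | natLt e f => e.Fits W s ∧ f.Fits W s
  | realLt e f => e.Fits W s ∧ f.Fits W s
  | not b => b.Fits W s
  | and b c => b.Fits W s ∧ c.Fits W s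

/-- The number of elementary operations needed for the evaluation. -/
def cost : Test → ℕ
  | natEq e f => e.cost + f.cost + 1
  | natLt e f => e.cost + f.cost + 1
  | realLt e f => e.cost + f.cost + 1
  | not b => b.cost + 1
  | and b c => b.cost + c.cost + 1

end Test

/-- Programs. -/
inductive Program
  | skip
  | setNat (x : ℕ) (e : NatExpr)
  | setNatArr (a : ℕ) (i e : NatExpr)
  | setReal (x : ℕ) (e : RealExpr)
  | setRealArr (a : ℕ) (i : NatExpr) (e : RealExpr)
  | seq (p q : Program)
  | cond (b : Test) (p q : Program)
  | loop (b : Test) (p : Program)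

/-- Replace entry `i` of array `a`. -/
def updateArr {α : Type} (m : ℕ → ℕ → α) (a i : ℕ) (x : α) : ℕ → ℕ → α :=
  Function.update m a (Function.update (m a) i x)

/-- `Runs W p s t s'`: started in memory `s`, the program `p` halts after `t` steps with memory
`s'`, and no integer evaluated on the way is `W` or larger. `loop b p` repeats `p` while `b`
holds. -/
inductive Runs (W : ℕ) : Program → State → ℕ → State → Prop
  | skip (s : State) : Runs W .skip s 1 s
  | setNat (x : ℕ) (e : NatExpr) (s : State) (he : e.Fits W s) :
      Runs W (.setNat x e) s (e.cost + 1)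
        { s with natVar := Function.update s.natVar x (e.eval s) }
  | setNatArr (a : ℕ) (i e : NatExpr) (s : State) (hi : i.Fits W s) (he : e.Fits W s) :
      Runs W (.setNatArr a i e) s (i.cost + e.cost + 1)
        { s with natArr := updateArr s.natArr a (i.eval s) (e.eval s) }
  | setReal (x : ℕ) (e : RealExpr) (s : State) (he : e.Fits W s) :
      Runs W (.setReal x e) s (e.cost + 1)
        { s with realVar := Function.update s.realVar x (e.eval s) }
  | setRealArr (a : ℕ) (i : NatExpr) (e : RealExpr) (s : State)
      (hi : i.Fits W s) (he : e.Fits W s) :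
      Runs W (.setRealArr a i e) s (i.cost + e.cost + 1)
        { s with realArr := updateArr s.realArr a (i.eval s) (e.eval s) }
  | seq {p q : Program} {s s' s'' : State} {t t' : ℕ}
      (hp : Runs W p s t s') (hq : Runs W q s' t' s'') :
      Runs W (.seq p q) s (t + t') s''
  | condTrue {b : Test} {p q : Program} {s s' : State} {t : ℕ}
      (hf : b.Fits W s) (hb : b.Holds s) (hp : Runs W p s t s') :
      Runs W (.cond b p q) s (b.cost + 1 + t) s'
  | condFalse {b : Test} {p q : Program} {s s' : State} {t : ℕ}
      (hf : b.Fits W s) (hb : ¬ b.Holds s) (hq : Runs W q s t s') :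
      Runs W (.cond b p q) s (b.cost + 1 + t) s'
  | loopDone {b : Test} {p : Program} {s : State}
      (hf : b.Fits W s) (hb : ¬ b.Holds s) :
      Runs W (.loop b p) s (b.cost + 1) s
  | loopStep {b : Test} {p : Program} {s s' s'' : State} {t t' : ℕ}
      (hf : b.Fits W s) (hb : b.Holds s) (hp : Runs W p s t s')
      (hl : Runs W (.loop b p) s' t' s'') :
      Runs W (.loop b p) s (b.cost + 1 + t + t') s''

end RAM

/-! ## Input and output of the all-pairs shortest path problem on a mixed graph -/

namespace MixedGraph

/-- An `n × n` matrix stored row by row (entry `(u, v)` at position `u * n + v`), padded by `0`. -/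
def rowMajor {α : Type} [Zero α] {n : ℕ} (f : Fin n → Fin n → α) (i : ℕ) : α :=
  if h : i < n * n then f (finProdFinEquiv.symm ⟨i, h⟩).1 (finProdFinEquiv.symm ⟨i, h⟩).2 else 0

open Classical in
/-- The input: integer variable `0` holds `n`; integer arrays `0` and `1` hold the adjacency
matrices of the undirected edges and of the arcs; real arrays `0` and `1` hold their weights; all
other memory cells are `0`. -/
noncomputable def input {n : ℕ} (G : MixedGraph (Fin n)) : RAM.State where
  natVar x := if x = 0 then n else 0
  natArr a :=
    if a = 0 then rowMajor fun u v => if G.edges.Adj u v then 1 else 0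
    else if a = 1 then rowMajor fun u v => if G.arcs.Adj u v then 1 else 0
    else fun _ => 0
  realVar _ := 0
  realArr a :=
    if a = 0 then rowMajor fun u v => if G.edges.Adj u v then G.edgeWeight s(u, v) else 0
    else if a = 1 then rowMajor fun u v => if G.arcs.Adj u v then G.arcWeight (u, v) else 0
    else fun _ => 0

/-- The final memory `σ` solves the all-pairs shortest path problem: integer variable `0` tells
whether `G` is conservative (`1`) or not (`0`), and if it is, then for all `s`, `t`, position
`s * n + t` of integer array `2` tells whether `t` is reachable from `s` (`1`) or not (`0`, the
distance being infinite), and if it is, then that position of real array `2` holds the distance. -/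
def SolvesAPSP {n : ℕ} (G : MixedGraph (Fin n)) (σ : RAM.State) : Prop :=
  (G.Conservative → σ.natVar 0 = 1 ∧ ∀ s t : Fin n,
    (G.Reachable s t → σ.natArr 2 (s * n + t) = 1 ∧
      G.IsDistance s t (σ.realArr 2 (s * n + t))) ∧
    (¬ G.Reachable s t → σ.natArr 2 (s * n + t) = 0)) ∧
  (¬ G.Conservative → σ.natVar 0 = 0)

end MixedGraph

/-! Only undirected edges of negative weight are difficult; arcs of negative weight can be treated
like ordinary links. If the weights are conservative, the negative edges form a forest
(`isAcyclic_of_conservative`), and a path between two vertices of one negative tree is at least as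
heavy as the tree path between them (`wt_treePath_le`). The reason is that a part of the path that
leaves the tree at a and comes back at b closes up with a tree path to a cycle, so it weighs at
least the absolute weight of that tree path; `signedLength_le_wt` adds up these excursions. Hence
any path can be replaced, without becoming heavier, by a walk that alternates between parts without
negative edges and tree paths and uses every tree at most once: from the start x of the first
negative edge, jump along the tree path to the last vertex of the path in the tree of x, and
continue. Conversely, in a conservative graph a walk that uses no negative edge twice is at least as
heavy as some path (`exists_path_le`). Dynamic programming over the set of trees already used
therefore finds the distance of a pair in O(2^k n^2) steps if k trees matter (`dp_le_wt`,
`TreeWalk`).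

To get k ≤ k₂, this is done only for pairs s, t in one strong component that no vertex separates.
For s ≠ t, `blockSet` is then a weak block that contains every vertex of every path from s to t, and
the trees with at least two relevant vertices correspond injectively to negative trees of that block
(`card_le_of_weakBlocks`). If c separates s from t, paths from s to c and from c to t meet only in
c, and distances add up (`pathSound_closure`, `pathComplete_closure`). Paths through several strong
components are cut at the arcs that lead from one to the next (`join_complete`, `leave_sound`).

Conservativeness is decided in two tests. The first one recognises forests by distances along
negative edges (`AcyclicTest`). For the second one, consider a negative cycle with the fewest links
other than negative edges. Opened at such a link, it becomes a path all of whose excursions are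
heavy (`exists_cycle_of_not_conservative`). The bound of the dynamic programming needs just this
property and not conservativeness, so adding the link back yields a negative sum. In a conservative
graph no such sum is negative, because it is at least the weight of a closed walk that uses no
negative edge twice.

The costs are O(n^4) for reachability after the removal of each vertex and for the forest test, and
O(2^k₂ n^2) for each of n^2 pairs. Word sizes and running times are bounded by monomials in M = 2^k₂
and n that are computed from the program text; only the doubling of the label counter needs an
argument (`safe_labelProg`).

Arrays: 2 result, 3 and 4 reachability, 5 walks without negative edges, 6 lengths along negative
edges, 7 distances inside strong components, 8 relevant vertices, 9 labels of trees, 10 and 11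
dynamic programming, 12 paths into other strong components. -/

/-! ## Programs with counted loops -/

namespace RAM

/-- Assign an integer variable. -/
def State.setVar (s : State) (x v : ℕ) : State :=
  { s with natVar := Function.update s.natVar x v }

/-- Programs whose loops are counted: `for_ x y p` runs `p` for all values of the variable `x` below
the value of the variable `y`. The command `setB` is an assignment whose range is not checked by
the static analysis below. -/
inductive ForProg
  | skip
  | setN (x : ℕ) (e : NatExpr)
  | setB (x : ℕ) (e : NatExpr)
  | setA (a : ℕ) (i e : NatExpr)
  | setR (a : ℕ) (i : NatExpr) (e : RealExpr)
  | seq (p q : ForProg)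
  | ite (b : Test) (p q : ForProg)
  | for_ (x y : ℕ) (p : ForProg)

namespace ForProg

/-- Translation to programs of the machine. -/
def compile : ForProg → Program
  | skip => .skip
  | setN x e => .setNat x e
  | setB x e => .setNat x e
  | setA a i e => .setNatArr a i e
  | setR a i e => .setRealArr a i e
  | seq p q => .seq p.compile q.compile
  | ite b p q => .cond b p.compile q.compile
  | for_ x y p => .seq (.setNat x (.lit 0))
      (.loop (.natLt (.var x) (.var y)) (.seq p.compile (.setNat x (.add (.var x) (.lit 1)))))

/-- The memory after `i` rounds of a counted loop with body `f`. -/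
def iter (f : State → State) (x : ℕ) (s : State) : ℕ → State
  | 0 => s.setVar x 0
  | i + 1 => (f (iter f x s i)).setVar x (i + 1)

open Classical in
/-- The memory after running a program. -/
noncomputable def run : ForProg → State → State
  | skip, s => s
  | setN x e, s => s.setVar x (e.eval s)
  | setB x e, s => s.setVar x (e.eval s)
  | setA a i e, s => { s with natArr := updateArr s.natArr a (i.eval s) (e.eval s) }
  | setR a i e, s => { s with realArr := updateArr s.realArr a (i.eval s) (e.eval s) }
  | seq p q, s => q.run (p.run s)
  | ite b p q, s => if b.Holds s then p.run s else q.run s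
  | for_ x y p, s => iter p.run x s (s.natVar y)

/-- The integer variables that a program may change. -/
def vars : ForProg → List ℕ
  | setN x _ => [x]
  | setB x _ => [x]
  | seq p q => p.vars ++ q.vars
  | ite _ p q => p.vars ++ q.vars
  | for_ x _ p => x :: p.vars
  | _ => []

/-- The arrays that a program may change. -/
def arrs : ForProg → List ℕ
  | setA a _ _ => [a]
  | setR a _ _ => [a]
  | seq p q => p.arrs ++ q.arrs
  | ite _ p q => p.arrs ++ q.arrs
  | for_ _ _ p => p.arrs
  | _ => []

end ForProg

/-- The memories `s` and `σ` agree except for the variables in `X` and the arrays in `A`. -/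
def Agree (X A : List ℕ) (s σ : State) : Prop :=
  (∀ x, x ∉ X → σ.natVar x = s.natVar x) ∧
  (∀ a, a ∉ A → σ.natArr a = s.natArr a) ∧ (∀ a, a ∉ A → σ.realArr a = s.realArr a)

theorem Agree.refl {X A : List ℕ} (s : State) : Agree X A s s :=
  ⟨fun _ _ => rfl, fun _ _ => rfl, fun _ _ => rfl⟩

theorem Agree.trans {X A : List ℕ} {s σ τ : State} (h : Agree X A s σ) (h' : Agree X A σ τ) :
    Agree X A s τ :=
  ⟨fun x hx => (h'.1 x hx).trans (h.1 x hx), fun x hx => (h'.2.1 x hx).trans (h.2.1 x hx),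
    fun x hx => (h'.2.2 x hx).trans (h.2.2 x hx)⟩

theorem Agree.mono {X X' A A' : List ℕ} {s σ : State} (h : Agree X A s σ) (hX : X ⊆ X')
    (hA : A ⊆ A') : Agree X' A' s σ :=
  ⟨fun x hx => h.1 x fun h' => hx (hX h'), fun x hx => h.2.1 x fun h' => hx (hA h'),
    fun x hx => h.2.2 x fun h' => hx (hA h')⟩

theorem agree_setVar {X A : List ℕ} (s : State) {x : ℕ} (v : ℕ) (hx : x ∈ X) :
    Agree X A s (s.setVar x v) :=
  ⟨fun y hy => by
    have : y ≠ x := fun h => hy (h ▸ hx)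
    simp [State.setVar, this], fun _ _ => rfl, fun _ _ => rfl⟩

theorem updateArr_of_ne {α : Type} (m : ℕ → ℕ → α) {a b : ℕ} (i : ℕ) (x : α) (h : b ≠ a) :
    updateArr m a i x b = m b := by
  simp [updateArr, h]

theorem updateArr_apply {α : Type} (m : ℕ → ℕ → α) (a i : ℕ) (x : α) (j : ℕ) :
    updateArr m a i x a j = if j = i then x else m a j := by
  simp [updateArr, Function.update_apply]

@[simp] theorem setVar_natVar_self (s : State) (x v : ℕ) : (s.setVar x v).natVar x = v := by
  simp [State.setVar]

theorem setVar_natVar_of_ne (s : State) {x y : ℕ} (v : ℕ) (h : y ≠ x) :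
    (s.setVar x v).natVar y = s.natVar y := by
  simp [State.setVar, h]

@[simp] theorem setVar_natArr (s : State) (x v : ℕ) : (s.setVar x v).natArr = s.natArr := rfl

namespace ForProg

theorem agree_run (p : ForProg) (s : State) : Agree p.vars p.arrs s (p.run s) := by
  induction p generalizing s with
  | skip => exact Agree.refl s
  | setN x e => exact agree_setVar s _ (by simp [vars])
  | setB x e => exact agree_setVar s _ (by simp [vars])
  | setA a i e =>
    refine ⟨fun _ _ => rfl, fun b hb => ?_, fun _ _ => rfl⟩
    exact updateArr_of_ne _ _ _ (by simpa [arrs] using hb)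
  | setR a i e =>
    refine ⟨fun _ _ => rfl, fun _ _ => rfl, fun b hb => ?_⟩
    exact updateArr_of_ne _ _ _ (by simpa [arrs] using hb)
  | seq p q ihp ihq =>
    exact ((ihp s).mono (by simp [vars]) (by simp [arrs])).trans
      ((ihq _).mono (by simp [vars]) (by simp [arrs]))
  | ite b p q ihp ihq =>
    rw [run]
    split_ifs
    · exact (ihp s).mono (by simp [vars]) (by simp [arrs])
    · exact (ihq s).mono (by simp [vars]) (by simp [arrs])
  | for_ x y p ih =>
    rw [run]
    generalize s.natVar y = N
    induction N with
    | zero => exact agree_setVar s _ (by simp [vars])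
    | succ i hi =>
      refine (hi.trans ((ih _).mono (by simp [vars]) (by simp [arrs]))).trans ?_
      exact agree_setVar _ _ (by simp [vars])

theorem iter_natVar (p : ForProg) {x : ℕ} (s : State) (i : ℕ) :
    (iter p.run x s i).natVar x = i := by
  cases i <;> simp [iter]

theorem iter_natVar_of_notMem (p : ForProg) {x y : ℕ} (s : State) (i : ℕ) (hxy : y ≠ x)
    (hy : y ∉ p.vars) : (iter p.run x s i).natVar y = s.natVar y := by
  induction i with
  | zero => simp [iter, setVar_natVar_of_ne _ _ hxy]
  | succ i hi => rw [iter, setVar_natVar_of_ne _ _ hxy, (p.agree_run _).1 y hy, hi]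

/-- Loop invariants. -/
theorem run_for {p : ForProg} {x y : ℕ} {s : State} (I : ℕ → State → Prop)
    (h0 : I 0 (s.setVar x 0))
    (hs : ∀ i σ, i < s.natVar y → σ.natVar x = i → I i σ → I (i + 1) ((p.run σ).setVar x (i + 1))) :
    I (s.natVar y) ((for_ x y p).run s) := by
  rw [run]
  have : ∀ i, i ≤ s.natVar y → I i (iter p.run x s i) := by
    intro i
    induction i with
    | zero => exact fun _ => h0
    | succ i ih => exact fun hi => hs i _ (by omega) (iter_natVar p s i) (ih (by omega))
  exact this _ le_rfl

/-- A loop each round of which changes the memory along a preorder `R` and establishes a property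
that persists along `R`. -/
theorem run_for_rel {p : ForProg} {x y : ℕ} {s : State} (R : State → State → Prop)
    (Q : ℕ → State → Prop) (htrans : ∀ σ τ υ, R σ τ → R τ υ → R σ υ)
    (hvar : ∀ σ v, R σ (σ.setVar x v))
    (hQ : ∀ i σ τ, R σ τ → Q i σ → Q i τ)
    (hs : ∀ i σ, i < s.natVar y → σ.natVar x = i → R s σ → R σ (p.run σ) ∧ Q i (p.run σ)) :
    R s ((for_ x y p).run s) ∧ ∀ i < s.natVar y, Q i ((for_ x y p).run s) := by
  refine run_for (fun m σ => R s σ ∧ ∀ i < m, Q i σ) ⟨hvar _ _, by simp⟩ ?_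
  rintro i σ hi hx ⟨h1, h2⟩
  obtain ⟨h3, h4⟩ := hs i σ hi hx h1
  have h5 := htrans _ _ _ h3 (hvar (p.run σ) (i + 1))
  refine ⟨htrans _ _ _ h1 h5, fun j hj => ?_⟩
  rcases Nat.lt_succ_iff_lt_or_eq.1 hj with hj | rfl
  · exact hQ _ _ _ h5 (h2 j hj)
  · exact hQ _ _ _ (hvar _ _) h4

end ForProg

/-! ### Static analysis of word sizes and running times -/

/-- The monomial bound `c * M ^ a * n ^ b`. -/
structure Bd where
  c : ℕ
  a : ℕ
  b : ℕ

namespace Bd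

def val (M n : ℕ) (p : Bd) : ℕ := p.c * M ^ p.a * n ^ p.b

/-- Not the sum but a monomial above it: for M, n ≥ 1 the exponents may be raised to their maxima,
and the bound stays in the same simple form. -/
def add (p q : Bd) : Bd := ⟨p.c + q.c, max p.a q.a, max p.b q.b⟩

def mul (p q : Bd) : Bd := ⟨p.c * q.c, p.a + q.a, p.b + q.b⟩

def le (p q : Bd) : Bool := decide (p.c ≤ q.c) && decide (p.a ≤ q.a) && decide (p.b ≤ q.b)

variable {M n : ℕ}

theorem val_const (k : ℕ) : (⟨k, 0, 0⟩ : Bd).val M n = k := by simp [val]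

theorem val_mono (hM : 1 ≤ M) (hn : 1 ≤ n) {p q : Bd} (hc : p.c ≤ q.c) (ha : p.a ≤ q.a)
    (hb : p.b ≤ q.b) : p.val M n ≤ q.val M n := by
  unfold val
  gcongr

theorem val_le (hM : 1 ≤ M) (hn : 1 ≤ n) {p q : Bd} (h : p.le q = true) :
    p.val M n ≤ q.val M n := by
  simp only [le, Bool.and_eq_true, decide_eq_true_eq] at h
  exact val_mono hM hn h.1.1 h.1.2 h.2

theorem add_le_val (hM : 1 ≤ M) (hn : 1 ≤ n) (p q : Bd) :
    p.val M n + q.val M n ≤ (p.add q).val M n := by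
  have h1 : p.val M n ≤ p.c * M ^ (max p.a q.a) * n ^ (max p.b q.b) :=
    val_mono (q := ⟨p.c, max p.a q.a, max p.b q.b⟩) hM hn le_rfl (le_max_left _ _)
      (le_max_left _ _)
  have h2 : q.val M n ≤ q.c * M ^ (max p.a q.a) * n ^ (max p.b q.b) :=
    val_mono (q := ⟨q.c, max p.a q.a, max p.b q.b⟩) hM hn le_rfl (le_max_right _ _)
      (le_max_right _ _)
  calc _ ≤ _ := add_le_add h1 h2
    _ = _ := by simp only [val, add]; ring

theorem mul_val (p q : Bd) : (p.mul q).val M n = p.val M n * q.val M n := by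
  simp only [val, mul]; ring

end Bd

namespace NatExpr

variable (cv ca : ℕ → Bd)

/-- A bound for the value of an expression from bounds for variables and array entries. -/
def bd : NatExpr → Bd
  | lit c => ⟨c, 0, 0⟩
  | var x => cv x
  | get a _ => ca a
  | add e f => e.bd.add f.bd
  | sub e _ => e.bd
  | mul e f => e.bd.mul f.bd
  | div e _ => e.bd

/-- A bound for the values of all subexpressions. -/
def cap : NatExpr → Bd
  | lit c => ⟨c, 0, 0⟩
  | var x => cv x
  | get a i => i.cap.add (ca a)
  | add e f => (e.cap.add f.cap).add (e.bd cv ca |>.add (f.bd cv ca))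
  | sub e f => e.cap.add f.cap
  | mul e f => (e.cap.add f.cap).add (e.bd cv ca |>.mul (f.bd cv ca))
  | div e f => e.cap.add f.cap

end NatExpr

def RealExpr.cap (cv ca : ℕ → Bd) : RealExpr → Bd
  | zero => ⟨0, 0, 0⟩
  | var _ => ⟨0, 0, 0⟩
  | get _ i => i.cap cv ca
  | add e f => e.cap cv ca |>.add (f.cap cv ca)
  | sub e f => e.cap cv ca |>.add (f.cap cv ca)

def Test.cap (cv ca : ℕ → Bd) : Test → Bd
  | natEq e f => e.cap cv ca |>.add (f.cap cv ca)
  | natLt e f => e.cap cv ca |>.add (f.cap cv ca)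
  | realLt e f => e.cap cv ca |>.add (f.cap cv ca)
  | not b => b.cap cv ca
  | and b c => b.cap cv ca |>.add (c.cap cv ca)

namespace ForProg

variable (cv ca : ℕ → Bd)

/-- A bound for the values of all expressions. -/
def cap : ForProg → Bd
  | skip => ⟨0, 0, 0⟩
  | setN _ e => e.cap cv ca
  | setB _ e => e.cap cv ca
  | setA _ i e => (i.cap cv ca).add (e.cap cv ca)
  | setR _ i e => (i.cap cv ca).add (e.cap cv ca)
  | seq p q => p.cap.add q.cap
  | ite b p q => (b.cap cv ca).add (p.cap.add q.cap)
  | for_ _ y p => p.cap.add ((cv y).add ⟨1, 0, 0⟩)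

/-- A bound for the running time. -/
def time : ForProg → Bd
  | skip => ⟨1, 0, 0⟩
  | setN _ e => ⟨e.cost + 1, 0, 0⟩
  | setB _ e => ⟨e.cost + 1, 0, 0⟩
  | setA _ i e => ⟨i.cost + e.cost + 1, 0, 0⟩
  | setR _ i e => ⟨i.cost + e.cost + 1, 0, 0⟩
  | seq p q => p.time.add q.time
  | ite b p q => Bd.add ⟨b.cost + 1, 0, 0⟩ (p.time.add q.time)
  -- Each round pays 4 for the test and 4 for the increment besides the body; setting the counter
  -- costs 2 and the last, failing test 4.
  | for_ _ y p => ((cv y).mul (p.time.add ⟨8, 0, 0⟩)).add ⟨6, 0, 0⟩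

/-- The static checks: assignments respect the bounds, and loops are counted. -/
def ok : ForProg → Bool
  | skip => true
  | setN x e => (e.bd cv ca).le (cv x)
  | setB _ _ => true
  | setA a _ e => (e.bd cv ca).le (ca a)
  | setR _ _ _ => true
  | seq p q => p.ok && q.ok
  | ite _ p q => p.ok && q.ok
  -- The body may change neither the counter nor its limit, so the machine loop makes exactly the
  -- rounds that `iter` counts.
  | for_ x y p => p.ok && !(p.vars.contains x) && !(p.vars.contains y) && !(Nat.beq y x)
      && (cv y).le (cv x)

/-- There is no assignment that the static analysis ignores. -/
def static : ForProg → Bool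
  | setB _ _ => false
  | seq p q => p.static && q.static
  | ite _ p q => p.static && q.static
  | for_ _ _ p => p.static
  | _ => true

/-- The assignments that the static analysis ignores respect the bounds. -/
def Safe (M n : ℕ) : ForProg → State → Prop
  | setB x e, s => e.eval s ≤ (cv x).val M n
  | seq p q, s => p.Safe M n s ∧ q.Safe M n (p.run s)
  | ite b p q, s => (b.Holds s → p.Safe M n s) ∧ (¬ b.Holds s → q.Safe M n s)
  | for_ x y p, s => ∀ i < s.natVar y, p.Safe M n (iter p.run x s i)
  | _, _ => True

theorem safe_of_static {M n : ℕ} {p : ForProg} (h : p.static = true) (s : State) :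
    p.Safe cv M n s := by
  induction p generalizing s with
  | setB x e => simp [static] at h
  | seq p q ihp ihq =>
    simp only [static, Bool.and_eq_true] at h
    exact ⟨ihp h.1 _, ihq h.2 _⟩
  | ite b p q ihp ihq =>
    simp only [static, Bool.and_eq_true] at h
    exact ⟨fun _ => ihp h.1 _, fun _ => ihq h.2 _⟩
  | for_ x y p ih => exact fun i _ => ih h _
  | _ => trivial

end ForProg

/-- All integers in memory respect the bounds. -/
def Bounded (cv ca : ℕ → Bd) (M n : ℕ) (s : State) : Prop :=
  (∀ x, s.natVar x ≤ (cv x).val M n) ∧ ∀ a i, s.natArr a i ≤ (ca a).val M n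

/-! ### Bounded memories and the cost of compiled programs -/

section

variable {cv ca : ℕ → Bd} {M n W : ℕ} {s : State}

theorem NatExpr.eval_le (hM : 1 ≤ M) (hn : 1 ≤ n) (hs : Bounded cv ca M n s) (e : NatExpr) :
    e.eval s ≤ (e.bd cv ca).val M n := by
  induction e with
  | lit c => simp [eval, bd, Bd.val_const]
  | var x => exact hs.1 x
  | get a i _ => exact hs.2 a _
  | add e f he hf => exact (add_le_add he hf).trans (Bd.add_le_val hM hn _ _)
  | sub e f he _ => exact (Nat.sub_le _ _).trans he
  | mul e f he hf => rw [bd, Bd.mul_val]; exact Nat.mul_le_mul he hf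
  | div e f he _ => exact (Nat.div_le_self _ _).trans he

theorem NatExpr.fits (hM : 1 ≤ M) (hn : 1 ≤ n) (hs : Bounded cv ca M n s) (e : NatExpr)
    (hW : (e.cap cv ca).val M n < W) : e.Fits W s := by
  induction e with
  | lit c => simpa [Fits, cap, Bd.val_const] using hW
  | var x => exact (hs.1 x).trans_lt hW
  | get a i ih =>
    have := Bd.add_le_val hM hn (i.cap cv ca) (ca a)
    rw [cap] at hW
    have h2 := hs.2 a (i.eval s)
    exact ⟨ih (by omega), by omega⟩
  | add e f he hf =>
    rw [cap] at hW
    have h1 := Bd.add_le_val hM hn (e.cap cv ca) (f.cap cv ca)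
    have h2 := Bd.add_le_val hM hn ((e.cap cv ca).add (f.cap cv ca))
      ((e.bd cv ca).add (f.bd cv ca))
    have h3 := NatExpr.eval_le hM hn hs (e.add f)
    rw [bd, eval] at h3
    exact ⟨he (by omega), hf (by omega), by omega⟩
  | mul e f he hf =>
    rw [cap] at hW
    have h1 := Bd.add_le_val hM hn (e.cap cv ca) (f.cap cv ca)
    have h2 := Bd.add_le_val hM hn ((e.cap cv ca).add (f.cap cv ca))
      ((e.bd cv ca).mul (f.bd cv ca))
    have h3 := NatExpr.eval_le hM hn hs (e.mul f)
    rw [bd, eval] at h3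
    exact ⟨he (by omega), hf (by omega), by omega⟩
  | sub e f he hf =>
    rw [cap] at hW
    have h1 := Bd.add_le_val hM hn (e.cap cv ca) (f.cap cv ca)
    exact ⟨he (by omega), hf (by omega)⟩
  | div e f he hf =>
    rw [cap] at hW
    have h1 := Bd.add_le_val hM hn (e.cap cv ca) (f.cap cv ca)
    exact ⟨he (by omega), hf (by omega)⟩

theorem RealExpr.fits (hM : 1 ≤ M) (hn : 1 ≤ n) (hs : Bounded cv ca M n s) (e : RealExpr)
    (hW : (e.cap cv ca).val M n < W) : e.Fits W s := by
  induction e with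
  | zero => trivial
  | var x => trivial
  | get a i => exact i.fits hM hn hs hW
  | add e f he hf =>
    have h1 := Bd.add_le_val hM hn (e.cap cv ca) (f.cap cv ca)
    rw [cap] at hW
    exact ⟨he (by omega), hf (by omega)⟩
  | sub e f he hf =>
    have h1 := Bd.add_le_val hM hn (e.cap cv ca) (f.cap cv ca)
    rw [cap] at hW
    exact ⟨he (by omega), hf (by omega)⟩

theorem Test.fits (hM : 1 ≤ M) (hn : 1 ≤ n) (hs : Bounded cv ca M n s) (b : Test)
    (hW : (b.cap cv ca).val M n < W) : b.Fits W s := by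
  induction b with
  | natEq e f =>
    have h1 := Bd.add_le_val hM hn (e.cap cv ca) (f.cap cv ca)
    rw [cap] at hW
    exact ⟨e.fits hM hn hs (by omega), f.fits hM hn hs (by omega)⟩
  | natLt e f =>
    have h1 := Bd.add_le_val hM hn (e.cap cv ca) (f.cap cv ca)
    rw [cap] at hW
    exact ⟨e.fits hM hn hs (by omega), f.fits hM hn hs (by omega)⟩
  | realLt e f =>
    have h1 := Bd.add_le_val hM hn (e.cap cv ca) (f.cap cv ca)
    rw [cap] at hW
    exact ⟨e.fits hM hn hs (by omega), f.fits hM hn hs (by omega)⟩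
  | not b ih => exact ih hW
  | and b c hb hc =>
    have h1 := Bd.add_le_val hM hn (b.cap cv ca) (c.cap cv ca)
    rw [cap] at hW
    exact ⟨hb (by omega), hc (by omega)⟩

theorem Bounded.setVar (hs : Bounded cv ca M n s) {x v : ℕ} (hv : v ≤ (cv x).val M n) :
    Bounded cv ca M n (s.setVar x v) := by
  refine ⟨fun y => ?_, hs.2⟩
  by_cases h : y = x
  · subst h; simpa using hv
  · rw [setVar_natVar_of_ne _ _ h]; exact hs.1 y

/-- Programs that pass the static checks run within the bounds. -/
theorem ForProg.runs (hM : 1 ≤ M) (hn : 1 ≤ n) (p : ForProg) (hok : p.ok cv ca = true)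
    (hW : (p.cap cv ca).val M n < W) (hs : Bounded cv ca M n s) (hsafe : p.Safe cv M n s) :
    ∃ t, Runs W p.compile s t (p.run s) ∧ t ≤ (p.time cv).val M n ∧
      Bounded cv ca M n (p.run s) := by
  induction p generalizing s with
  | skip => exact ⟨1, .skip s, by simp [time, Bd.val_const], hs⟩
  | setN x e =>
    rw [time, Bd.val_const]
    refine ⟨_, .setNat x e s (e.fits hM hn hs hW), le_rfl, hs.setVar ?_⟩
    exact (e.eval_le hM hn hs).trans (Bd.val_le hM hn hok)
  | setB x e =>
    rw [time, Bd.val_const]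
    exact ⟨_, .setNat x e s (e.fits hM hn hs hW), le_rfl, hs.setVar hsafe⟩
  | setA a i e =>
    rw [cap] at hW
    rw [time, Bd.val_const]
    have h2 := Bd.add_le_val hM hn (i.cap cv ca) (e.cap cv ca)
    refine ⟨_, .setNatArr a i e s (i.fits hM hn hs (by omega)) (e.fits hM hn hs (by omega)),
      le_rfl, hs.1, fun b j => ?_⟩
    by_cases h : b = a
    · subst h
      simp only [run, updateArr_apply]
      split_ifs
      · exact (e.eval_le hM hn hs).trans (Bd.val_le hM hn hok)
      · exact hs.2 b j
    · simp only [run, updateArr_of_ne _ _ _ h]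
      exact hs.2 b j
  | setR a i e =>
    rw [cap] at hW
    rw [time, Bd.val_const]
    have h2 := Bd.add_le_val hM hn (i.cap cv ca) (e.cap cv ca)
    exact ⟨_, .setRealArr a i e s (i.fits hM hn hs (by omega)) (e.fits hM hn hs (by omega)),
      le_rfl, hs⟩
  | seq p q ihp ihq =>
    rw [cap] at hW
    rw [time]
    have h1 := Bd.add_le_val hM hn (p.cap cv ca) (q.cap cv ca)
    have h2 := Bd.add_le_val hM hn (p.time cv) (q.time cv)
    simp only [ok, Bool.and_eq_true] at hok
    obtain ⟨t, ht, htle, hb⟩ := ihp hok.1 (by omega) hs hsafe.1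
    obtain ⟨t', ht', htle', hb'⟩ := ihq hok.2 (by omega) hb hsafe.2
    exact ⟨t + t', .seq ht ht', by omega, hb'⟩
  | ite b p q ihp ihq =>
    rw [cap] at hW
    rw [time]
    have h1 := Bd.add_le_val hM hn (b.cap cv ca) ((p.cap cv ca).add (q.cap cv ca))
    have h3 := Bd.add_le_val hM hn (p.cap cv ca) (q.cap cv ca)
    have h2 := Bd.add_le_val hM hn ⟨b.cost + 1, 0, 0⟩ ((p.time cv).add (q.time cv))
    have h4 := Bd.add_le_val hM hn (p.time cv) (q.time cv)
    rw [Bd.val_const] at h2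
    simp only [ok, Bool.and_eq_true] at hok
    have hf := b.fits hM hn hs (W := W) (by omega)
    rw [run]
    split_ifs with hb
    · obtain ⟨t, ht, htle, hb'⟩ := ihp hok.1 (by omega) hs (hsafe.1 hb)
      exact ⟨_, .condTrue hf hb ht, by omega, hb'⟩
    · obtain ⟨t, ht, htle, hb'⟩ := ihq hok.2 (by omega) hs (hsafe.2 hb)
      exact ⟨_, .condFalse hf hb ht, by omega, hb'⟩
  | for_ x y p ih =>
    simp only [ok, Bool.and_eq_true, Bool.not_eq_true', List.contains_eq_mem,
      decide_eq_false_iff_not] at hok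
    obtain ⟨⟨⟨⟨hok, hx⟩, hy⟩, hyx⟩, hle⟩ := hok
    have hyx : y ≠ x := fun h => by simp [h] at hyx
    have hle := Bd.val_le hM hn hle
    rw [cap] at hW
    rw [time]
    have h1 := Bd.add_le_val hM hn (p.cap cv ca) ((cv y).add ⟨1, 0, 0⟩)
    have h3 := Bd.add_le_val hM hn (cv y) ⟨1, 0, 0⟩
    have h4 := Bd.add_le_val hM hn (p.time cv) ⟨8, 0, 0⟩
    have h2 := Bd.add_le_val hM hn ((cv y).mul ((p.time cv).add ⟨8, 0, 0⟩)) ⟨6, 0, 0⟩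
    have h5 := Bd.mul_val (M := M) (n := n) (cv y) ((p.time cv).add ⟨8, 0, 0⟩)
    rw [Bd.val_const] at h2 h3 h4
    generalize hB : (p.time cv).val M n = B at *
    generalize hY : (cv y).val M n = Y at *
    have h6 := Nat.mul_le_mul_left Y h4
    rw [← h5] at h6
    set N := s.natVar y with hN
    have hNY : N ≤ Y := hY ▸ hs.1 y
    -- Induction on the number k of rounds that remain: each costs at most B + 8, and the failing
    -- test at the end costs 4.
    have key : ∀ k i, i + k = N → Bounded cv ca M n (iter p.run x s i) →
        ∃ t, Runs W (.loop (.natLt (.var x) (.var y))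
          (.seq p.compile (.setNat x (.add (.var x) (.lit 1))))) (iter p.run x s i) t
          (iter p.run x s N) ∧ t ≤ k * (B + 8) + 4 ∧ Bounded cv ca M n (iter p.run x s N) := by
      intro k
      induction k with
      | zero =>
        intro i hi hb
        obtain rfl : i = N := by omega
        refine ⟨_, .loopDone ⟨?_, ?_⟩ ?_, ?_, hb⟩
        · simp only [NatExpr.Fits, iter_natVar]; omega
        · simp only [NatExpr.Fits, iter_natVar_of_notMem p s _ hyx hy]; omega
        · simp only [Test.Holds, NatExpr.eval, iter_natVar, iter_natVar_of_notMem p s _ hyx hy]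
          omega
        · simp [Test.cost, NatExpr.cost]
      | succ k ihk =>
        intro i hi hb
        obtain ⟨t, ht, htle, hb'⟩ := ih hok (by omega) hb (hsafe i (by omega))
        have hxv : (p.run (iter p.run x s i)).natVar x = i := by
          rw [(p.agree_run _).1 x hx, iter_natVar]
        have hb2 : Bounded cv ca M n (iter p.run x s (i + 1)) := hb'.setVar (by omega)
        obtain ⟨t', ht', htle', hb3⟩ := ihk (i + 1) (by omega) hb2
        have hstep : Runs W (.setNat x (.add (.var x) (.lit 1))) (p.run (iter p.run x s i)) 4
            (iter p.run x s (i + 1)) := by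
          have := Runs.setNat (W := W) x (.add (.var x) (.lit 1)) (p.run (iter p.run x s i))
            ⟨by simp only [NatExpr.Fits, hxv]; omega, by simp only [NatExpr.Fits]; omega,
              by simp only [NatExpr.eval, hxv]; omega⟩
          simp only [NatExpr.eval, hxv, NatExpr.cost] at this
          exact this
        refine ⟨_, .loopStep ⟨?_, ?_⟩ ?_ (.seq ht hstep) ht', ?_, hb3⟩
        · simp only [NatExpr.Fits, iter_natVar]; omega
        · simp only [NatExpr.Fits, iter_natVar_of_notMem p s _ hyx hy]; omega
        · simp only [Test.Holds, NatExpr.eval, iter_natVar, iter_natVar_of_notMem p s _ hyx hy]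
          omega
        · simp only [Test.cost, NatExpr.cost]
          rw [Nat.succ_mul]
          omega
    obtain ⟨t, ht, htle, hb⟩ := key N 0 (by omega) (hs.setVar (by omega))
    refine ⟨_, .seq (.setNat x (.lit 0) s (by simp only [NatExpr.Fits]; omega)) ht, ?_, hb⟩
    have h7 : N * (B + 8) ≤ Y * (B + 8) := Nat.mul_le_mul_right _ hNY
    simp only [NatExpr.cost]
    omega

end

end RAM

/-! ## Walks as lists of steps -/

namespace MixedGraph

variable {V : Type} {G : MixedGraph V}

/-- `G.Steps u l v`: following the links in `l`, each listed with the vertex it leads to, is a walk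
from `u` to `v`. -/
def Steps (G : MixedGraph V) : V → List ((Sym2 V ⊕ V × V) × V) → V → Prop
  | u, [], v => u = v
  | u, p :: l, v => G.Joins p.1 u p.2 ∧ G.Steps p.2 l v

/-- The weight of a list of steps. -/
def wt (G : MixedGraph V) (l : List ((Sym2 V ⊕ V × V) × V)) : ℝ :=
  (l.map fun p => G.weight p.1).sum

/-- Undirected edges of negative weight. -/
def IsNeg (G : MixedGraph V) : Sym2 V ⊕ V × V → Prop
  | .inl e => G.edgeWeight e < 0
  | .inr _ => False

/-- No negative edge is used twice. -/
def NegOnce (G : MixedGraph V) (l : List ((Sym2 V ⊕ V × V) × V)) : Prop :=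
  l.Pairwise fun p q => G.IsNeg p.1 → p.1 ≠ q.1

theorem steps_append {u v : V} {l m : List ((Sym2 V ⊕ V × V) × V)} :
    G.Steps u (l ++ m) v ↔ ∃ x, G.Steps u l x ∧ G.Steps x m v := by
  induction l generalizing u with
  | nil => simp [Steps]
  | cons p l ih =>
    simp only [List.cons_append, Steps, ih]
    constructor
    · rintro ⟨h, x, h1, h2⟩; exact ⟨x, ⟨h, h1⟩, h2⟩
    · rintro ⟨x, ⟨h, h1⟩, h2⟩; exact ⟨h, x, h1, h2⟩

theorem Steps.append {u v w : V} {l m : List ((Sym2 V ⊕ V × V) × V)} (h : G.Steps u l v)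
    (h' : G.Steps v m w) : G.Steps u (l ++ m) w :=
  steps_append.2 ⟨v, h, h'⟩

@[simp] theorem wt_nil : G.wt [] = 0 := rfl

@[simp] theorem wt_cons (p : (Sym2 V ⊕ V × V) × V) (l) : G.wt (p :: l) = G.weight p.1 + G.wt l := by
  simp [wt]

@[simp] theorem wt_append (l m : List ((Sym2 V ⊕ V × V) × V)) :
    G.wt (l ++ m) = G.wt l + G.wt m := by
  simp [wt]

theorem Steps.exists_walk {u v : V} {l : List ((Sym2 V ⊕ V × V) × V)} (h : G.Steps u l v) :
    ∃ p : G.Walk u v, p.support = u :: l.map Prod.snd ∧ p.links = l.map Prod.fst := by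
  induction l generalizing u with
  | nil => obtain rfl : u = v := h; exact ⟨.nil u, rfl, rfl⟩
  | cons a l ih =>
    obtain ⟨p, h1, h2⟩ := ih h.2
    exact ⟨.cons a.1 h.1 p, by simp [Walk.support, h1], by simp [Walk.links, h2]⟩

theorem Walk.exists_steps {u v : V} (p : G.Walk u v) :
    ∃ l, G.Steps u l v ∧ p.support = u :: l.map Prod.snd ∧ p.links = l.map Prod.fst := by
  induction p with
  | nil v => exact ⟨[], rfl, rfl, rfl⟩
  | @cons u v w a h p ih =>
    obtain ⟨l, h0, h1, h2⟩ := ih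
    exact ⟨(a, v) :: l, ⟨h, h0⟩, by simp [Walk.support, h1], by simp [Walk.links, h2]⟩

theorem Walk.weight_eq {u v : V} {p : G.Walk u v} {l : List ((Sym2 V ⊕ V × V) × V)}
    (h : p.links = l.map Prod.fst) : p.weight = G.wt l := by
  simp [Walk.weight, wt, h, Function.comp_def]

theorem reachable_iff {u v : V} :
    G.Reachable u v ↔ ∃ l, G.Steps u l v ∧ (u :: l.map Prod.snd).Nodup := by
  constructor
  · rintro ⟨p, hp⟩
    obtain ⟨l, h0, h1, h2⟩ := p.exists_steps
    exact ⟨l, h0, h1 ▸ hp⟩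
  · rintro ⟨l, h, hl⟩
    obtain ⟨p, h1, h2⟩ := h.exists_walk
    exact ⟨p, by rw [Walk.IsPath, h1]; exact hl⟩

theorem isDistance_iff {u v : V} {d : ℝ} :
    G.IsDistance u v d ↔ (∃ l, G.Steps u l v ∧ (u :: l.map Prod.snd).Nodup ∧ G.wt l = d) ∧
      ∀ l, G.Steps u l v → (u :: l.map Prod.snd).Nodup → d ≤ G.wt l := by
  constructor
  · rintro ⟨⟨p, hp, hw⟩, hmin⟩
    obtain ⟨l, h0, h1, h2⟩ := p.exists_steps
    refine ⟨⟨l, h0, h1 ▸ hp, by rw [← Walk.weight_eq h2, hw]⟩, fun m hm hnd => ?_⟩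
    obtain ⟨q, h3, h4⟩ := hm.exists_walk
    exact hmin ⟨q, by rw [Walk.IsPath, h3]; exact hnd, Walk.weight_eq h4⟩
  · rintro ⟨⟨l, h, hl, hw⟩, hmin⟩
    obtain ⟨p, h1, h2⟩ := h.exists_walk
    refine ⟨⟨p, by rw [Walk.IsPath, h1]; exact hl, by rw [Walk.weight_eq h2, hw]⟩, ?_⟩
    rintro w ⟨q, hq, rfl⟩
    obtain ⟨m, h3, h4, h5⟩ := q.exists_steps
    rw [Walk.weight_eq h5]
    exact hmin m h3 (h4 ▸ hq)

theorem Steps.mem_of_ne_nil {u v : V} {l : List ((Sym2 V ⊕ V × V) × V)} (h : G.Steps u l v)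
    (hl : l ≠ []) : v ∈ l.map Prod.snd := by
  induction l generalizing u with
  | nil => exact absurd rfl hl
  | cons p l ih =>
    by_cases hl' : l = []
    · subst hl'; have : p.2 = v := h.2; simp [this]
    · exact List.mem_cons_of_mem _ (ih h.2 hl')

theorem Steps.getLast_eq {u v : V} {l : List ((Sym2 V ⊕ V × V) × V)} (h : G.Steps u l v)
    (hl : l ≠ []) : (l.getLast hl).2 = v := by
  induction l generalizing u with
  | nil => exact absurd rfl hl
  | cons p l ih =>
    by_cases hl' : l = []
    · subst hl'; exact h.2
    · rw [List.getLast_cons hl']; exact ih h.2 hl'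

theorem Steps.eq_nil {v : V} {l : List ((Sym2 V ⊕ V × V) × V)} (h : G.Steps v l v)
    (hl : (v :: l.map Prod.snd).Nodup) : l = [] := by
  by_contra hne
  exact (List.nodup_cons.1 hl).1 (h.mem_of_ne_nil hne)

theorem Joins.ne {a : Sym2 V ⊕ V × V} {u v : V} (h : G.Joins a u v) : u ≠ v := by
  rintro rfl
  cases a with
  | inl e => exact G.edges.irrefl h.1
  | inr e => exact G.arcs_loopless u h.1

theorem Joins.isNeg_adj {a : Sym2 V ⊕ V × V} {u v : V} (h : G.Joins a u v) (ha : G.IsNeg a) :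
    G.negEdges.Adj u v ∧ a = .inl s(u, v) := by
  cases a with
  | inl e => obtain ⟨h1, rfl⟩ := h; exact ⟨⟨h1, ha⟩, rfl⟩
  | inr e => exact absurd ha id

theorem negEdges_adj_joins {u v : V} (h : G.negEdges.Adj u v) :
    G.Joins (.inl s(u, v)) u v ∧ G.IsNeg (.inl s(u, v)) :=
  ⟨⟨h.1, rfl⟩, h.2⟩

/-! ### Closed walks -/

theorem exists_split_of_not_nodup_map {α β : Type*} {f : α → β} {l : List α}
    (h : ¬ (l.map f).Nodup) :
    ∃ l₁ a l₂ b l₃, l = l₁ ++ a :: (l₂ ++ b :: l₃) ∧ f a = f b := by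
  induction l with
  | nil => simp at h
  | cons p l ih =>
    by_cases hp : f p ∈ l.map f
    · obtain ⟨b, hb, hfb⟩ := List.mem_map.1 hp
      obtain ⟨l₂, l₃, rfl⟩ := List.append_of_mem hb
      exact ⟨[], p, l₂, b, l₃, rfl, hfb.symm⟩
    · have : ¬ (l.map f).Nodup := fun h' => h (by simpa using ⟨by simpa using hp, h'⟩)
      obtain ⟨l₁, a, l₂, b, l₃, rfl, hab⟩ := ih this
      exact ⟨p :: l₁, a, l₂, b, l₃, rfl, hab⟩

/-- Cycles as lists of steps: closed walks without repeated vertices that do not go back and forth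
along one edge. -/
def Cyc (G : MixedGraph V) (v : V) (l : List ((Sym2 V ⊕ V × V) × V)) : Prop :=
  G.Steps v l v ∧ l ≠ [] ∧ (l.map Prod.snd).Nodup ∧
    ∀ e x y, l ≠ [(Sum.inl e, x), (Sum.inl e, y)]

/-- An arc, or an edge used twice in the same direction, would repeat its head. If an edge is used
from u to x and later from x to u, distinctness of the vertices leaves no room for links before,
between or after, and what remains is the excluded walk back and forth. -/
theorem Cyc.links_nodup {v : V} {l : List ((Sym2 V ⊕ V × V) × V)} (h : G.Cyc v l) :
    (l.map Prod.fst).Nodup := by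
  by_contra hnd
  obtain ⟨h1, hne, h2, h3⟩ := h
  obtain ⟨l₁, ⟨a, x⟩, l₂, ⟨b, y⟩, l₃, rfl, hab⟩ := exists_split_of_not_nodup_map hnd
  dsimp only at hab
  subst hab
  obtain ⟨u, hu, hux, h1⟩ := steps_append.1 h1
  obtain ⟨w, hw, hwy, hy1⟩ := steps_append.1 h1
  dsimp only at hux hwy hy1 hw
  simp only [List.map_append, List.map_cons, List.nodup_append, List.nodup_cons,
    List.mem_append, List.mem_cons, not_or] at h2
  obtain ⟨-, ⟨⟨hx2, hxy, hx3⟩, -, ⟨hy3, -⟩, h23⟩, h123⟩ := h2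
  cases a with
  | inr e => exact hxy (Prod.ext_iff.1 (hux.2.symm.trans hwy.2)).2
  | inl e =>
    have he : s(u, x) = s(w, y) := hux.2.symm.trans hwy.2
    rcases Sym2.eq_iff.1 he with ⟨-, h⟩ | ⟨rfl, rfl⟩
    · exact hxy h
    · have hl2 : l₂ = [] := by
        by_contra hl; exact hx2 (hw.mem_of_ne_nil hl)
      have hl1 : l₁ = [] := by
        by_contra hl
        exact h123 _ (hu.mem_of_ne_nil hl) u (by simp) rfl
      subst hl1 hl2
      obtain rfl : v = u := hu
      have hl3 : l₃ = [] := by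
        by_contra hl; exact hy3 (hy1.mem_of_ne_nil hl)
      subst hl3
      exact h3 e _ _ rfl

theorem conservative_iff : G.Conservative ↔ ∀ v l, G.Cyc v l → 0 ≤ G.wt l := by
  constructor
  · intro hG v l hl
    obtain ⟨p, h1, h2⟩ := hl.1.exists_walk
    rw [← Walk.weight_eq h2]
    refine hG v p ⟨by simpa [h2] using hl.2.1, by simpa [h1] using hl.2.2.1, ?_⟩
    rw [h2]
    exact hl.links_nodup
  · intro h v p hp
    obtain ⟨l, h0, h1, h2⟩ := p.exists_steps
    obtain ⟨hne, hs, hl⟩ := hp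
    rw [Walk.weight_eq h2]
    refine h v l ⟨h0, by rintro rfl; simp [h2] at hne, by simpa [h1] using hs, ?_⟩
    rintro e x y rfl
    simp [h2] at hl

/-- The repetition is looked for in the tail of the walk first. Only if the tail repeats nothing is
the starting vertex the repeated one, and then the closed part inherits distinct vertices from the
tail. -/
theorem exists_closed {u v : V} {l : List ((Sym2 V ⊕ V × V) × V)} (h : G.Steps u l v)
    (hl : ¬ (u :: l.map Prod.snd).Nodup) :
    ∃ l₁ l₂ l₃ x, l = l₁ ++ l₂ ++ l₃ ∧ l₂ ≠ [] ∧ G.Steps u l₁ x ∧ G.Steps x l₂ x ∧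
      G.Steps x l₃ v ∧ (l₂.map Prod.snd).Nodup := by
  induction l generalizing u with
  | nil => simp at hl
  | cons p l ih =>
    by_cases hnd : (p.2 :: l.map Prod.snd).Nodup
    · have hu : u ∈ (p :: l).map Prod.snd := by
        by_contra hu
        exact hl (List.nodup_cons.2 ⟨hu, hnd⟩)
      obtain ⟨q, hq, rfl⟩ := List.mem_map.1 hu
      obtain ⟨m, m', hm⟩ := List.append_of_mem hq
      have hm' : p :: l = (m ++ [q]) ++ m' := by simp [hm]
      have hnd' : ((p :: l).map Prod.snd).Nodup := hnd
      rw [hm'] at hnd' h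
      obtain ⟨x, h1, h2⟩ := steps_append.1 h
      obtain rfl : x = q.2 := by
        have := h1.getLast_eq (by simp)
        simpa using this.symm
      refine ⟨[], m ++ [q], m', q.2, by simpa using hm, by simp, rfl, h1, h2, ?_⟩
      rw [List.map_append] at hnd'
      exact (List.nodup_append.1 hnd').1
    · obtain ⟨l₁, l₂, l₃, x, rfl, h1, h2, h3, h4, h5⟩ := ih h.2 hnd
      exact ⟨p :: l₁, l₂, l₃, x, by simp, h1, ⟨h.1, h2⟩, h3, h4, h5⟩

/-- In a conservative graph, a walk that uses no negative edge twice is at least as heavy as some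
path. -/
theorem exists_path_le (hG : G.Conservative) {u v : V} {l : List ((Sym2 V ⊕ V × V) × V)}
    (h : G.Steps u l v) (hl : G.NegOnce l) :
    ∃ m, G.Steps u m v ∧ (u :: m.map Prod.snd).Nodup ∧ G.wt m ≤ G.wt l := by
  induction hk : l.length using Nat.strong_induction_on generalizing l with
  | _ k ih =>
    by_cases hnd : (u :: l.map Prod.snd).Nodup
    · exact ⟨l, h, hnd, le_rfl⟩
    · obtain ⟨l₁, l₂, l₃, x, rfl, hne, h1, h2, h3, h4⟩ := exists_closed h hnd
      have hlen : 0 < l₂.length := List.length_pos_iff.2 hne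
      obtain ⟨m, hm, hm', hle⟩ := ih (l₁ ++ l₃).length (by simp at hk ⊢; omega) (h1.append h3)
        (hl.sublist (by simp)) rfl
      refine ⟨m, hm, hm', hle.trans ?_⟩
      have hn2 : G.NegOnce l₂ := hl.sublist
        ((List.sublist_append_right l₁ l₂).trans (List.sublist_append_left _ _))
      -- The closed part is either a cycle or goes back and forth along one edge; in the second case
      -- the edge is not negative, since no negative edge is used twice.
      have : 0 ≤ G.wt l₂ := by
        by_cases hb : ∀ e x y, l₂ ≠ [(Sum.inl e, x), (Sum.inl e, y)]
        · exact conservative_iff.1 hG x l₂ ⟨h2, hne, h4, hb⟩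
        · push Not at hb
          obtain ⟨e, x, y, rfl⟩ := hb
          have : ¬ G.IsNeg (.inl e) := fun he => by
            have := List.pairwise_cons.1 hn2
            exact this.1 (.inl e, y) (by simp) he rfl
          have : 0 ≤ G.weight (.inl e) := not_lt.1 this
          simp only [wt_cons, wt_nil]
          linarith
      simp only [wt_append]
      linarith

theorem wt_nonneg_of_closed (hG : G.Conservative) {u : V} {l : List ((Sym2 V ⊕ V × V) × V)}
    (h : G.Steps u l u) (hl : G.NegOnce l) : 0 ≤ G.wt l := by
  obtain ⟨m, hm, hm', hle⟩ := exists_path_le hG h hl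
  rwa [hm.eq_nil hm', wt_nil] at hle

theorem negOnce_of_forall_not {l : List ((Sym2 V ⊕ V × V) × V)} (h : ∀ p ∈ l, ¬ G.IsNeg p.1) :
    G.NegOnce l := by
  refine List.Pairwise.imp_of_mem (R := fun _ _ => True) (fun {p q} hp _ _ hn => absurd hn (h p hp))
    (List.pairwise_of_forall fun _ _ => trivial)

theorem negOnce_append {l m : List ((Sym2 V ⊕ V × V) × V)} :
    G.NegOnce (l ++ m) ↔ G.NegOnce l ∧ G.NegOnce m ∧
      ∀ p ∈ l, ∀ q ∈ m, G.IsNeg p.1 → p.1 ≠ q.1 :=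
  List.pairwise_append

theorem Steps.source_mem {u v : V} {l : List ((Sym2 V ⊕ V × V) × V)} (h : G.Steps u l v)
    {a : Sym2 V ⊕ V × V} {x : V} (hp : (a, x) ∈ l) :
    ∃ y ∈ u :: l.map Prod.snd, G.Joins a y x := by
  induction l generalizing u with
  | nil => simp at hp
  | cons q l ih =>
    rcases List.mem_cons.1 hp with rfl | hp
    · exact ⟨u, by simp, h.1⟩
    · obtain ⟨y, hy, hj⟩ := ih h.2 hp
      exact ⟨y, List.mem_cons_of_mem _ hy, hj⟩

/-- All vertices of an undirected edge used by a walk are on the walk. -/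
theorem Steps.mem_of_mem_edge {u v : V} {l : List ((Sym2 V ⊕ V × V) × V)} (h : G.Steps u l v)
    {e : Sym2 V} (he : Sum.inl e ∈ l.map Prod.fst) {z : V} (hz : z ∈ e) :
    z ∈ u :: l.map Prod.snd := by
  obtain ⟨⟨a, x⟩, hp, rfl⟩ := List.mem_map.1 he
  obtain ⟨y, hy, hj⟩ := h.source_mem hp
  obtain ⟨-, rfl⟩ := hj
  rcases Sym2.mem_iff.1 hz with rfl | rfl
  · exact hy
  · exact List.mem_cons_of_mem _ (List.mem_map.2 ⟨_, hp, rfl⟩)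

theorem Steps.negOnce {u v : V} {l : List ((Sym2 V ⊕ V × V) × V)} (h : G.Steps u l v)
    (hl : (u :: l.map Prod.snd).Nodup) : G.NegOnce l := by
  induction l generalizing u with
  | nil => exact List.Pairwise.nil
  | cons p l ih =>
    refine List.pairwise_cons.2 ⟨fun q hq hp hpq => ?_, ih h.2 (List.nodup_cons.1 hl).2⟩
    obtain ⟨-, hpe⟩ := h.1.isNeg_adj hp
    exact (List.nodup_cons.1 hl).1 (h.2.mem_of_mem_edge (e := s(u, p.2))
      (List.mem_map.2 ⟨q, hq, by rw [← hpq, hpe]⟩) (Sym2.mem_mk_left _ _))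

end MixedGraph

/-! ## Forests of negative edges -/

namespace MixedGraph

variable {V : Type} {G : MixedGraph V}

/-- The steps of a walk along negative edges. -/
def negSteps : {x y : V} → G.negEdges.Walk x y → List ((Sym2 V ⊕ V × V) × V)
  | _, _, .nil => []
  | x, _, .cons (v := v) _ p => (.inl s(x, v), v) :: negSteps p

theorem steps_negSteps {x y : V} (p : G.negEdges.Walk x y) : G.Steps x (negSteps p) y := by
  induction p with
  | nil => rfl
  | cons h p ih => exact ⟨(negEdges_adj_joins h).1, ih⟩

theorem cons_map_negSteps {x y : V} (p : G.negEdges.Walk x y) :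
    x :: (negSteps p).map Prod.snd = p.support := by
  induction p with
  | nil => rfl
  | cons h p ih => simp [negSteps, ← ih]

theorem isNeg_of_mem_negSteps {x y : V} (p : G.negEdges.Walk x y)
    {q : (Sym2 V ⊕ V × V) × V} (hq : q ∈ negSteps p) : G.IsNeg q.1 := by
  induction p with
  | nil => simp [negSteps] at hq
  | cons h p ih =>
    rcases List.mem_cons.1 hq with rfl | hq
    · exact (negEdges_adj_joins h).2
    · exact ih hq

theorem Steps.exists_negWalk {x y : V} {l : List ((Sym2 V ⊕ V × V) × V)} (h : G.Steps x l y)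
    (hl : ∀ p ∈ l, G.IsNeg p.1) : ∃ p : G.negEdges.Walk x y, negSteps p = l := by
  induction l generalizing x with
  | nil => obtain rfl : x = y := h; exact ⟨.nil, rfl⟩
  | cons q l ih =>
    obtain ⟨p, hp⟩ := ih h.2 fun p hp => hl p (List.mem_cons_of_mem _ hp)
    obtain ⟨h1, h2⟩ := h.1.isNeg_adj (hl q (by simp))
    exact ⟨.cons h1 p, by rw [negSteps, hp, ← h2]⟩

theorem wt_nonpos {l : List ((Sym2 V ⊕ V × V) × V)} (hl : ∀ p ∈ l, G.IsNeg p.1) :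
    G.wt l ≤ 0 := by
  induction l with
  | nil => simp
  | cons q l ih =>
    have h1 := ih fun p hp => hl p (List.mem_cons_of_mem _ hp)
    have h2 : G.weight q.1 ≤ 0 := by
      have := hl q (by simp)
      obtain ⟨_ | _, _⟩ := q
      · exact le_of_lt this
      · exact absurd this id
    rw [wt_cons]
    linarith

theorem IsNeg.weight_neg {a : Sym2 V ⊕ V × V} (h : G.IsNeg a) : G.weight a < 0 := by
  cases a with
  | inl e => exact h
  | inr e => exact absurd h id

open Classical in
/-- The steps of a path along negative edges. -/
noncomputable def treePath (G : MixedGraph V) (x y : V) : List ((Sym2 V ⊕ V × V) × V) :=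
  if h : G.negEdges.Reachable x y then negSteps (h.some.toPath : G.negEdges.Walk x y) else []

theorem treePath_spec {x y : V} (h : G.negEdges.Reachable x y) :
    ∃ p : G.negEdges.Walk x y, p.IsPath ∧ G.treePath x y = negSteps p := by
  classical
  refine ⟨_, h.some.toPath.2, ?_⟩
  rw [treePath, dif_pos h]

theorem treePath_eq (hac : G.negEdges.IsAcyclic) {x y : V} {p : G.negEdges.Walk x y}
    (hp : p.IsPath) : G.treePath x y = negSteps p := by
  obtain ⟨q, hq, h⟩ := treePath_spec ⟨p⟩
  rw [h, show q = p from congrArg Subtype.val ((hac.subsingleton_path _ _).elim ⟨q, hq⟩ ⟨p, hp⟩)]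

theorem isNeg_of_mem_treePath {x y : V} {q : (Sym2 V ⊕ V × V) × V}
    (hq : q ∈ G.treePath x y) : G.IsNeg q.1 := by
  by_cases h : G.negEdges.Reachable x y
  · obtain ⟨p, -, hp⟩ := treePath_spec h
    exact isNeg_of_mem_negSteps p (hp ▸ hq)
  · rw [treePath, dif_neg h] at hq; simp at hq

theorem steps_treePath {x y : V} (h : G.negEdges.Reachable x y) :
    G.Steps x (G.treePath x y) y := by
  obtain ⟨p, -, hp⟩ := treePath_spec h
  exact hp ▸ steps_negSteps p

theorem nodup_treePath {x y : V} (h : G.negEdges.Reachable x y) :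
    (x :: (G.treePath x y).map Prod.snd).Nodup := by
  obtain ⟨p, hp, he⟩ := treePath_spec h
  rw [he, cons_map_negSteps]
  exact hp.support_nodup

theorem reachable_of_mem_treePath {x y z : V} (h : G.negEdges.Reachable x y)
    (hz : z ∈ x :: (G.treePath x y).map Prod.snd) : G.negEdges.Reachable x z := by
  classical
  obtain ⟨p, hp, he⟩ := treePath_spec h
  rw [he, cons_map_negSteps] at hz
  exact ⟨p.takeUntil z hz⟩

@[simp] theorem treePath_self (x : V) : G.treePath x x = [] := by
  have h := SimpleGraph.Reachable.refl (G := G.negEdges) x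
  exact (steps_treePath h).eq_nil (nodup_treePath h)

/-- Of two adjacent vertices, one lies on the path from the other one to any third vertex. -/
theorem treePath_adj (hac : G.negEdges.IsAcyclic) {x z y : V} (hxz : G.negEdges.Adj x z)
    (h : G.negEdges.Reachable z y) :
    G.treePath x y = (.inl s(x, z), z) :: G.treePath z y ∨
      G.treePath z y = (.inl s(x, z), x) :: G.treePath x y := by
  classical
  obtain ⟨p, hp, he⟩ := treePath_spec h
  by_cases hx : x ∈ p.support
  · right
    have h1 : (SimpleGraph.Walk.cons hxz.symm (p.dropUntil x hx)).IsPath := by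
      have h2 : p.takeUntil x hx = .cons hxz.symm .nil := by
        refine congrArg Subtype.val ((hac.subsingleton_path _ _).elim ⟨_, hp.takeUntil hx⟩
          ⟨.cons hxz.symm .nil, ?_⟩)
        simpa using hxz.ne'
      have h3 := p.take_spec hx
      rw [h2] at h3
      have h4 : SimpleGraph.Walk.cons hxz.symm (p.dropUntil x hx) = p := h3
      rw [h4]; exact hp
    rw [treePath_eq hac h1, treePath_eq hac (hp.dropUntil hx), negSteps, Sym2.eq_swap]
  · left
    have h1 : (SimpleGraph.Walk.cons hxz p).IsPath := hp.cons hx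
    rw [treePath_eq hac h1, he, negSteps]

/-- The length of a tree path, where the links in `U` count negatively. -/
noncomputable def signedLength (G : MixedGraph V) (U : Set (Sym2 V ⊕ V × V)) (x y : V) : ℝ :=
  open Classical in
  ((G.treePath x y).map fun p => if p.1 ∈ U then G.weight p.1 else -G.weight p.1).sum

theorem le_signedLength (U : Set (Sym2 V ⊕ V × V)) (x y : V) :
    G.wt (G.treePath x y) ≤ G.signedLength U x y := by
  classical
  refine List.sum_le_sum fun p hp => ?_
  have := (isNeg_of_mem_treePath hp).weight_neg
  split_ifs <;> linarith

theorem signedLength_anti {U U' : Set (Sym2 V ⊕ V × V)} (h : U ⊆ U') (x y : V) :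
    G.signedLength U' x y ≤ G.signedLength U x y := by
  classical
  refine List.sum_le_sum fun p hp => ?_
  have := (isNeg_of_mem_treePath hp).weight_neg
  split_ifs with h1 h2 h2
  · exact le_rfl
  · linarith
  · exact absurd (h h2) h1
  · exact le_rfl

/-- Moving the start of a tree path across one edge either prepends or deletes that edge, so the
signed length grows by at most the absolute weight of the edge. This is summed along the path from a
to b. -/
theorem signedLength_triangle (hac : G.negEdges.IsAcyclic) (U : Set (Sym2 V ⊕ V × V)) {a b y : V}
    (h : G.negEdges.Reachable a b) (hby : G.negEdges.Reachable b y) :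
    G.signedLength U a y ≤ -G.wt (G.treePath a b) + G.signedLength U b y := by
  classical
  have key : ∀ {a b : V} (p : G.negEdges.Walk a b), G.negEdges.Reachable b y →
      G.signedLength U a y ≤ -G.wt (negSteps p) + G.signedLength U b y := by
    clear hby h
    intro a b p hby
    induction p with
    | nil => simp [negSteps]
    | @cons a z b hadj p ih =>
      have ih := ih hby
      have hz : G.negEdges.Reachable z y := SimpleGraph.Reachable.trans ⟨p⟩ hby
      have hneg := (negEdges_adj_joins hadj).2.weight_neg
      rw [negSteps, wt_cons]
      dsimp only
      rcases treePath_adj hac hadj hz with h1 | h1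
      · have : G.signedLength U a y = (if Sum.inl s(a, z) ∈ U then G.weight (.inl s(a, z))
            else -G.weight (.inl s(a, z))) + G.signedLength U z y := by
          simp [signedLength, h1]
        rw [this]
        split_ifs <;> linarith
      · have : G.signedLength U z y = (if Sum.inl s(a, z) ∈ U then G.weight (.inl s(a, z))
            else -G.weight (.inl s(a, z))) + G.signedLength U a y := by
          simp [signedLength, h1]
        split_ifs at this <;> linarith
  obtain ⟨p, -, hp⟩ := treePath_spec h
  rw [hp]
  exact key p hby

/-- Every part of the walk between two vertices of a negative tree that starts with another link
and is otherwise outside of the tree is at least as long as the tree path. -/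
def ExcursionsHeavy (G : MixedGraph V) (l : List ((Sym2 V ⊕ V × V) × V)) : Prop :=
  ∀ l₁ q l₂ a b, l = l₁ ++ q ++ l₂ → G.Steps a q b → G.negEdges.Reachable a b →
    (a :: q.map Prod.snd).Nodup → (∀ p ∈ q.head?, ¬ G.IsNeg p.1) →
    (∀ p ∈ q.dropLast, ¬ G.negEdges.Reachable a p.2) → -G.wt (G.treePath a b) ≤ G.wt q

theorem ExcursionsHeavy.infix {l l₁ m l₂ : List ((Sym2 V ⊕ V × V) × V)}
    (h : G.ExcursionsHeavy l) (hl : l = l₁ ++ m ++ l₂) : G.ExcursionsHeavy m := by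
  rintro k₁ q k₂ a b rfl
  exact h (l₁ ++ k₁) q (k₂ ++ l₂) a b (by simp [hl])

theorem exists_first {α : Type*} (P : α → Prop) {l : List α} (h : ∃ p ∈ l, P p) :
    ∃ l₁ a l₂, l = l₁ ++ a :: l₂ ∧ P a ∧ ∀ p ∈ l₁, ¬ P p := by
  induction l with
  | nil => simp at h
  | cons q l ih =>
    by_cases hq : P q
    · exact ⟨[], q, l, rfl, hq, by simp⟩
    · have : ∃ p ∈ l, P p := by
        obtain ⟨p, hp, hP⟩ := h
        rcases List.mem_cons.1 hp with rfl | hp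
        · exact absurd hP hq
        · exact ⟨p, hp, hP⟩
      obtain ⟨l₁, a, l₂, rfl, h1, h2⟩ := ih this
      refine ⟨q :: l₁, a, l₂, rfl, h1, fun p hp => ?_⟩
      rcases List.mem_cons.1 hp with rfl | hp
      · exact hq
      · exact h2 p hp

theorem exists_last {α : Type*} (P : α → Prop) {l : List α} (h : ∃ p ∈ l, P p) :
    ∃ l₁ a l₂, l = l₁ ++ a :: l₂ ∧ P a ∧ ∀ p ∈ l₂, ¬ P p := by
  obtain ⟨l₁, a, l₂, hl, h1, h2⟩ := exists_first P (l := l.reverse) (by simpa using h)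
  refine ⟨l₂.reverse, a, l₁.reverse, ?_, h1, fun p hp => h2 p (by simpa using hp)⟩
  have := congrArg List.reverse hl
  simpa using this

theorem Steps.split_at {u v : V} {l₁ l₂ : List ((Sym2 V ⊕ V × V) × V)}
    {a : (Sym2 V ⊕ V × V) × V} (h : G.Steps u (l₁ ++ a :: l₂) v) :
    G.Steps u (l₁ ++ [a]) a.2 ∧ G.Steps a.2 l₂ v := by
  obtain ⟨x, h1, h2⟩ := steps_append.1 h
  exact ⟨h1.append ⟨h2.1, rfl⟩, h2.2⟩

/-- A path between two vertices of a negative tree is at least as heavy as the tree path. -/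
theorem signedLength_le_wt (hac : G.negEdges.IsAcyclic) {x y : V}
    {l : List ((Sym2 V ⊕ V × V) × V)} (h : G.Steps x l y) (hnd : (x :: l.map Prod.snd).Nodup)
    (hxy : G.negEdges.Reachable x y) (hl : G.ExcursionsHeavy l) :
    G.signedLength {a | a ∈ l.map Prod.fst} x y ≤ G.wt l := by
  classical
  induction hk : l.length using Nat.strong_induction_on generalizing x l with
  | _ k ih =>
    cases l with
    | nil =>
      obtain rfl : x = y := h
      simp [signedLength]
    | cons p l =>
      by_cases hp : G.IsNeg p.1
      · obtain ⟨hadj, he⟩ := h.1.isNeg_adj hp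
        have hy : G.negEdges.Reachable p.2 y := hadj.reachable.symm.trans hxy
        have hl' : G.ExcursionsHeavy l := hl.infix (l₁ := [p]) (l₂ := []) (by simp)
        have h1 := ih l.length (by simp at hk; omega) h.2 (List.nodup_cons.1 hnd).2 hy hl' rfl
        have hsub : {a | a ∈ l.map Prod.fst} ⊆ {a | a ∈ (p :: l).map Prod.fst} :=
          fun a ha => List.mem_cons_of_mem _ ha
        have hp1 : p.1 ∉ l.map Prod.fst := by
          intro hm
          rw [he] at hm
          exact (List.nodup_cons.1 hnd).1 (h.2.mem_of_mem_edge hm (Sym2.mem_mk_left _ _))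
        rw [wt_cons]
        rcases treePath_adj hac hadj hy with h2 | h2
        · have h3 : G.signedLength {a | a ∈ (p :: l).map Prod.fst} x y =
              G.weight p.1 + G.signedLength {a | a ∈ (p :: l).map Prod.fst} p.2 y := by
            simp [signedLength, h2, ← he]
          have h4 := signedLength_anti (G := G) hsub p.2 y
          linarith
        -- Here the path walks away from y. Its rest never uses this edge again, so the edge counts
        -- positively in the signed length from the new vertex and cancels the negative weight of
        -- the step. With the plain weight of the tree path instead of the signed length, the
        -- induction would fail here.
        · have h3 : G.signedLength {a | a ∈ l.map Prod.fst} p.2 y =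
              -G.weight p.1 + G.signedLength {a | a ∈ l.map Prod.fst} x y := by
            rw [signedLength, h2, List.map_cons, List.sum_cons, ← he]
            rw [if_neg (by exact hp1)]
            rfl
          have h4 := signedLength_anti (G := G) hsub x y
          linarith
      -- The path leaves along another link. Up to its first return b to the tree it is a heavy
      -- excursion, which pays for moving the start from x to b in the triangle inequality.
      · have hyl : ∃ q ∈ p :: l, G.negEdges.Reachable x q.2 := by
          obtain ⟨q, hq, rfl⟩ := List.mem_map.1 (h.mem_of_ne_nil (by simp))
          exact ⟨q, hq, hxy⟩
        obtain ⟨l₁, b, l₂, hpl, hb, hl₁⟩ := exists_first _ hyl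
        have hpl' : p :: l = (l₁ ++ [b]) ++ l₂ := by simp [hpl]
        have hst := h
        rw [hpl] at hst
        obtain ⟨hq, h2⟩ := hst.split_at
        have hnd' := hnd
        rw [hpl', List.map_append, ← List.cons_append] at hnd'
        have hby : G.negEdges.Reachable b.2 y := hb.symm.trans hxy
        have hQ : -G.wt (G.treePath x b.2) ≤ G.wt (l₁ ++ [b]) := by
          refine hl [] (l₁ ++ [b]) l₂ x b.2 (by simpa using hpl) hq hb
            (List.nodup_append.1 hnd').1 ?_ (by simpa using hl₁)
          have : (l₁ ++ [b]).head? = some p := by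
            cases l₁ with
            | nil => simpa using (List.cons.inj hpl).1.symm
            | cons c l₁ => simpa using (List.cons.inj hpl).1.symm
          rw [this]
          simpa using hp
        have hlen := congrArg List.length hpl
        have hl2 : G.ExcursionsHeavy l₂ := hl.infix (l₁ := l₁ ++ [b]) (l₂ := []) (by simp [hpl])
        have hnd2 : (b.2 :: l₂.map Prod.snd).Nodup := by
          have : b.2 :: l₂.map Prod.snd = (b :: l₂).map Prod.snd := rfl
          rw [this]
          refine List.Nodup.sublist (List.Sublist.map _ ?_) (List.nodup_cons.1 hnd).2
          rw [hpl]
          exact List.sublist_append_right _ _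
        have h1 := ih l₂.length (by simp at hlen hk; omega) h2 hnd2 hby hl2 rfl
        have h3 := signedLength_triangle hac {a | a ∈ (p :: l).map Prod.fst} hb hby
        have h4 : G.signedLength {a | a ∈ (p :: l).map Prod.fst} b.2 y ≤
            G.signedLength {a | a ∈ l₂.map Prod.fst} b.2 y := by
          refine signedLength_anti (fun a ha => ?_) _ _
          have ha : a ∈ l₂.map Prod.fst := ha
          show a ∈ (p :: l).map Prod.fst
          rw [hpl', List.map_append]
          exact List.mem_append_right _ ha
        rw [hpl', wt_append]
        rw [← hpl']
        linarith

/-- This permits replacing the part of a path between two vertices of a tree by the tree path. It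
follows because signs can only increase weights that are all negative. -/
theorem wt_treePath_le (hac : G.negEdges.IsAcyclic) {x y : V}
    {l : List ((Sym2 V ⊕ V × V) × V)} (h : G.Steps x l y) (hnd : (x :: l.map Prod.snd).Nodup)
    (hxy : G.negEdges.Reachable x y) (hl : G.ExcursionsHeavy l) :
    G.wt (G.treePath x y) ≤ G.wt l :=
  (le_signedLength _ x y).trans (signedLength_le_wt hac h hnd hxy hl)

/-- An excursion from a negative tree and the tree path back form a cycle. -/
theorem cyc_append_treePath {a b : V} {q : List ((Sym2 V ⊕ V × V) × V)} (hq : G.Steps a q b)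
    (hab : G.negEdges.Reachable a b) (hnd : (a :: q.map Prod.snd).Nodup) (hne : q ≠ [])
    (hhead : ∀ p ∈ q.head?, ¬ G.IsNeg p.1)
    (hin : ∀ p ∈ q.dropLast, ¬ G.negEdges.Reachable a p.2) :
    G.Cyc a (q ++ G.treePath b a) := by
  have hst := steps_treePath hab.symm
  have hnt := nodup_treePath hab.symm
  refine ⟨hq.append hst, by simp [hne], ?_, ?_⟩
  · rw [List.map_append, List.nodup_append]
    refine ⟨(List.nodup_cons.1 hnd).2, (List.nodup_cons.1 hnt).2, ?_⟩
    rintro x hx y hy rfl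
    have hx' := reachable_of_mem_treePath hab.symm (List.mem_cons_of_mem _ hy)
    rw [← List.dropLast_append_getLast hne, List.map_append, List.mem_append] at hx
    rcases hx with hx | hx
    · obtain ⟨p, hp, rfl⟩ := List.mem_map.1 hx
      exact hin p hp (hab.trans hx')
    · have : x = b := by simpa [hq.getLast_eq hne] using hx
      subst this
      exact (List.nodup_cons.1 hnt).1 hy
  -- The closed walk is not a single edge traversed back and forth: its first link is not a negative
  -- edge, but those of the tree path are.
  · intro e x y hl
    have hne' : G.treePath b a ≠ [] := by
      intro h0
      rw [h0] at hst
      obtain rfl : b = a := hst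
      exact (List.nodup_cons.1 hnd).1 (hq.mem_of_ne_nil hne)
    obtain ⟨p, l, hp⟩ := List.exists_cons_of_ne_nil hne
    obtain ⟨p', l', hp'⟩ := List.exists_cons_of_ne_nil hne'
    have h1 := hhead p (by simp [hp])
    have h2 := isNeg_of_mem_treePath (q := p') (by rw [hp']; simp)
    rw [hp, hp'] at hl
    cases l with
    | nil =>
      simp only [List.cons_append, List.nil_append, List.cons.injEq] at hl
      obtain ⟨rfl, rfl, -⟩ := hl
      exact h1 h2
    | cons c l => simp at hl

theorem wt_negSteps {x y : V} (p : G.negEdges.Walk x y) :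
    G.wt (negSteps p) = (p.edges.map G.edgeWeight).sum := by
  induction p with
  | nil => simp [negSteps]
  | cons h p ih => simp [negSteps, ih, weight]

theorem wt_treePath_comm (hac : G.negEdges.IsAcyclic) {a b : V} (hab : G.negEdges.Reachable a b) :
    G.wt (G.treePath b a) = G.wt (G.treePath a b) := by
  obtain ⟨p, hp, h⟩ := treePath_spec hab
  rw [h, treePath_eq hac hp.reverse, wt_negSteps, wt_negSteps, SimpleGraph.Walk.edges_reverse,
    List.map_reverse, List.sum_reverse]

/-- The tree path is the heaviest walk along negative edges. -/
theorem wt_negSteps_le (hac : G.negEdges.IsAcyclic) {x y : V} (p : G.negEdges.Walk x y) :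
    G.wt (negSteps p) ≤ G.wt (G.treePath x y) := by
  induction p with
  | nil => simp [negSteps]
  | @cons x z y hadj p ih =>
    have hneg := (negEdges_adj_joins hadj).2.weight_neg
    rw [negSteps, wt_cons]
    dsimp only
    rcases treePath_adj hac hadj p.reachable with h1 | h1
    · rw [h1, wt_cons]; linarith
    · rw [h1, wt_cons] at ih
      linarith

/-- A cycle formed by negative edges would be a cycle of negative weight. -/
theorem isAcyclic_of_conservative (hG : G.Conservative) : G.negEdges.IsAcyclic := by
  intro v p hp
  have h1 := steps_negSteps p
  have h2 := cons_map_negSteps p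
  have hne : negSteps p ≠ [] := by
    intro h0
    have := congrArg List.length h2
    rw [h0, SimpleGraph.Walk.length_support] at this
    have := hp.three_le_length
    simp only [List.map_nil, List.length_cons, List.length_nil] at *
    omega
  have hcyc : G.Cyc v (negSteps p) := by
    refine ⟨h1, hne, ?_, ?_⟩
    · have := hp.support_nodup
      rw [← h2] at this
      exact this
    · intro e x y h0
      have := congrArg List.length h2
      rw [h0, SimpleGraph.Walk.length_support] at this
      have := hp.three_le_length
      simp only [List.map_nil, List.map_cons, List.length_cons, List.length_nil] at *
      omega
  have h3 := conservative_iff.1 hG v _ hcyc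
  obtain ⟨q, l, hl⟩ := List.exists_cons_of_ne_nil hne
  have h4 : ∀ p' ∈ negSteps p, G.IsNeg p'.1 := fun _ => isNeg_of_mem_negSteps p
  rw [hl] at h3 h4
  have h5 := (h4 q (by simp)).weight_neg
  have h6 := wt_nonpos fun p' hp' => h4 p' (List.mem_cons_of_mem _ hp')
  rw [wt_cons] at h3
  linarith

/-- An excursion and the tree path back form a cycle, whose weight is not negative. -/
theorem excursionsHeavy_of_conservative (hG : G.Conservative)
    (l : List ((Sym2 V ⊕ V × V) × V)) : G.ExcursionsHeavy l := by
  rintro l₁ q l₂ a b - hq hab hnd hhead hin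
  have hac := isAcyclic_of_conservative hG
  by_cases hne : q = []
  · subst hne
    obtain rfl : a = b := hq
    simp
  · have := conservative_iff.1 hG a _ (cyc_append_treePath hq hab hnd hne hhead hin)
    rw [wt_append, wt_treePath_comm hac hab] at this
    linarith

/-- If the negative edges form a forest but the graph is not conservative, then some negative cycle
consists of a path all of whose excursions are heavy and another link. -/
theorem exists_cycle_of_not_conservative (hG : ¬ G.Conservative) (hac : G.negEdges.IsAcyclic) :
    ∃ r v l a, G.Steps r l v ∧ (r :: l.map Prod.snd).Nodup ∧ G.ExcursionsHeavy l ∧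
      G.Joins a v r ∧ ¬ G.IsNeg a ∧ G.wt l + G.weight a < 0 := by
  classical
  rw [conservative_iff] at hG
  push Not at hG
  -- The number of links other than negative edges. Among the negative cycles, one that minimises it
  -- is chosen.
  let c : List ((Sym2 V ⊕ V × V) × V) → ℕ := fun l => l.countP fun p => decide (¬ G.IsNeg p.1)
  have hex : ∃ k v l, G.Cyc v l ∧ G.wt l < 0 ∧ c l = k := by
    obtain ⟨v, l, h1, h2⟩ := hG
    exact ⟨_, v, l, h1, h2, rfl⟩
  obtain ⟨v, l, hcyc, hneg, hk⟩ := Nat.find_spec hex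
  have hmin : ∀ v' l', G.Cyc v' l' → c l' < c l → 0 ≤ G.wt l' := by
    intro v' l' h1 h2
    by_contra h3
    exact Nat.find_min hex (hk ▸ h2) ⟨v', l', h1, not_le.1 h3, rfl⟩
  clear hk
  -- Otherwise the links after the first one would form a path of negative edges back to the start.
  -- In a forest this has to be the first edge reversed, so the closed walk would only go back and
  -- forth.
  have hnon : ∃ p ∈ l, ¬ G.IsNeg p.1 := by
    by_contra hall
    push Not at hall
    obtain ⟨p, l', rfl⟩ := List.exists_cons_of_ne_nil hcyc.2.1
    obtain ⟨hj, hst⟩ := hcyc.1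
    obtain ⟨hadj, he⟩ := hj.isNeg_adj (hall p (by simp))
    obtain ⟨w, hw⟩ := hst.exists_negWalk fun q hq => hall q (List.mem_cons_of_mem _ hq)
    have hw' : w.IsPath := by
      rw [SimpleGraph.Walk.isPath_def, ← cons_map_negSteps, hw]
      exact hcyc.2.2.1
    have h1 := treePath_eq hac hw'
    have h2 := treePath_eq hac (p := .cons hadj.symm .nil) (by simpa using hadj.ne')
    rw [h1, hw] at h2
    simp only [negSteps] at h2
    apply hcyc.2.2.2 s(v, p.2) p.2 v
    rw [h2, Sym2.eq_swap]
    rw [← he]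
  obtain ⟨p, hp, hpn⟩ := hnon
  obtain ⟨l₁, l₂, rfl⟩ := List.append_of_mem hp
  obtain ⟨h1, h2⟩ := hcyc.1.split_at
  obtain ⟨w, h3, h4⟩ := steps_append.1 h1
  have hj : G.Joins p.1 w p.2 := h4.1
  have hP : G.Steps p.2 (l₂ ++ l₁) w := h2.append h3
  have hnd : (p.2 :: (l₂ ++ l₁).map Prod.snd).Nodup := by
    have := hcyc.2.2.1
    refine (List.Perm.nodup_iff ?_).1 this
    have h5 : p.2 :: (l₂ ++ l₁).map Prod.snd = (p :: (l₂ ++ l₁)).map Prod.snd := rfl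
    rw [h5]
    refine List.Perm.map _ ?_
    exact List.perm_middle.trans (List.Perm.cons _ List.perm_append_comm)
  refine ⟨p.2, w, l₂ ++ l₁, p.1, hP, hnd, ?_, hj, hpn, ?_⟩
  · rintro k₁ q k₂ a b hl hq hab hqnd hhead hin
    by_cases hne : q = []
    · subst hne
      obtain rfl : a = b := hq
      simp
    -- The excursion lies in the opened cycle, which lacks the link `p`, and tree paths contribute
    -- nothing to the count. So the cycle closed by the tree path has fewer links of the counted
    -- kind and cannot be negative.
    · have := hmin a _ (cyc_append_treePath hq hab hqnd hne hhead hin) ?_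
      · rw [wt_append, wt_treePath_comm hac hab] at this
        linarith
      · have e1 : c (l₁ ++ p :: l₂) = c (l₂ ++ l₁) + 1 := by
          simp only [c, List.countP_append, List.countP_cons, hpn]
          simp
          omega
        have e2 : c (G.treePath b a) = 0 := by
          simp only [c, List.countP_eq_zero]
          intro q hq
          simpa using isNeg_of_mem_treePath hq
        rw [hl] at e1
        simp only [c, List.countP_append] at e1 e2 ⊢
        omega
  · simp only [wt_append, wt_cons] at hneg ⊢
    linarith

end MixedGraph

/-! ## Distances from dynamic programming over sets of negative trees -/

/-- Adding a power of two that does not occur in the binary expansion. -/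
theorem add_two_pow_div_mod {S i j : ℕ} (h : S / 2 ^ j % 2 = 0) (hij : i ≠ j) :
    (S + 2 ^ j) / 2 ^ i % 2 = S / 2 ^ i % 2 := by
  rcases lt_or_gt_of_ne hij with hlt | hlt
  · obtain ⟨k, rfl⟩ := Nat.exists_eq_add_of_lt hlt
    have h1 : 2 ^ (i + k + 1) = 2 ^ i * (2 * 2 ^ k) := by ring
    rw [h1, Nat.add_mul_div_left _ _ (by positivity)]
    omega
  · obtain ⟨k, rfl⟩ := Nat.exists_eq_add_of_lt hlt
    have h1 : 2 ^ (j + k + 1) = 2 ^ j * 2 * 2 ^ k := by ring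
    have h2 : (S + 2 ^ j) / 2 ^ j = S / 2 ^ j + 1 := Nat.add_div_right _ (by positivity)
    rw [h1, ← Nat.div_div_eq_div_mul, ← Nat.div_div_eq_div_mul, ← Nat.div_div_eq_div_mul,
      ← Nat.div_div_eq_div_mul, h2, show (S / 2 ^ j + 1) / 2 = S / 2 ^ j / 2 by omega]

theorem add_two_pow_lt {S j k : ℕ} (hS : S < 2 ^ k) (hj : j < k) (h : S / 2 ^ j % 2 = 0) :
    S + 2 ^ j < 2 ^ k := by
  obtain ⟨i, rfl⟩ := Nat.exists_eq_add_of_lt hj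
  have h1 : 2 ^ (j + i + 1) = 2 * 2 ^ i * 2 ^ j := by ring
  have h2 : (S + 2 ^ j) / 2 ^ j = S / 2 ^ j + 1 := Nat.add_div_right _ (by positivity)
  rw [h1] at hS ⊢
  have h3 := (Nat.div_lt_iff_lt_mul (by positivity)).2 hS
  rw [← Nat.div_lt_iff_lt_mul (by positivity), h2]
  omega

theorem sub_two_pow_div_mod {S i j : ℕ} (hj : S / 2 ^ j % 2 = 1)
    (h : (S - 2 ^ j) / 2 ^ i % 2 = 1) : i ≠ j ∧ S / 2 ^ i % 2 = 1 := by
  have hle : 2 ^ j ≤ S := by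
    by_contra hlt
    rw [Nat.div_eq_of_lt (not_le.1 hlt)] at hj
    simp at hj
  obtain ⟨S, rfl⟩ := Nat.exists_eq_add_of_le' hle
  have h2 : (S + 2 ^ j) / 2 ^ j = S / 2 ^ j + 1 := Nat.add_div_right _ (by positivity)
  rw [Nat.add_sub_cancel] at h
  have hij : i ≠ j := by rintro rfl; omega
  exact ⟨hij, by rw [add_two_pow_div_mod (by omega) hij, h]⟩

namespace MixedGraph

variable {V : Type} {G : MixedGraph V}

/-- The table `L` holds the weights of some walks that use no negative edge, at most those of all
such paths. -/
structure IsNonnegTable (G : MixedGraph V) (L : V → V → WithTop ℝ) : Prop where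
  sound : ∀ u v (c : ℝ), L u v = c →
    ∃ l, G.Steps u l v ∧ (∀ p ∈ l, ¬ G.IsNeg p.1) ∧ G.wt l = c
  complete : ∀ u v l, G.Steps u l v → (∀ p ∈ l, ¬ G.IsNeg p.1) →
    (u :: l.map Prod.snd).Nodup → L u v ≤ (G.wt l : ℝ)

/-- The table `δ` holds the lengths of some walks along negative edges, at most those of all such
paths, where the length is the negative of the weight. -/
structure IsTreeTable (G : MixedGraph V) (δ : V → V → WithTop ℝ) : Prop where
  sound : ∀ u v (c : ℝ), δ u v = c → ∃ p : G.negEdges.Walk u v, -G.wt (negSteps p) = c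
  complete : ∀ u v (p : G.negEdges.Walk u v), p.IsPath → δ u v ≤ (-G.wt (negSteps p) : ℝ)

theorem IsTreeTable.ne_top_iff {δ : V → V → WithTop ℝ} (hδ : G.IsTreeTable δ) {x y : V} :
    δ x y ≠ ⊤ ↔ G.negEdges.Reachable x y := by
  classical
  constructor
  · intro h
    obtain ⟨c, hc⟩ := WithTop.ne_top_iff_exists.1 h
    obtain ⟨p, -⟩ := hδ.sound x y c hc.symm
    exact ⟨p⟩
  · rintro ⟨p⟩ h
    have := hδ.complete x y p.toPath p.toPath.2
    rw [h] at this
    exact absurd (top_le_iff.1 this) (WithTop.coe_ne_top)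

/-- The tree path is one of the paths that the table has to take into account, and its length is the
smallest among all walks along negative edges (`wt_negSteps_le`). -/
theorem IsTreeTable.eq (hac : G.negEdges.IsAcyclic) {δ : V → V → WithTop ℝ}
    (hδ : G.IsTreeTable δ) {x y : V} (h : G.negEdges.Reachable x y) :
    δ x y = (-G.wt (G.treePath x y) : ℝ) := by
  obtain ⟨p, hp, he⟩ := treePath_spec h
  refine le_antisymm (he ▸ hδ.complete x y p hp) ?_
  obtain ⟨c, hc⟩ := WithTop.ne_top_iff_exists.1 (hδ.ne_top_iff.2 h)
  obtain ⟨q, hq⟩ := hδ.sound x y c hc.symm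
  rw [← hc, ← hq, WithTop.coe_le_coe]
  linarith [wt_negSteps_le hac q]

/-- No vertex has two neighbours that are at most as far from some vertex. -/
def AcyclicTest (G : MixedGraph V) (δ : V → V → WithTop ℝ) : Prop :=
  ∀ x y z z', G.negEdges.Adj y z → G.negEdges.Adj y z' → z ≠ z' → δ x y ≠ ⊤ →
    δ x z ≤ δ x y → δ x z' ≤ δ x y → False

/-- In a forest with positive lengths, a neighbour of y that is at most as far from x as y is the
next vertex on the tree path from y to x, and there is only one such vertex. -/
theorem IsTreeTable.test_of_isAcyclic {δ : V → V → WithTop ℝ} (hδ : G.IsTreeTable δ)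
    (hac : G.negEdges.IsAcyclic) : G.AcyclicTest δ := by
  intro x y z z' hz hz' hne hxy h h'
  rw [hδ.ne_top_iff] at hxy
  have key : ∀ z, G.negEdges.Adj y z → δ x z ≤ δ x y →
      G.treePath y x = (.inl s(y, z), z) :: G.treePath z x := by
    intro z hz h
    have hxz := hxy.trans hz.reachable
    rw [hδ.eq hac hxz, hδ.eq hac hxy, WithTop.coe_le_coe, wt_treePath_comm hac hxz.symm,
      wt_treePath_comm hac hxy.symm] at h
    rcases treePath_adj hac hz hxz.symm with h1 | h1
    · exact h1
    · rw [h1, wt_cons] at h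
      have := (negEdges_adj_joins hz).2.weight_neg
      linarith
  have h1 := key z hz h
  rw [key z' hz' h'] at h1
  exact hne (Prod.ext_iff.1 (List.cons.inj h1).1).2.symm

/-- On a cycle, a vertex farthest from the starting vertex has two different neighbours that are at
most as far. -/
theorem IsTreeTable.isAcyclic_of_test {δ : V → V → WithTop ℝ} (hδ : G.IsTreeTable δ)
    (h : G.AcyclicTest δ) : G.negEdges.IsAcyclic := by
  classical
  intro v p hp
  obtain ⟨y, hy, hmax⟩ : ∃ y ∈ p.support.toFinset, ∀ z ∈ p.support.toFinset, δ v z ≤ δ v y :=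
    Finset.exists_max_image _ _ ⟨v, by simp⟩
  rw [List.mem_toFinset] at hy
  have hq : (p.rotate y hy).IsCycle := by simpa using hp
  have hsup : ∀ z ∈ (p.rotate y hy).support, z ∈ p.support := by
    intro z hz
    rw [← SimpleGraph.Walk.cons_tail_support] at hz
    rcases List.mem_cons.1 hz with rfl | hz
    · exact hy
    · have := (SimpleGraph.Walk.support_rotate p y hy).mem_iff.1 hz
      exact List.mem_of_mem_tail this
  have hnil : ¬ (p.rotate y hy).Nil := hq.not_nil
  refine h v y (p.rotate y hy).snd (p.rotate y hy).penultimate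
    (SimpleGraph.Walk.adj_snd hnil) (SimpleGraph.Walk.adj_penultimate hnil).symm
    hq.snd_ne_penultimate (hδ.ne_top_iff.2 ⟨p.takeUntil y hy⟩) (hmax _ ?_) (hmax _ ?_)
  · rw [List.mem_toFinset]
    exact hsup _ (SimpleGraph.Walk.getVert_mem_support _ _)
  · rw [List.mem_toFinset]
    exact hsup _ (SimpleGraph.Walk.getVert_mem_support _ _)

/-- The vertices in `rel` that have another such vertex in their negative tree are labelled by
powers of two, one for each tree. -/
structure IsTreeLabelling (G : MixedGraph V) (rel : V → Prop) (k : ℕ) (pw : V → ℕ) : Prop where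
  pow : ∀ x, pw x ≠ 0 → ∃ j < k, pw x = 2 ^ j
  eq_iff : ∀ x y, pw x ≠ 0 → pw y ≠ 0 → (pw x = pw y ↔ G.negEdges.Reachable x y)
  ne_zero : ∀ x y, rel x → rel y → x ≠ y → G.negEdges.Reachable x y → pw x ≠ 0

/-- The weight `c` of a walk from `s` to `y` that uses negative edges at most once, and only those
of trees in `S`. -/
def TreeWalk (G : MixedGraph V) (pw : V → ℕ) (s : V) (S : ℕ) (y : V) (c : ℝ) : Prop :=
  ∃ l, G.Steps s l y ∧ G.NegOnce l ∧ G.wt l = c ∧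
    ∀ e : Sym2 V, Sum.inl e ∈ l.map Prod.fst → G.IsNeg (.inl e) →
      ∃ z, pw z ≠ 0 ∧ S / pw z % 2 = 1 ∧ ∀ w ∈ e, G.negEdges.Reachable z w

theorem treeWalk_nil (pw : V → ℕ) (s : V) (S : ℕ) : G.TreeWalk pw s S s 0 :=
  ⟨[], rfl, List.Pairwise.nil, rfl, by simp⟩

theorem TreeWalk.append_nonneg {L : V → V → WithTop ℝ} (hL : G.IsNonnegTable L) {pw : V → ℕ}
    {s : V} {S : ℕ} {y v : V} {c d : ℝ} (h : G.TreeWalk pw s S y c) (hd : L y v = d) :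
    G.TreeWalk pw s S v (c + d) := by
  obtain ⟨l, h1, h2, rfl, h4⟩ := h
  obtain ⟨m, h5, h6, rfl⟩ := hL.sound y v d hd
  refine ⟨l ++ m, h1.append h5, negOnce_append.2 ⟨h2, negOnce_of_forall_not h6, ?_⟩,
    wt_append _ _, ?_⟩
  · intro p hp q hq hneg heq
    exact h6 q hq (heq ▸ hneg)
  · intro e he hneg
    rw [List.map_append, List.mem_append] at he
    rcases he with he | he
    · exact h4 e he hneg
    · obtain ⟨q, hq, hqe⟩ := List.mem_map.1 he
      exact absurd (hqe ▸ hneg) (h6 q hq)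

/-- The bit of the tree of x is missing in the set allowed for the walk so far, so that walk
contains no edge of this tree, and the tree path repeats no negative edge. -/
theorem TreeWalk.append_tree (hac : G.negEdges.IsAcyclic) {δ : V → V → WithTop ℝ}
    (hδ : G.IsTreeTable δ) {rel : V → Prop} {k : ℕ} {pw : V → ℕ}
    (hpw : G.IsTreeLabelling rel k pw) {s : V} {S : ℕ} {x y : V} {c d : ℝ}
    (hx : pw x ≠ 0) (hS : S / pw x % 2 = 1) (h : G.TreeWalk pw s (S - pw x) x c)
    (hd : δ x y = d) : G.TreeWalk pw s S y (c - d) := by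
  obtain ⟨l, h1, h2, rfl, h4⟩ := h
  have hxy : G.negEdges.Reachable x y := hδ.ne_top_iff.1 (by rw [hd]; exact WithTop.coe_ne_top)
  rw [hδ.eq hac hxy, WithTop.coe_eq_coe] at hd
  obtain ⟨j, hj, hxj⟩ := hpw.pow x hx
  have hst := steps_treePath hxy
  have htree : ∀ e : Sym2 V, Sum.inl e ∈ (G.treePath x y).map Prod.fst →
      ∀ w ∈ e, G.negEdges.Reachable x w := fun e he w hw =>
    reachable_of_mem_treePath hxy (hst.mem_of_mem_edge he hw)
  have hbit : ∀ z, pw z ≠ 0 → (S - pw x) / pw z % 2 = 1 → pw z ≠ pw x ∧ S / pw z % 2 = 1 := by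
    intro z hz h
    obtain ⟨i, hi, hzi⟩ := hpw.pow z hz
    rw [hxj] at hS
    rw [hzi, hxj] at h
    obtain ⟨hij, h'⟩ := sub_two_pow_div_mod hS h
    rw [hzi, hxj]
    exact ⟨fun he => hij (Nat.pow_right_injective le_rfl he), h'⟩
  refine ⟨l ++ G.treePath x y, h1.append hst,
    negOnce_append.2 ⟨h2, hst.negOnce (nodup_treePath hxy), ?_⟩, by rw [wt_append]; linarith, ?_⟩
  · rintro ⟨a, v⟩ hp ⟨b, w⟩ hq hneg heq
    dsimp only at hneg heq
    subst heq
    obtain ⟨u, hu, hj⟩ := h1.source_mem hp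
    obtain ⟨-, rfl⟩ := hj.isNeg_adj hneg
    obtain ⟨z, hz, hzS, hzw⟩ := h4 _ (List.mem_map.2 ⟨_, hp, rfl⟩) hneg
    have hxu := htree _ (List.mem_map.2 ⟨_, hq, rfl⟩) u (Sym2.mem_mk_left _ _)
    exact (hbit z hz hzS).1 ((hpw.eq_iff z x hz hx).2
      ((hzw u (Sym2.mem_mk_left _ _)).trans hxu.symm))
  · intro e he hneg
    rw [List.map_append, List.mem_append] at he
    rcases he with he | he
    · obtain ⟨z, hz, hzS, hzw⟩ := h4 e he hneg
      exact ⟨z, hz, (hbit z hz hzS).2, hzw⟩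
    · exact ⟨x, hx, hS, htree e he⟩

theorem exists_maximal_prefix {l : List ((Sym2 V ⊕ V × V) × V)} :
    (∀ p ∈ l, ¬ G.IsNeg p.1) ∨
      ∃ l₁ p l₂, l = l₁ ++ p :: l₂ ∧ (∀ p ∈ l₁, ¬ G.IsNeg p.1) ∧ G.IsNeg p.1 := by
  classical
  by_cases h : ∃ p ∈ l, G.IsNeg p.1
  · obtain ⟨l₁, p, l₂, h1, h2, h3⟩ := exists_first _ h
    exact .inr ⟨l₁, p, l₂, h1, h3, h2⟩
  · push Not at h; exact .inl h

theorem add_le_of_le {a b : WithTop ℝ} {c d e : ℝ} (h : a ≤ (c : WithTop ℝ) + b)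
    (hb : b ≤ (d : ℝ)) (he : c + d = e) : a ≤ (e : ℝ) := by
  refine h.trans ((add_le_add_right hb _).trans ?_)
  rw [← WithTop.coe_add, he]

/-- The dynamic programming over sets of trees takes every path with heavy excursions into
account. -/
theorem dp_le_wt (hac : G.negEdges.IsAcyclic) {L δ : V → V → WithTop ℝ}
    (hL : G.IsNonnegTable L) (hδ : G.IsTreeTable δ) {rel : V → Prop} {k : ℕ} {pw : V → ℕ}
    (hpw : G.IsTreeLabelling rel k pw) {s t : V} {A B : ℕ → V → WithTop ℝ} {D : WithTop ℝ}
    (h0 : ∀ v, A 0 v ≤ L s v)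
    (hB : ∀ S x y c d, S < 2 ^ k → pw x ≠ 0 → pw x = pw y → S / pw x % 2 = 1 →
      A (S - pw x) x ≤ ((c : ℝ) : WithTop ℝ) → δ x y = ((d : ℝ) : WithTop ℝ) →
      B S y ≤ ((c - d : ℝ) : WithTop ℝ))
    (hA : ∀ S y v, S < 2 ^ k → A S v ≤ B S y + L y v)
    (hD : ∀ S, S < 2 ^ k → D ≤ A S t)
    {l : List ((Sym2 V ⊕ V × V) × V)} (hl : G.Steps s l t) (hnd : (s :: l.map Prod.snd).Nodup)
    (hheavy : G.ExcursionsHeavy l) (hrel : ∀ v ∈ s :: l.map Prod.snd, rel v) :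
    D ≤ (G.wt l : ℝ) := by
  -- Induction on the length of the rest `l` of the path, which starts in u. The part before u has
  -- been replaced by a walk through the trees in S of weight at most c, and the last hypothesis
  -- says that the rest uses no negative edge of these trees.
  have key : ∀ m u l S c, l.length = m → S < 2 ^ k → (∀ v, A S v ≤ ((c : ℝ) : WithTop ℝ) + L u v) →
      G.Steps u l t → (u :: l.map Prod.snd).Nodup → G.ExcursionsHeavy l →
      (∀ v ∈ u :: l.map Prod.snd, rel v) →
      (∀ p ∈ l, G.IsNeg p.1 → S / pw p.2 % 2 = 0) → D ≤ (c + G.wt l : ℝ) := by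
    intro m
    induction m using Nat.strong_induction_on with
    | _ m ih =>
    intro u l S c hm hS hc hl hnd hheavy hrel hbit
    rcases exists_maximal_prefix (G := G) (l := l) with hnon | ⟨l₁, p, l₂, rfl, hl₁, hp⟩
    · exact add_le_of_le ((hD S hS).trans (hc t)) (hL.complete u t l hl hnon hnd) rfl
    · obtain ⟨x, hx1, hx2, hx3⟩ := steps_append.1 hl
      obtain ⟨hadj, he⟩ := hx2.isNeg_adj hp
      have hex : ∃ q ∈ p :: l₂, G.negEdges.Reachable x q.2 := ⟨p, by simp, hadj.reachable⟩
      -- The first negative edge starts in x, and `y` ends in the last vertex of the path in the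
      -- tree of x. The part in between gives way to the tree path, and after it the tree is not met
      -- again.
      obtain ⟨m₁, y, m₂, hm', hy, hlast⟩ := exists_last _ hex
      have hsteps : G.Steps x (m₁ ++ y :: m₂) t := hm' ▸ ⟨hx2, hx3⟩
      obtain ⟨hP2, hP3⟩ := hsteps.split_at
      have hsplit : l₁ ++ p :: l₂ = l₁ ++ (m₁ ++ [y]) ++ m₂ := by simp [hm']
      have hndall := hnd
      rw [hsplit] at hndall
      have hnd1 : (u :: l₁.map Prod.snd).Nodup := by
        rw [List.map_append, List.map_append, ← List.cons_append, ← List.cons_append] at hndall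
        exact (List.nodup_append.1 (List.nodup_append.1 hndall).1).1
      have hxmem : x ∈ u :: l₁.map Prod.snd := by
        by_cases hne : l₁ = []
        · subst hne; obtain rfl : u = x := hx1; simp
        · exact List.mem_cons_of_mem _ (hx1.mem_of_ne_nil hne)
      have hnd23 : ∀ z ∈ (p :: l₂).map Prod.snd, z ≠ x := by
        rintro z hz rfl
        rw [List.map_append, ← List.cons_append] at hnd
        exact (List.nodup_append.1 hnd).2.2 z hxmem z hz rfl
      have hnd2 : (x :: (p :: l₂).map Prod.snd).Nodup := by
        refine List.nodup_cons.2 ⟨fun h => hnd23 x h rfl, ?_⟩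
        rw [List.map_append] at hnd
        exact (List.nodup_append.1 (List.nodup_cons.1 hnd).2).2.1
      rw [hm', show m₁ ++ y :: m₂ = (m₁ ++ [y]) ++ m₂ by simp, List.map_append,
        ← List.cons_append] at hnd2
      have hndP2 := (List.nodup_append.1 hnd2).1
      have hndP3 : (y.2 :: m₂.map Prod.snd).Nodup := by
        refine List.nodup_cons.2 ⟨fun h => ?_, (List.nodup_append.1 hnd2).2.1⟩
        exact (List.nodup_append.1 hnd2).2.2 y.2 (by simp) y.2 h rfl
      have hyx : x ≠ y.2 := by
        have := hnd23 y.2 (List.mem_map.2 ⟨y, by rw [hm']; simp, rfl⟩)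
        exact this.symm
      have hrelx : rel x := hrel x (by
        rw [List.map_append, ← List.cons_append]; exact List.mem_append_left _ hxmem)
      have hmem2 : ∀ z ∈ (p :: l₂).map Prod.snd, rel z := fun z hz => hrel z (by
        rw [List.map_append, ← List.cons_append]; exact List.mem_append_right _ hz)
      have hrely : rel y.2 := hmem2 y.2 (List.mem_map.2 ⟨y, by rw [hm']; simp, rfl⟩)
      have hrelp : rel p.2 := hmem2 p.2 (by simp)
      have hpx := hpw.ne_zero x y.2 hrelx hrely hyx hy
      have hpy := hpw.ne_zero y.2 x hrely hrelx hyx.symm hy.symm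
      have hpp := hpw.ne_zero p.2 x hrelp hrelx (hnd23 p.2 (by simp)) hadj.reachable.symm
      have hxy := (hpw.eq_iff x y.2 hpx hpy).2 hy
      have hxp := (hpw.eq_iff x p.2 hpx hpp).2 hadj.reachable
      obtain ⟨j, hj, hxj⟩ := hpw.pow x hpx
      -- The tree of x contains the negative edge `p` of the rest of the path, so it is not in S
      -- yet.
      have hSj : S / 2 ^ j % 2 = 0 := by
        have := hbit p (by simp) hp
        rwa [← hxp, hxj] at this
      have hAx : A S x ≤ ((c + G.wt l₁ : ℝ) : WithTop ℝ) :=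
        add_le_of_le (hc x) (hL.complete u x l₁ hx1 hl₁ hnd1) rfl
      have hdisj := wt_treePath_le hac hP2 hndP2 hy
        (hheavy.infix (l₁ := l₁) (l₂ := m₂) hsplit)
      have hδy := hδ.eq hac hy
      have hBy := hB (S + pw x) x y.2 (c + G.wt l₁) (-G.wt (G.treePath x y.2))
        (by rw [hxj]; exact add_two_pow_lt hS hj hSj) hpx hxy
        (by
          rw [hxj, Nat.add_div_right _ (by positivity)]
          omega)
        (by rwa [Nat.add_sub_cancel]) hδy
      have hBy' : B (S + pw x) y.2 ≤ ((c + G.wt l₁ + G.wt (m₁ ++ [y]) : ℝ) : WithTop ℝ) := by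
        refine hBy.trans (WithTop.coe_le_coe.2 ?_)
        linarith
      have hlen := congrArg List.length hsplit
      simp only [List.length_append, List.length_cons, List.length_nil] at hlen hm
      have := ih m₂.length (by omega) y.2 m₂ (S + pw x) (c + G.wt l₁ + G.wt (m₁ ++ [y])) rfl
        (by rw [hxj]; exact add_two_pow_lt hS hj hSj) (fun v => ?_) hP3 hndP3
        (hheavy.infix (l₁ := l₁ ++ (m₁ ++ [y])) (l₂ := []) (by simp [hm'])) ?_ ?_
      · refine this.trans (WithTop.coe_le_coe.2 ?_)
        rw [hsplit]
        simp only [wt_append]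
        linarith
      · refine (hA (S + pw x) y.2 v (by rw [hxj]; exact add_two_pow_lt hS hj hSj)).trans ?_
        exact add_le_add_left hBy' _
      · intro z hz
        rcases List.mem_cons.1 hz with rfl | hz
        · exact hrely
        · refine hmem2 z ?_
          rw [hm']
          simp only [List.map_append, List.map_cons, List.mem_append, List.mem_cons]
          exact .inr (.inr hz)
      · intro q hq hqneg
        have hq0 : q ∈ l₁ ++ p :: l₂ := by rw [hsplit]; exact List.mem_append_right _ hq
        have hS0 := hbit q hq0 hqneg
        obtain ⟨w, hw, hwj⟩ := hP3.source_mem (a := q.1) (x := q.2) hq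
        have hwq := (hwj.isNeg_adj hqneg).1
        have hw2 : rel w ∧ ¬ G.negEdges.Reachable x q.2 := by
          refine ⟨?_, hlast q hq⟩
          rcases List.mem_cons.1 hw with rfl | hw
          · exact hrely
          · refine hmem2 w ?_
            rw [hm']
            simp only [List.map_append, List.map_cons, List.mem_append, List.mem_cons]
            exact .inr (.inr hw)
        have hrelq : rel q.2 := hmem2 q.2 (by
          rw [hm']
          simp only [List.map_append, List.map_cons, List.mem_append, List.mem_cons]
          exact .inr (.inr (List.mem_map.2 ⟨q, hq, rfl⟩)))
        have hpq := hpw.ne_zero q.2 w hrelq hw2.1 hwq.ne' hwq.reachable.symm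
        obtain ⟨i, hi, hqi⟩ := hpw.pow q.2 hpq
        -- A negative edge behind the last vertex in the tree of x belongs to another tree, so
        -- setting bit j does not touch its bit.
        have hij : i ≠ j := by
          rintro rfl
          exact hw2.2 ((hpw.eq_iff x q.2 hpx hpq).1 (hxj.trans hqi.symm))
        rw [hqi] at hS0 ⊢
        rw [hxj, add_two_pow_div_mod hSj hij, hS0]
  have h := key l.length s l 0 0 rfl (by positivity) (fun v => by simpa using h0 v) hl hnd hheavy
    hrel (by simp)
  simpa using h

end MixedGraph

/-! ## Closures of distance tables -/

namespace MixedGraph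

/-- The weight of the walk from `u` to `v` with the given inner vertices. -/
def chainWeight {V : Type} (w : V → V → WithTop ℝ) : V → List V → V → WithTop ℝ
  | u, [], v => w u v
  | u, y :: l, v => w u y + chainWeight w y l v

theorem chainWeight_append {V : Type} (w : V → V → WithTop ℝ) (u v z : V) (l m : List V) :
    chainWeight w u (l ++ z :: m) v = chainWeight w u l z + chainWeight w z m v := by
  induction l generalizing u with
  | nil => rfl
  | cons y l ih => simp [chainWeight, ih, add_assoc]

/-- The table `v` arises from `w` by allowing the vertices in turn as intermediate vertices, for
those pairs for which `Z` permits this. -/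
structure IsClosure {n : ℕ} (Z : Fin n → Fin n → Fin n → Prop) (w v : Fin n → Fin n → WithTop ℝ) :
    Prop where
  sound : ∀ P : Fin n → Fin n → ℝ → Prop,
    (∀ i k j x y, Z k i j → P i k x → P k j y → P i j (x + y)) →
    (∀ i j (x : ℝ), w i j = x → P i j x) → ∀ i j (x : ℝ), v i j = x → P i j x
  relaxed : ∃ f : ℕ → Fin n → Fin n → WithTop ℝ, f 0 = w ∧ f n = v ∧
    ∀ (k i j : Fin n), f (k + 1) i j ≤ f k i j ∧ (Z k i j → f (k + 1) i j ≤ f k i k + f k k j)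

/-- Induction on a strict bound for the inner vertices: the largest permitted one occurs at most
once and splits the chain into two with smaller inner vertices. Only distinctness of the inner
vertices is used, so closed walks of negative weight do no harm. -/
theorem IsClosure.le_chainWeight {n : ℕ} {w v : Fin n → Fin n → WithTop ℝ}
    (h : IsClosure (fun _ _ _ => True) w v) (i j : Fin n) {l : List (Fin n)} (hl : l.Nodup) :
    v i j ≤ chainWeight w i l j := by
  obtain ⟨f, rfl, rfl, hf⟩ := h.relaxed
  have key : ∀ m, m ≤ n → ∀ (i j : Fin n) (l : List (Fin n)), l.Nodup → (∀ z ∈ l, (z : ℕ) < m) →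
      f m i j ≤ chainWeight (f 0) i l j := by
    intro m
    induction m with
    | zero =>
      intro _ i j l _ hl
      cases l with
      | nil => exact le_rfl
      | cons y l => exact absurd (hl y (by simp)) (by omega)
    | succ m ih =>
      intro hm i j l hnd hl
      by_cases hml : (⟨m, hm⟩ : Fin n) ∈ l
      · obtain ⟨l₁, l₂, rfl⟩ := List.append_of_mem hml
        rw [chainWeight_append]
        rw [List.nodup_append, List.nodup_cons] at hnd
        refine ((hf ⟨m, hm⟩ i j).2 trivial).trans (add_le_add (ih (by omega) _ _ _ hnd.1 ?_)
          (ih (by omega) _ _ _ hnd.2.1.2 ?_))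
        · intro z hz
          have h1 := hl z (by simp [hz])
          have h2 : z ≠ ⟨m, hm⟩ := hnd.2.2 z hz _ (by simp)
          have h3 : (z : ℕ) ≠ m := fun h => h2 (Fin.ext h)
          omega
        · intro z hz
          have h1 := hl z (by simp [hz])
          have h2 : z ≠ ⟨m, hm⟩ := fun h => hnd.2.1.1 (h ▸ hz)
          have h3 : (z : ℕ) ≠ m := fun h => h2 (Fin.ext h)
          omega
      · refine ((hf ⟨m, hm⟩ i j).1).trans (ih (by omega) i j l hnd fun z hz => ?_)
        have h1 := hl z hz
        have h2 : z ≠ ⟨m, hm⟩ := fun h => hml (h ▸ hz)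
        have h3 : (z : ℕ) ≠ m := fun h => h2 (Fin.ext h)
        omega
  exact key n le_rfl i j l hl fun z _ => z.2

theorem IsClosure.le_sum {n : ℕ} {G : MixedGraph (Fin n)} {w v : Fin n → Fin n → WithTop ℝ}
    (h : IsClosure (fun _ _ _ => True) w v) {i j : Fin n}
    {l : List ((Sym2 (Fin n) ⊕ Fin n × Fin n) × Fin n)} (hl : G.Steps i l j)
    (hnd : (i :: l.map Prod.snd).Nodup) (f : Sym2 (Fin n) ⊕ Fin n × Fin n → ℝ) (h0 : w i i ≤ 0)
    (hw : ∀ y ∈ i :: l.map Prod.snd, ∀ p ∈ l, G.Joins p.1 y p.2 → w y p.2 ≤ (f p.1 : ℝ)) :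
    v i j ≤ ((l.map fun p => f p.1).sum : ℝ) := by
  cases l with
  | nil =>
    obtain rfl : i = j := hl
    simpa using (h.le_chainWeight i i List.nodup_nil).trans h0
  | cons p l =>
    have hnd' : (((p :: l).map Prod.snd).dropLast).Nodup :=
      (List.nodup_cons.1 hnd).2.sublist (List.dropLast_sublist _)
    refine (h.le_chainWeight i j hnd').trans ?_
    clear hnd hnd' h0
    induction l generalizing i p with
    | nil =>
      obtain ⟨h1, h2⟩ := hl
      obtain rfl : p.2 = j := h2
      simpa [chainWeight] using hw i (by simp) p (by simp) h1
    | cons q l ih =>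
      have h1 := ih q hl.2 (fun y hy r hr => hw y (List.mem_cons_of_mem _ hy) r
        (List.mem_cons_of_mem _ hr))
      have h2 := hw i (by simp) p (by simp) hl.1
      simp only [List.map_cons, List.dropLast_cons_cons, chainWeight, List.sum_cons] at h1 ⊢
      rw [WithTop.coe_add]
      exact add_le_add h2 h1

/-! ### Walks that avoid a vertex, and separating vertices -/

section Compose

variable {V : Type} {G : MixedGraph V}

/-- There is a walk from `u` to `v`. -/
def Conn (G : MixedGraph V) (u v : V) : Prop := ∃ l, G.Steps u l v

/-- There is a walk from `u` to `v` that avoids `c`. -/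
def ConnAvoid (G : MixedGraph V) (c u v : V) : Prop :=
  ∃ l, G.Steps u l v ∧ c ∉ u :: l.map Prod.snd

/-- The vertex `c` separates `t` from `s` in a strong component. -/
def Separates (G : MixedGraph V) (c s t : V) : Prop :=
  G.Conn s t ∧ G.Conn t s ∧ c ≠ s ∧ c ≠ t ∧ ¬ G.ConnAvoid c s t

theorem Conn.refl (u : V) : G.Conn u u := ⟨[], rfl⟩

theorem Conn.trans {u v w : V} (h : G.Conn u v) (h' : G.Conn v w) : G.Conn u w := by
  obtain ⟨l, hl⟩ := h
  obtain ⟨m, hm⟩ := h'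
  exact ⟨l ++ m, hl.append hm⟩

theorem Joins.conn {a : Sym2 V ⊕ V × V} {u v : V} (h : G.Joins a u v) : G.Conn u v :=
  ⟨[(a, v)], h, rfl⟩

theorem Steps.conn {u v : V} {l : List ((Sym2 V ⊕ V × V) × V)} (h : G.Steps u l v) :
    G.Conn u v := ⟨l, h⟩

theorem Steps.exists_path {u v : V} {l : List ((Sym2 V ⊕ V × V) × V)} (h : G.Steps u l v) :
    ∃ m, G.Steps u m v ∧ (u :: m.map Prod.snd).Nodup ∧ m ⊆ l := by
  induction hk : l.length using Nat.strong_induction_on generalizing l with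
  | _ k ih =>
    by_cases hnd : (u :: l.map Prod.snd).Nodup
    · exact ⟨l, h, hnd, List.Subset.refl _⟩
    · obtain ⟨l₁, l₂, l₃, x, rfl, hne, h1, h2, h3, h4⟩ := exists_closed h hnd
      have hlen : 0 < l₂.length := List.length_pos_iff.2 hne
      obtain ⟨m, hm, hm', hle⟩ := ih (l₁ ++ l₃).length (by simp at hk ⊢; omega) (h1.append h3) rfl
      refine ⟨m, hm, hm', fun q hq => ?_⟩
      have := hle hq
      simp only [List.mem_append] at this ⊢
      tauto

theorem reachable_iff_conn {u v : V} : G.Reachable u v ↔ G.Conn u v := by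
  rw [reachable_iff]
  constructor
  · rintro ⟨l, h, -⟩; exact ⟨l, h⟩
  · rintro ⟨l, h⟩
    obtain ⟨m, h1, h2, -⟩ := h.exists_path
    exact ⟨m, h1, h2⟩

theorem Steps.exists_split {u v c : V} {l : List ((Sym2 V ⊕ V × V) × V)} (h : G.Steps u l v)
    (hc : c ∈ u :: l.map Prod.snd) :
    ∃ l₁ l₂, l = l₁ ++ l₂ ∧ G.Steps u l₁ c ∧ G.Steps c l₂ v := by
  rcases List.mem_cons.1 hc with rfl | hc
  · exact ⟨[], l, rfl, rfl, h⟩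
  · obtain ⟨p, hp, rfl⟩ := List.mem_map.1 hc
    obtain ⟨l₁, l₂, rfl⟩ := List.append_of_mem hp
    obtain ⟨h1, h2⟩ := h.split_at
    exact ⟨l₁ ++ [p], l₂, by simp, h1, h2⟩

theorem nodup_append_iff {u : V} {l m : List ((Sym2 V ⊕ V × V) × V)} :
    (u :: (l ++ m).map Prod.snd).Nodup ↔ (u :: l.map Prod.snd).Nodup ∧ (m.map Prod.snd).Nodup ∧
      ∀ z ∈ u :: l.map Prod.snd, z ∉ m.map Prod.snd := by
  rw [List.map_append, ← List.cons_append, List.nodup_append]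
  constructor
  · rintro ⟨h1, h2, h3⟩; exact ⟨h1, h2, fun z hz hz' => h3 z hz z hz' rfl⟩
  · rintro ⟨h1, h2, h3⟩; exact ⟨h1, h2, fun z hz y hy h => h3 z hz (h ▸ hy)⟩

theorem Steps.end_mem {u v : V} {l : List ((Sym2 V ⊕ V × V) × V)} (h : G.Steps u l v) :
    v ∈ u :: l.map Prod.snd := by
  by_cases hl : l = []
  · subst hl; obtain rfl : u = v := h; simp
  · exact List.mem_cons_of_mem _ (h.mem_of_ne_nil hl)

theorem Steps.nodup_right {u c : V} {l m : List ((Sym2 V ⊕ V × V) × V)} (h : G.Steps u l c)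
    (hnd : (u :: (l ++ m).map Prod.snd).Nodup) : (c :: m.map Prod.snd).Nodup := by
  obtain ⟨-, h2, h3⟩ := nodup_append_iff.1 hnd
  exact List.nodup_cons.2 ⟨h3 c h.end_mem, h2⟩

/-- The table `d` holds, for pairs of vertices in the same strong component, upper bounds for the
weights of some paths. -/
def PathSound (G : MixedGraph V) (d : V → V → WithTop ℝ) : Prop :=
  ∀ s t (x : ℝ), d s t = x →
    G.Conn t s ∧ ∃ l, G.Steps s l t ∧ (s :: l.map Prod.snd).Nodup ∧ G.wt l ≤ x

/-- The table `d` takes all paths between two vertices of a strong component into account. -/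
def PathComplete (G : MixedGraph V) (d : V → V → WithTop ℝ) : Prop :=
  ∀ s t l, G.Conn t s → G.Steps s l t → (s :: l.map Prod.snd).Nodup → G.ExcursionsHeavy l →
    d s t ≤ (G.wt l : ℝ)

end Compose

/-! ### Composition of distances at separating vertices -/

section Fin

variable {n : ℕ} {G : MixedGraph (Fin n)}

/-- Joining two paths at a separating vertex c gives a path: if they shared another vertex z,
following the first one to z and the second one from z on would lead from s to t without c. -/
theorem pathSound_closure {d₀ d : Fin n → Fin n → WithTop ℝ} (h : IsClosure G.Separates d₀ d)
    (h₀ : G.PathSound d₀) : G.PathSound d := by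
  refine h.sound (fun s t x => G.Conn t s ∧ ∃ l, G.Steps s l t ∧ (s :: l.map Prod.snd).Nodup ∧
    G.wt l ≤ x) ?_ h₀
  rintro s c t x y ⟨hst, hts, hcs, hct, hsep⟩ ⟨-, l, hl, hnd, hwl⟩ ⟨-, m, hm, hnd', hwm⟩
  refine ⟨hts, l ++ m, hl.append hm, nodup_append_iff.2 ⟨hnd, (List.nodup_cons.1 hnd').2, ?_⟩,
    by rw [wt_append]; linarith⟩
  intro z hz hz'
  apply hsep
  obtain ⟨l₁, l₂, rfl, h1, h2⟩ := hl.exists_split hz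
  obtain ⟨m₁, m₂, rfl, h3, h4⟩ := hm.exists_split (List.mem_cons_of_mem _ hz')
  refine ⟨l₁ ++ m₂, h1.append h4, ?_⟩
  have hcz : c ≠ z := by
    rintro rfl; exact (List.nodup_cons.1 hnd').1 hz'
  rw [List.map_append, ← List.cons_append, List.mem_append, not_or]
  constructor
  · intro hc
    have hne : l₂ ≠ [] := by
      rintro rfl
      exact hcz (show z = c from h2).symm
    exact (nodup_append_iff.1 hnd).2.2 c hc (h2.mem_of_ne_nil hne)
  · intro hc
    have := (List.nodup_cons.1 hnd').1
    rw [List.map_append, List.mem_append, not_or] at this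
    exact this.2 hc

/-- Induction on m, for pairs all of whose separating vertices are below m + 1. If m separates s
from t, every path is cut at m, and a vertex separating s from m or m from t also separates s from
t; it differs from m, hence is smaller, and the induction hypothesis applies to both halves. -/
theorem pathComplete_closure {d₀ d : Fin n → Fin n → WithTop ℝ} (h : IsClosure G.Separates d₀ d)
    (h₀ : ∀ s t l, G.Conn t s → (∀ c, ¬ G.Separates c s t) → G.Steps s l t →
      (s :: l.map Prod.snd).Nodup → G.ExcursionsHeavy l → d₀ s t ≤ (G.wt l : ℝ)) :
    G.PathComplete d := by
  obtain ⟨f, rfl, rfl, hf⟩ := h.relaxed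
  have key : ∀ m, m ≤ n → ∀ s t l, G.Conn t s → (∀ c, G.Separates c s t → (c : ℕ) < m) →
      G.Steps s l t → (s :: l.map Prod.snd).Nodup → G.ExcursionsHeavy l →
      f m s t ≤ (G.wt l : ℝ) := by
    intro m
    induction m with
    | zero =>
      intro _ s t l hts hsep hl hnd hheavy
      exact h₀ s t l hts (fun c hc => absurd (hsep c hc) (by omega)) hl hnd hheavy
    | succ m ih =>
      intro hm s t l hts hsep hl hnd hheavy
      by_cases hmsep : G.Separates ⟨m, hm⟩ s t
      · obtain ⟨-, -, hms, hmt, hno⟩ := hmsep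
        have hmem : ∀ l', G.Steps s l' t → (⟨m, hm⟩ : Fin n) ∈ s :: l'.map Prod.snd := by
          intro l' hl'
          by_contra hc
          exact hno ⟨l', hl', hc⟩
        obtain ⟨l₁, l₂, rfl, h1, h2⟩ := hl.exists_split (hmem l hl)
        have hnd1 := (nodup_append_iff.1 hnd).1
        have hnd2 : ((⟨m, hm⟩ : Fin n) :: l₂.map Prod.snd).Nodup := h1.nodup_right hnd
        have hne1 : l₁ ≠ [] := by
          rintro rfl; exact hms (show s = _ from h1).symm
        have hne2 : l₂ ≠ [] := by
          rintro rfl; exact hmt (show _ = t from h2)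
        have hlt : ∀ c : Fin n, G.Separates c s t → c ≠ ⟨m, hm⟩ → (c : ℕ) < m := by
          intro c hc hcm
          have h3 := hsep c hc
          have h4 : (c : ℕ) ≠ m := fun h => hcm (Fin.ext h)
          omega
        rw [wt_append, WithTop.coe_add]
        refine ((hf ⟨m, hm⟩ s t).2 ⟨hl.conn, hts, hms, hmt, hno⟩).trans (add_le_add
          (ih (by omega) s _ l₁ (h2.conn.trans hts) ?_ h1 hnd1
            (hheavy.infix (l₁ := []) (l₂ := l₂) (by simp)))
          (ih (by omega) _ t l₂ (hts.trans h1.conn) ?_ h2 hnd2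
            (hheavy.infix (l₁ := l₁) (l₂ := []) (by simp))))
        · rintro c ⟨-, -, hcs, hcm, hcno⟩
          refine hlt c ⟨hl.conn, hts, hcs, ?_, ?_⟩ hcm
          · rintro rfl
            refine hcno ⟨l₁, h1, fun hc => ?_⟩
            exact (nodup_append_iff.1 hnd).2.2 c hc (h2.mem_of_ne_nil hne2)
          · rintro ⟨l', hl', hc'⟩
            obtain ⟨m₁, m₂, rfl, h3, h4⟩ := hl'.exists_split (hmem l' hl')
            refine hcno ⟨m₁, h3, fun hc => hc' ?_⟩
            rw [List.map_append, ← List.cons_append]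
            exact List.mem_append_left _ hc
        · rintro c ⟨-, -, hcm, hct, hcno⟩
          refine hlt c ⟨hl.conn, hts, ?_, hct, ?_⟩ hcm
          · rintro rfl
            refine hcno ⟨l₂, h2, fun hc => ?_⟩
            rcases List.mem_cons.1 hc with hc | hc
            · exact hcm hc
            · exact (nodup_append_iff.1 hnd).2.2 c (by simp) hc
          · rintro ⟨l', hl', hc'⟩
            obtain ⟨m₁, m₂, rfl, h3, h4⟩ := hl'.exists_split (hmem l' hl')
            refine hcno ⟨m₂, h4, fun hc => ?_⟩
            rcases List.mem_cons.1 hc with hc | hc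
            · exact hcm hc
            · apply hc'
              rw [List.map_append, ← List.cons_append]
              exact List.mem_append_right _ hc
      · refine (hf ⟨m, hm⟩ s t).1.trans (ih (by omega) s t l hts (fun c hc => ?_) hl hnd hheavy)
        have h3 := hsep c hc
        have h4 : (c : ℕ) ≠ m := by
          intro h
          apply hmsep
          have : c = ⟨m, hm⟩ := Fin.ext h
          rwa [← this]
        omega
  intro s t l hts hl hnd hheavy
  exact key n le_rfl s t l hts (fun c _ => c.2) hl hnd hheavy

end Fin

/-! ### The test for negative cycles -/

section

variable {V : Type} {G : MixedGraph V}

/-- No pair of vertices gives rise to a negative closed walk. -/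
def CycleTest (d L : V → V → WithTop ℝ) : Prop :=
  ∀ r v, ¬ d r v + L v r < 0

/-- The path bounded by the entry of `d` uses no negative edge twice, and the walk back uses none,
so the two form a closed walk of nonnegative weight. -/
theorem cycleTest_of_conservative (hG : G.Conservative) {d L : V → V → WithTop ℝ}
    (hd : G.PathSound d) (hL : G.IsNonnegTable L) : CycleTest d L := by
  intro r v h
  obtain ⟨x, hx⟩ := WithTop.ne_top_iff_exists.1 (WithTop.add_ne_top.1 (ne_top_of_lt h)).1
  obtain ⟨y, hy⟩ := WithTop.ne_top_iff_exists.1 (WithTop.add_ne_top.1 (ne_top_of_lt h)).2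
  obtain ⟨-, l, h1, h2, h3⟩ := hd r v x hx.symm
  obtain ⟨m, h4, h5, rfl⟩ := hL.sound v r y hy.symm
  rw [← hx, ← hy, ← WithTop.coe_add, ← WithTop.coe_zero, WithTop.coe_lt_coe] at h
  have := wt_nonneg_of_closed hG (h1.append h4) (negOnce_append.2 ⟨h1.negOnce h2,
    negOnce_of_forall_not h5, fun p hp q hq hneg heq => h5 q hq (heq ▸ hneg)⟩)
  rw [wt_append] at this
  linarith

/-- If the graph were not conservative, `exists_cycle_of_not_conservative` would supply a path and a
link back with negative total weight. Both tables are bounded by these, since the ends of the link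
lie in one strong component. -/
theorem conservative_of_tests {d L : V → V → WithTop ℝ} (hac : G.negEdges.IsAcyclic)
    (hd : G.PathComplete d) (hL : G.IsNonnegTable L) (h : CycleTest d L) : G.Conservative := by
  by_contra hG
  obtain ⟨r, v, l, a, h1, h2, h3, h4, h5, h6⟩ := exists_cycle_of_not_conservative hG hac
  refine h r v ?_
  have e1 := hd r v l h4.conn h1 h2 h3
  have e2 := hL.complete v r [(a, r)] ⟨h4, rfl⟩ (by simpa using h5) (by simpa using h4.ne)
  refine (add_le_add e1 e2).trans_lt ?_
  rw [← WithTop.coe_add, ← WithTop.coe_zero, WithTop.coe_lt_coe]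
  simpa using h6

end

/-! ### Paths through several strong components -/

section Final

variable {n : ℕ} {G : MixedGraph (Fin n)}

/-- The table of the weights of paths whose last link leads to another strong component. -/
structure IsLeaveTable (G : MixedGraph (Fin n)) (d X : Fin n → Fin n → WithTop ℝ) : Prop where
  sound : ∀ s v (x : ℝ), X s v = x → ∃ u, G.arcs.Adj u v ∧ ¬ G.Conn v u ∧
    ∃ y : ℝ, d s u = y ∧ y + G.arcWeight (u, v) = x
  complete : ∀ s u v, G.arcs.Adj u v → ¬ G.Conn v u →
    X s v ≤ d s u + (G.arcWeight (u, v) : ℝ)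

/-- The table `o` combines the table `d` for strong components with the table `Y` of paths that
lead to other ones. -/
structure IsJoinTable (d Y o : Fin n → Fin n → WithTop ℝ) : Prop where
  sound : ∀ s t (x : ℝ), o s t = x → d s t = x ∨
    ∃ v, ∃ y z : ℝ, Y s v = y ∧ d v t = z ∧ y + z = x
  complete : ∀ s t, o s t ≤ d s t ∧ ∀ v, o s t ≤ Y s v + d v t

/-- The path is cut behind its last vertex from which s can be reached. The next link is an arc,
since an undirected edge could be traversed back, and its head starts a shorter path to which
induction applies. The list `inner` collects the heads of all such arcs but the last one, whose head
is `v`. -/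
theorem join_complete (hG : G.Conservative) {d X : Fin n → Fin n → WithTop ℝ}
    (hd : G.PathComplete d) (hX : G.IsLeaveTable d X) {s t : Fin n}
    {l : List ((Sym2 (Fin n) ⊕ Fin n × Fin n) × Fin n)} (hl : G.Steps s l t)
    (hnd : (s :: l.map Prod.snd).Nodup) :
    G.Conn t s ∨ ∃ inner v, inner.Nodup ∧ (∀ z ∈ inner, z ∈ l.map Prod.snd) ∧
      chainWeight X s inner v + d v t ≤ (G.wt l : ℝ) := by
  induction hk : l.length using Nat.strong_induction_on generalizing s l with
  | _ k ih =>
    by_cases hts : G.Conn t s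
    · exact .inl hts
    right
    obtain ⟨l₁, u, p, l₂, rfl, h1, hus, hout⟩ : ∃ l₁ u p l₂, l = l₁ ++ p :: l₂ ∧
        G.Steps s l₁ u ∧ G.Conn u s ∧ ¬ G.Conn p.2 s := by
      by_cases hex : ∃ q ∈ l, G.Conn q.2 s
      · obtain ⟨m₁, y, m₂, rfl, hy, hlast⟩ := exists_last _ hex
        obtain ⟨h1, h2⟩ := hl.split_at
        cases m₂ with
        | nil =>
          have : y.2 = t := h2
          exact absurd (this ▸ hy) hts
        | cons p m₂ =>
          exact ⟨m₁ ++ [y], y.2, p, m₂, by simp, h1, hy, hlast p (by simp)⟩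
      · push Not at hex
        cases l with
        | nil =>
          obtain rfl : s = t := hl
          exact absurd (Conn.refl s) hts
        | cons p l => exact ⟨[], s, p, l, rfl, rfl, Conn.refl s, hex p (by simp)⟩
    obtain ⟨w, hw, hpv, h2⟩ := steps_append.1 hl
    obtain rfl : w = u := by
      by_cases hne : l₁ = []
      · subst hne
        exact (show s = w from hw).symm.trans (show s = u from h1)
      · exact (hw.getLast_eq hne).symm.trans (h1.getLast_eq hne)
    have hvu : ¬ G.Conn p.2 w := fun h => hout (h.trans hus)
    obtain ⟨a, v⟩ := p
    dsimp only at hpv h2 hout hvu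
    obtain ⟨hnd1, hnd2, hdis⟩ := nodup_append_iff.1 hnd
    have e1 : d s w ≤ (G.wt l₁ : ℝ) :=
      hd s w l₁ hus h1 hnd1 (excursionsHeavy_of_conservative hG _)
    cases a with
    | inl e =>
      obtain ⟨hadj, rfl⟩ := hpv
      have : G.Joins (.inl s(w, v)) v w := ⟨hadj.symm, Sym2.eq_swap⟩
      exact absurd this.conn hvu
    | inr b =>
      obtain ⟨hadj, rfl⟩ := hpv
      have e2 : X s v ≤ ((G.wt l₁ + G.arcWeight (w, v) : ℝ) : WithTop ℝ) := by
        refine (hX.complete s w v hadj hvu).trans ?_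
        rw [WithTop.coe_add]
        exact add_le_add_left e1 _
      have hlen : l₂.length < k := by simp at hk; omega
      have e3 : G.wt (l₁ ++ (Sum.inr (w, v), v) :: l₂) =
          G.wt l₁ + G.arcWeight (w, v) + G.wt l₂ := by
        simp only [wt_append, wt_cons, weight]; ring
      rcases ih l₂.length hlen h2 hnd2 rfl with htv | ⟨inner, v', h3, h4, h5⟩
      · refine ⟨[], v, List.nodup_nil, by simp, ?_⟩
        rw [e3, WithTop.coe_add]
        exact add_le_add e2 (hd v t l₂ htv h2 hnd2 (excursionsHeavy_of_conservative hG _))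
      · refine ⟨v :: inner, v', List.nodup_cons.2 ⟨fun h => ?_, h3⟩, ?_, ?_⟩
        · exact (List.nodup_cons.1 hnd2).1 (h4 v h)
        · intro z hz
          rw [List.map_append, List.mem_append]
          right
          rcases List.mem_cons.1 hz with rfl | hz
          · simp
          · exact List.mem_cons_of_mem _ (h4 z hz)
        · rw [e3, WithTop.coe_add, chainWeight, add_assoc]
          exact add_le_add e2 h5

/-- The last clause, that v reaches no other vertex of the path, keeps concatenations simple: a
vertex on both parts would be reachable from the vertex where they are joined. It holds for single
entries because their last arc leaves a strong component for good. -/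
theorem leave_sound {d X Y : Fin n → Fin n → WithTop ℝ} (hd : G.PathSound d)
    (hX : G.IsLeaveTable d X) (hY : IsClosure (fun _ _ _ => True) X Y) (s v : Fin n) (x : ℝ)
    (h : Y s v = x) :
    ∃ l, G.Steps s l v ∧ (s :: l.map Prod.snd).Nodup ∧ G.wt l ≤ x ∧
      ∀ z ∈ s :: l.map Prod.snd, z ≠ v → ¬ G.Conn v z := by
  have hconn : ∀ {s v : Fin n} {l}, G.Steps s l v → ∀ z ∈ s :: l.map Prod.snd,
      G.Conn s z ∧ G.Conn z v := by
    intro s v l hl z hz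
    obtain ⟨m, m', -, h1, h2⟩ := hl.exists_split hz
    exact ⟨h1.conn, h2.conn⟩
  refine hY.sound (fun s v x => ∃ l, G.Steps s l v ∧ (s :: l.map Prod.snd).Nodup ∧ G.wt l ≤ x ∧
      ∀ z ∈ s :: l.map Prod.snd, z ≠ v → ¬ G.Conn v z) ?_ ?_ s v x h
  · rintro s u v x y - ⟨l, h1, h2, h3, h4⟩ ⟨m, h5, h6, h7, h8⟩
    refine ⟨l ++ m, h1.append h5, nodup_append_iff.2 ⟨h2, (List.nodup_cons.1 h6).2, ?_⟩,
      by rw [wt_append]; linarith, ?_⟩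
    · intro z hz hz'
      refine h4 z hz ?_ (hconn h5 z (List.mem_cons_of_mem _ hz')).1
      rintro rfl
      exact (List.nodup_cons.1 h6).1 hz'
    · intro z hz hzv hvz
      rw [List.map_append, ← List.cons_append, List.mem_append] at hz
      rcases hz with hz | hz
      · by_cases huv : u = v
        · subst huv; exact h4 z hz hzv hvz
        · exact h8 u (by simp) huv (hvz.trans (hconn h1 z hz).2)
      · exact h8 z (List.mem_cons_of_mem _ hz) hzv hvz
  · intro s v x hx
    obtain ⟨u, hadj, hvu, y, hy, rfl⟩ := hX.sound s v x hx
    obtain ⟨-, l, h1, h2, h3⟩ := hd s u y hy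
    have hno : ∀ z ∈ s :: l.map Prod.snd, ¬ G.Conn v z := fun z hz h =>
      hvu (h.trans (hconn h1 z hz).2)
    refine ⟨l ++ [(.inr (u, v), v)], h1.append (v := u) ⟨show G.Joins (.inr (u, v)) u v from ⟨hadj, rfl⟩, rfl⟩,
      nodup_append_iff.2 ⟨h2, by simp, ?_⟩, ?_, ?_⟩
    · intro z hz hz'
      have : z = v := by simpa using hz'
      subst this; exact hno z hz (Conn.refl z)
    · simp only [wt_append, wt_cons, wt_nil, weight]
      linarith
    · intro z hz hzv
      rw [List.map_append, ← List.cons_append, List.mem_append] at hz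
      rcases hz with hz | hz
      · exact hno z hz
      · exact absurd (by simpa using hz) hzv

/-- The table computed from the distances in strong components contains all distances. -/
theorem join_correct (hG : G.Conservative) {d X Y o : Fin n → Fin n → WithTop ℝ}
    (hs : G.PathSound d) (hc : G.PathComplete d) (hX : G.IsLeaveTable d X)
    (hY : IsClosure (fun _ _ _ => True) X Y) (ho : IsJoinTable d Y o) (s t : Fin n) :
    (G.Reachable s t → ∃ x : ℝ, o s t = x ∧ G.IsDistance s t x) ∧
      (¬ G.Reachable s t → o s t = ⊤) := by
  have hsound : ∀ x : ℝ, o s t = x →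
      ∃ l, G.Steps s l t ∧ (s :: l.map Prod.snd).Nodup ∧ G.wt l ≤ x := by
    intro x hx
    rcases ho.sound s t x hx with h | ⟨v, y, z, hy, hz, rfl⟩
    · exact (hs s t x h).2
    · obtain ⟨l, h1, h2, h3, h4⟩ := leave_sound hs hX hY s v y hy
      obtain ⟨-, m, h5, h6, h7⟩ := hs v t z hz
      refine ⟨l ++ m, h1.append h5, nodup_append_iff.2 ⟨h2, (List.nodup_cons.1 h6).2, ?_⟩,
        by rw [wt_append]; linarith⟩
      intro z hz hz'
      refine h4 z hz ?_ ?_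
      · rintro rfl
        exact (List.nodup_cons.1 h6).1 hz'
      · obtain ⟨m₁, m₂, -, h8, -⟩ := h5.exists_split (List.mem_cons_of_mem _ hz')
        exact h8.conn
  have hcompl : ∀ l, G.Steps s l t → (s :: l.map Prod.snd).Nodup → o s t ≤ (G.wt l : ℝ) := by
    intro l hl hnd
    rcases join_complete hG hc hX hl hnd with h | ⟨inner, v, h1, -, h3⟩
    · exact (ho.complete s t).1.trans (hc s t l h hl hnd (excursionsHeavy_of_conservative hG _))
    · refine ((ho.complete s t).2 v).trans (le_trans ?_ h3)
      exact add_le_add_left (hY.le_chainWeight s v h1) _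
  constructor
  · intro h
    obtain ⟨l, hl, hnd⟩ := reachable_iff.1 h
    obtain ⟨x, hx⟩ := WithTop.ne_top_iff_exists.1
      (ne_top_of_le_ne_top WithTop.coe_ne_top (hcompl l hl hnd))
    obtain ⟨m, h1, h2, h3⟩ := hsound x hx.symm
    have hle : ∀ l, G.Steps s l t → (s :: l.map Prod.snd).Nodup → x ≤ G.wt l := by
      intro l hl hnd
      have := hcompl l hl hnd
      rwa [← hx, WithTop.coe_le_coe] at this
    exact ⟨x, hx.symm, isDistance_iff.2 ⟨⟨m, h1, h2, le_antisymm h3 (hle m h1 h2)⟩, hle⟩⟩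
  · intro h
    by_contra hne
    obtain ⟨x, hx⟩ := WithTop.ne_top_iff_exists.1 hne
    obtain ⟨m, h1, h2, -⟩ := hsound x hx.symm
    exact h (reachable_iff.2 ⟨m, h1, h2⟩)

end Final

end MixedGraph

/-! ## Counting the negative trees that paths in a strong component can meet -/

namespace MixedGraph

variable {V : Type} {G : MixedGraph V}

/-- Vertices through which a path from `s` to `t` may lead, as far as single separating vertices
can tell. -/
def Relevant (G : MixedGraph V) (s t u : V) : Prop :=
  ∀ c, c ≠ u → G.ConnAvoid c s u ∨ G.ConnAvoid c u t

/-- Another vertex c occurs on the path before u or after u but not on both sides, so one of the two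
parts avoids it. -/
theorem Steps.relevant {s t : V} {l : List ((Sym2 V ⊕ V × V) × V)} (h : G.Steps s l t)
    (hnd : (s :: l.map Prod.snd).Nodup) {u : V} (hu : u ∈ s :: l.map Prod.snd) :
    G.Relevant s t u := by
  intro c hcu
  obtain ⟨l₁, l₂, rfl, h1, h2⟩ := h.exists_split hu
  by_cases hc : c ∈ s :: l₁.map Prod.snd
  · refine .inr ⟨l₂, h2, fun hc' => ?_⟩
    rcases List.mem_cons.1 hc' with hc' | hc'
    · exact hcu hc'
    · exact (nodup_append_iff.1 hnd).2.2 c hc hc'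
  · exact .inl ⟨l₁, h1, hc⟩

/-- There is a walk in the underlying graph inside `X`. -/
def WeakConn (G : MixedGraph V) (X : Set V) (a b : V) : Prop :=
  ∃ p : G.underlying.Walk a b, ∀ z ∈ p.support, z ∈ X

theorem WeakConn.symm {X : Set V} {a b : V} (h : G.WeakConn X a b) : G.WeakConn X b a := by
  obtain ⟨p, hp⟩ := h
  exact ⟨p.reverse, by simpa using hp⟩

theorem WeakConn.trans {X : Set V} {a b c : V} (h : G.WeakConn X a b) (h' : G.WeakConn X b c) :
    G.WeakConn X a c := by
  obtain ⟨p, hp⟩ := h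
  obtain ⟨q, hq⟩ := h'
  refine ⟨p.append q, fun z hz => ?_⟩
  rcases (SimpleGraph.Walk.mem_support_append_iff _ _).1 hz with hz | hz
  · exact hp z hz
  · exact hq z hz

theorem WeakConn.reachable {X : Set V} {a b : V} (h : G.WeakConn X a b) (ha : a ∈ X)
    (hb : b ∈ X) : (G.underlying.induce X).Reachable ⟨a, ha⟩ ⟨b, hb⟩ := by
  obtain ⟨p, hp⟩ := h
  exact ⟨p.induce X hp⟩

theorem WeakConn.of_reachable {X Y : Set V} (hXY : X ⊆ Y) {a b : X}
    (h : (G.underlying.induce X).Reachable a b) : G.WeakConn Y a b := by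
  obtain ⟨p⟩ := h
  refine ⟨p.map (SimpleGraph.Embedding.induce X).toHom, fun z hz => ?_⟩
  have hz := (SimpleGraph.Walk.support_map (SimpleGraph.Embedding.induce X).toHom p) ▸ hz
  obtain ⟨w, -, rfl⟩ := List.mem_map.1 hz
  exact hXY w.2

theorem Joins.underlying_adj {a : Sym2 V ⊕ V × V} {u v : V} (h : G.Joins a u v) :
    G.underlying.Adj u v := by
  refine (SimpleGraph.fromRel_adj _ _ _).2 ⟨h.ne, .inl ?_⟩
  cases a with
  | inl e => exact .inl h.1
  | inr e => exact .inr h.1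

theorem Steps.weakConn {X : Set V} {u v : V} {l : List ((Sym2 V ⊕ V × V) × V)}
    (h : G.Steps u l v) (hX : ∀ z ∈ u :: l.map Prod.snd, z ∈ X) : G.WeakConn X u v := by
  induction l generalizing u with
  | nil =>
    obtain rfl : u = v := h
    exact ⟨.nil, by simpa using hX⟩
  | cons p l ih =>
    obtain ⟨q, hq⟩ := ih h.2 fun z hz => hX z (List.mem_cons_of_mem _ hz)
    refine ⟨.cons h.1.underlying_adj q, fun z hz => ?_⟩
    rw [SimpleGraph.Walk.support_cons] at hz
    rcases List.mem_cons.1 hz with rfl | hz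
    · exact hX z (by simp)
    · exact hq z hz

/-- The strong component of `s`. -/
def strongComponent (G : MixedGraph V) (s : V) : Set V :=
  {u | G.Reachable u s ∧ G.Reachable s u}

theorem mem_strongComponent {s u : V} :
    u ∈ G.strongComponent s ↔ G.Conn u s ∧ G.Conn s u := by
  simp [strongComponent, reachable_iff_conn]

theorem Steps.mem_strongComponent {s u v : V} {l : List ((Sym2 V ⊕ V × V) × V)}
    (h : G.Steps u l v) (hu : u ∈ G.strongComponent s) (hv : v ∈ G.strongComponent s) {z : V}
    (hz : z ∈ u :: l.map Prod.snd) : z ∈ G.strongComponent s := by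
  rw [MixedGraph.mem_strongComponent] at *
  obtain ⟨l₁, l₂, -, h1, h2⟩ := h.exists_split hz
  exact ⟨h2.conn.trans hv.1, hu.2.trans h1.conn⟩

theorem ConnAvoid.weakConn {s u v w : V} (h : G.ConnAvoid w u v)
    (hu : u ∈ G.strongComponent s) (hv : v ∈ G.strongComponent s) :
    G.WeakConn (G.strongComponent s \ {w}) u v := by
  obtain ⟨l, hl, hw⟩ := h
  refine hl.weakConn fun z hz => ⟨hl.mem_strongComponent hu hv hz, ?_⟩
  rintro rfl
  exact hw hz

/-- The vertices that no single vertex separates from `s` or from `t`. -/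
def blockSet (G : MixedGraph V) (s t : V) : Set V :=
  {u | u ∈ G.strongComponent s ∧ ∀ w, w ≠ u →
    (w ≠ s → G.WeakConn (G.strongComponent s \ {w}) u s) ∧
    (w ≠ t → G.WeakConn (G.strongComponent s \ {w}) u t)}

/-! ### The weak block of two vertices that no vertex separates -/

section

variable {s t : V}

theorem source_mem_strongComponent (s : V) : s ∈ G.strongComponent s :=
  mem_strongComponent.2 ⟨Conn.refl s, Conn.refl s⟩

theorem weakConn_of_not_separates (hst : G.Conn s t) (hts : G.Conn t s)
    (hsep : ∀ c, ¬ G.Separates c s t) {w : V} (hws : w ≠ s) (hwt : w ≠ t) :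
    G.WeakConn (G.strongComponent s \ {w}) s t := by
  have : G.ConnAvoid w s t := by
    by_contra h
    exact hsep w ⟨hst, hts, hws, hwt, h⟩
  exact this.weakConn (source_mem_strongComponent s) (mem_strongComponent.2 ⟨hts, hst⟩)

theorem weakConn_refl {X : Set V} {u : V} (hu : u ∈ X) : G.WeakConn X u u :=
  ⟨.nil, by simpa using hu⟩

/-- As s ≠ t, the removed vertex differs from one of them, and a and b are both connected to that
one. -/
theorem weakConn_of_mem_blockSet (hne : s ≠ t) {a b w : V} (ha : a ∈ G.blockSet s t)
    (hb : b ∈ G.blockSet s t) (hwa : w ≠ a) (hwb : w ≠ b) : G.WeakConn (G.strongComponent s \ {w}) a b := by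
  by_cases hws : w = s
  · have hwt : w ≠ t := fun h => hne (hws.symm.trans h)
    exact ((ha.2 w hwa).2 hwt).trans ((hb.2 w hwb).2 hwt).symm
  · exact ((ha.2 w hwa).1 hws).trans ((hb.2 w hwb).1 hws).symm

/-- When w ≠ u is removed, one of the two parts into which u cuts the path survives. It links u to
an end of the path, which is in turn linked to s and t. -/
theorem mem_blockSet_of_path {a b : V} (ha : a ∈ G.blockSet s t) (hb : b ∈ G.blockSet s t)
    {p : G.underlying.Walk a b} (hp : p.IsPath)
    (hK : ∀ z ∈ p.support, z ∈ G.strongComponent s) {u : V} (hu : u ∈ p.support) :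
    u ∈ G.blockSet s t := by
  classical
  refine ⟨hK u hu, fun w hwu => ?_⟩
  have key : ∃ c ∈ G.blockSet s t, w ≠ c ∧ G.WeakConn (G.strongComponent s \ {w}) u c := by
    by_cases hw : w ∈ (p.takeUntil u hu).support
    · refine ⟨b, hb, ?_, p.dropUntil u hu, fun z hz => ⟨hK z ?_, ?_⟩⟩ <;>
        have hno : w ∉ (p.dropUntil u hu).support := by
          intro hw'
          have hnd := hp.support_nodup
          rw [← p.take_spec hu, SimpleGraph.Walk.support_append, List.nodup_append] at hnd
          rw [← SimpleGraph.Walk.cons_tail_support] at hw'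
          rcases List.mem_cons.1 hw' with hw' | hw'
          · exact hwu hw'
          · exact hnd.2.2 w hw w hw' rfl
      · rintro rfl; exact hno (SimpleGraph.Walk.end_mem_support _)
      · exact p.support_dropUntil_subset_support hu hz
      · rintro rfl; exact hno hz
    · refine ⟨a, ha, ?_, (p.takeUntil u hu).reverse, fun z hz => ?_⟩
      · rintro rfl; exact hw (SimpleGraph.Walk.start_mem_support _)
      · rw [SimpleGraph.Walk.support_reverse, List.mem_reverse] at hz
        refine ⟨hK z (p.support_takeUntil_subset_support hu hz), ?_⟩
        rintro rfl; exact hw hz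
  obtain ⟨c, hc, hwc, huc⟩ := key
  exact ⟨fun h => huc.trans ((hc.2 w hwc).1 h), fun h => huc.trans ((hc.2 w hwc).2 h)⟩

theorem weakConn_blockSet {X : Set V} (hX : X ⊆ G.strongComponent s) {a b : V}
    (ha : a ∈ G.blockSet s t) (hb : b ∈ G.blockSet s t) (h : G.WeakConn X a b) :
    G.WeakConn (G.blockSet s t ∩ X) a b := by
  classical
  obtain ⟨p, hp⟩ := h
  have hb' : ∀ z ∈ p.bypass.support, z ∈ X := fun z hz => hp z (p.support_bypass_subset_support hz)
  exact ⟨p.bypass, fun z hz => ⟨mem_blockSet_of_path ha hb p.bypass_isPath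
    (fun z hz => hX (hb' z hz)) hz, hb' z hz⟩⟩

theorem source_mem_blockSet (hst : G.Conn s t) (hts : G.Conn t s)
    (hsep : ∀ c, ¬ G.Separates c s t) : s ∈ G.blockSet s t :=
  ⟨source_mem_strongComponent s, fun _ hw =>
    ⟨fun _ => weakConn_refl ⟨source_mem_strongComponent s, fun h => hw (by simpa using h.symm)⟩,
      fun hwt => weakConn_of_not_separates hst hts hsep hw hwt⟩⟩

theorem target_mem_blockSet (hst : G.Conn s t) (hts : G.Conn t s)
    (hsep : ∀ c, ¬ G.Separates c s t) : t ∈ G.blockSet s t :=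
  have ht : t ∈ G.strongComponent s := mem_strongComponent.2 ⟨hts, hst⟩
  ⟨ht, fun _ hw => ⟨fun hws => (weakConn_of_not_separates hst hts hsep hws hw).symm,
    fun _ => weakConn_refl ⟨ht, fun h => hw (by simpa using h.symm)⟩⟩⟩

theorem weakConn_strongComponent {a b : V} (ha : a ∈ G.strongComponent s)
    (hb : b ∈ G.strongComponent s) : G.WeakConn (G.strongComponent s) a b := by
  have h := (mem_strongComponent.1 ha).1.trans (mem_strongComponent.1 hb).2
  obtain ⟨l, hl⟩ := h
  exact hl.weakConn fun z hz => hl.mem_strongComponent ha hb hz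

/-- Nonseparability: connections in the component, with or without a vertex removed, shorten to
paths, and paths between members stay among the members. Maximality: a larger nonseparable set
contains s and t and connects each of its vertices to both of them after the removal of any other
vertex, which is the condition for membership. -/
theorem isWeakBlock_blockSet (hne : s ≠ t) (hst : G.Conn s t) (hts : G.Conn t s)
    (hsep : ∀ c, ¬ G.Separates c s t) : G.IsWeakBlock (G.strongComponent s) (G.blockSet s t) := by
  have hs := source_mem_blockSet hst hts hsep
  have ht := target_mem_blockSet hst hts hsep
  have hsub : G.blockSet s t ⊆ G.strongComponent s := fun u hu => hu.1
  refine ⟨⟨hsub, ⟨{ preconnected := fun a b => ?_, nonempty := ⟨s, hs⟩ }, ?_⟩⟩, ?_⟩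
  · have := weakConn_blockSet (s := s) (t := t) (le_refl _) a.2 b.2
      (weakConn_strongComponent (hsub a.2) (hsub b.2))
    rw [Set.inter_eq_left.2 hsub] at this
    exact this.reachable a.2 b.2
  · intro w _ a b
    have h1 := weakConn_blockSet (s := s) (t := t) Set.sdiff_subset a.2.1 b.2.1
      (weakConn_of_mem_blockSet hne a.2.1 b.2.1 (fun h => a.2.2 h.symm) (fun h => b.2.2 h.symm))
    have h2 : G.blockSet s t ∩ (G.strongComponent s \ {w}) = G.blockSet s t \ {w} := by
      ext z
      constructor
      · rintro ⟨h1, h2, h3⟩; exact ⟨h1, h3⟩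
      · rintro ⟨h1, h3⟩; exact ⟨h1, hsub h1, h3⟩
    rw [h2] at h1
    exact h1.reachable a.2 b.2
  · rintro S ⟨hSK, hconn, hcut⟩ hBS u hu
    have hsS : s ∈ S := hBS hs
    have htS : t ∈ S := hBS ht
    refine ⟨hSK hu, fun w hwu => ?_⟩
    have key : ∀ c ∈ S, w ≠ c → G.WeakConn (G.strongComponent s \ {w}) u c := by
      intro c hc hwc
      by_cases hwS : w ∈ S
      · have := hcut w hwS ⟨u, hu, fun h => hwu h.symm⟩ ⟨c, hc, fun h => hwc h.symm⟩
        exact WeakConn.of_reachable (Set.sdiff_subset_sdiff_left hSK) this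
      · have := hconn.preconnected ⟨u, hu⟩ ⟨c, hc⟩
        have hS : S ⊆ G.strongComponent s \ {w} := fun z hz =>
          ⟨hSK hz, fun h => hwS (by rwa [← show z = w from h])⟩
        exact WeakConn.of_reachable hS this
    exact ⟨key s hsS, key t htS⟩

/-- For u different from s and t, relevance with t and then s removed shows that s reaches u and u
reaches t, so u is in the component. For any other removed vertex it connects u to s or to t, and
these two remain connected to each other unless one of them is removed. -/
theorem Relevant.mem_blockSet (hst : G.Conn s t) (hts : G.Conn t s)
    (hsep : ∀ c, ¬ G.Separates c s t) {u : V} (hu : G.Relevant s t u) : u ∈ G.blockSet s t := by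
  by_cases hus : u = s
  · subst hus; exact source_mem_blockSet hst hts hsep
  by_cases hut : u = t
  · subst hut; exact target_mem_blockSet hst hts hsep
  have h1 : G.Conn s u := by
    rcases hu t (fun h => hut h.symm) with ⟨l, hl, -⟩ | ⟨l, hl, hno⟩
    · exact hl.conn
    · exact absurd hl.end_mem hno
  have h2 : G.Conn u t := by
    rcases hu s (fun h => hus h.symm) with ⟨l, hl, hno⟩ | ⟨l, hl, -⟩
    · simp at hno
    · exact hl.conn
  have hs := source_mem_strongComponent (G := G) s
  have ht : t ∈ G.strongComponent s := mem_strongComponent.2 ⟨hts, hst⟩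
  have huK : u ∈ G.strongComponent s := mem_strongComponent.2 ⟨h2.trans hts, h1⟩
  refine ⟨huK, fun w hw => ?_⟩
  rcases hu w hw with h | h
  · have hws : w ≠ s := by
      obtain ⟨l, -, hno⟩ := h
      rintro rfl
      simp at hno
    have h' := (h.weakConn hs huK).symm
    exact ⟨fun _ => h', fun hwt => h'.trans (weakConn_of_not_separates hst hts hsep hws hwt)⟩
  · have hwt : w ≠ t := by
      obtain ⟨l, hl, hno⟩ := h
      rintro rfl
      exact hno hl.end_mem
    have h' := h.weakConn huK ht
    exact ⟨fun hws => h'.trans (weakConn_of_not_separates hst hts hsep hws hwt).symm, fun _ => h'⟩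

/-- A negative tree does not fall apart inside the block: a path of negative edges between two
members stays in the strong component and hence in the block. -/
theorem negReachable_blockSet {a b : V} (ha : a ∈ G.blockSet s t) (hb : b ∈ G.blockSet s t)
    (h : G.negEdges.Reachable a b) :
    (G.negEdges.induce (G.blockSet s t)).Reachable ⟨a, ha⟩ ⟨b, hb⟩ := by
  classical
  obtain ⟨p, hp⟩ : ∃ p : G.negEdges.Walk a b, p.IsPath := h.exists_isPath
  have hle : G.negEdges ≤ G.underlying := fun u v huv =>
    (negEdges_adj_joins huv).1.underlying_adj
  have hsup : ∀ z ∈ p.support, z ∈ G.blockSet s t := by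
    intro z hz
    refine mem_blockSet_of_path (p := p.mapLe hle) ha hb (by simpa using hp) (fun z hz => ?_)
      (by simpa using hz)
    have hz' : z ∈ p.support := by simpa using hz
    have := steps_negSteps p
    exact this.mem_strongComponent ha.1 hb.1 (by rwa [cons_map_negSteps])
  exact ⟨p.induce _ hsup⟩

/-- Different negative trees with at least two relevant vertices count towards the number of
negative trees in one weak block. -/
theorem card_le_of_weakBlocks [Finite V] (hne : s ≠ t) (hst : G.Conn s t) (hts : G.Conn t s)
    (hsep : ∀ c, ¬ G.Separates c s t) {k : ℕ}
    (hk : ∀ K B : Set V, G.IsStrongComponent K → G.IsWeakBlock K B → G.numNegTrees B ≤ k)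
    (R : Finset V) (hR : ∀ u ∈ R, ∃ v, G.Relevant s t u ∧ G.Relevant s t v ∧ u ≠ v ∧
      G.negEdges.Reachable u v)
    (hinj : ∀ u ∈ R, ∀ v ∈ R, G.negEdges.Reachable u v → u = v) : R.card ≤ k := by
  classical
  refine le_trans ?_ (hk (G.strongComponent s) (G.blockSet s t) ⟨s, rfl⟩
    (isWeakBlock_blockSet hne hst hts hsep))
  rw [numNegTrees, ← Set.ncard_coe_finset]
  have hmem : ∀ u ∈ R, u ∈ G.blockSet s t := fun u hu => by
    obtain ⟨v, h, -⟩ := hR u hu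
    exact h.mem_blockSet hst hts hsep
  -- The vertices of `R` lie in the block; elsewhere the component of s is only a default value.
  let f : V → (G.negEdges.induce (G.blockSet s t)).ConnectedComponent := fun u =>
    (G.negEdges.induce (G.blockSet s t)).connectedComponentMk
      (if h : u ∈ G.blockSet s t then ⟨u, h⟩ else ⟨s, source_mem_blockSet hst hts hsep⟩)
  have hf : ∀ u (h : u ∈ G.blockSet s t), f u =
      (G.negEdges.induce (G.blockSet s t)).connectedComponentMk ⟨u, h⟩ := by
    intro u h
    simp only [f, dif_pos h]
  refine Set.ncard_le_ncard_of_injOn f ?_ ?_ (Set.toFinite _)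
  · intro u hu
    obtain ⟨v, h1, h2, huv, hr⟩ := hR u hu
    have hu' := h1.mem_blockSet hst hts hsep
    have hv' := h2.mem_blockSet hst hts hsep
    rw [hf u hu']
    refine ⟨⟨u, hu'⟩, rfl, ⟨v, hv'⟩, ?_, fun h => huv (congrArg Subtype.val h)⟩
    exact SimpleGraph.ConnectedComponent.sound (negReachable_blockSet hu' hv' hr).symm
  · intro u hu v hv huv
    have hu' := hmem u hu
    have hv' := hmem v hv
    rw [hf u hu', hf v hv'] at huv
    have := SimpleGraph.ConnectedComponent.exact huv
    exact hinj u hu v hv (this.map (SimpleGraph.Embedding.induce _).toHom)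

end

end MixedGraph

/-! ## Distance tables in memory -/

namespace RAM

/-- The entry of a table of distances: infinite if the integer array holds `0`, and otherwise given
by the real array. -/
noncomputable def State.val (s : State) (a k : ℕ) : WithTop ℝ :=
  if s.natArr a k = 0 then ⊤ else (s.realArr a k : WithTop ℝ)

/-- A table of distances stored row by row. -/
noncomputable def State.tab (s : State) (n a : ℕ) (i j : Fin n) : WithTop ℝ := s.val a (i * n + j)

theorem Agree.val_eq {X A : List ℕ} {s σ : State} (h : Agree X A s σ) {a : ℕ} (ha : a ∉ A) :
    σ.val a = s.val a := by
  funext k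
  simp [State.val, h.2.1 a ha, h.2.2 a ha]

theorem Agree.tab_eq {X A : List ℕ} {s σ : State} (h : Agree X A s σ) {a : ℕ} (ha : a ∉ A)
    (n : ℕ) : σ.tab n a = s.tab n a := by
  funext i j
  simp [State.tab, h.val_eq ha]

theorem val_ne_top_iff {s : State} {a k : ℕ} : s.val a k ≠ ⊤ ↔ s.natArr a k ≠ 0 := by
  unfold State.val
  split_ifs with h <;> simp [h]

theorem val_of_ne {s : State} {a k : ℕ} (h : s.natArr a k ≠ 0) :
    s.val a k = (s.realArr a k : ℝ) := if_neg h

theorem index_inj {n i j i' j' : ℕ} (hj : j < n) (hj' : j' < n) (h : i * n + j = i' * n + j') :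
    i = i' ∧ j = j' := by
  have hn : 0 < n := by omega
  have h1 : (i * n + j) / n = i := by
    rw [mul_comm, Nat.mul_add_div hn, Nat.div_eq_of_lt hj, add_zero]
  have h2 : (i' * n + j') / n = i' := by
    rw [mul_comm, Nat.mul_add_div hn, Nat.div_eq_of_lt hj', add_zero]
  have : i = i' := by rw [← h1, ← h2, h]
  subst this
  exact ⟨rfl, by omega⟩

theorem fin_index_inj {n : ℕ} {i j i' j' : Fin n} (h : (i : ℕ) * n + j = i' * n + j') :
    i = i' ∧ j = j' := by
  obtain ⟨h1, h2⟩ := index_inj j.2 j'.2 h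
  exact ⟨Fin.ext h1, Fin.ext h2⟩

namespace ForProg

/-- The position in row `x` and column `y`, for variables `x` and `y`. -/
def ix (x y : ℕ) : NatExpr := .add (.mul (.var x) (.var 0)) (.var y)

/-- The test whether an entry of a table is finite. -/
def finite (a : ℕ) (i : NatExpr) : Test := .not (.natEq (.get a i) (.lit 0))

/-- If `b` holds, replace entry `i` of table `a` by its minimum with `e`. -/
def relax (a : ℕ) (i : NatExpr) (b : Test) (e : RealExpr) : ForProg :=
  .ite (.and b (.not (.and (finite a i) (.not (.realLt e (.get a i))))))
    (.seq (.setR a i e) (.setA a i (.lit 1))) .skip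

theorem natExpr_eval_congr {s σ : State} (h1 : σ.natVar = s.natVar) (h2 : σ.natArr = s.natArr)
    (e : NatExpr) : e.eval σ = e.eval s := by
  induction e <;> simp_all [NatExpr.eval]

theorem finite_holds {a : ℕ} {i : NatExpr} {s : State} :
    (finite a i).Holds s ↔ s.val a (i.eval s) ≠ ⊤ := by
  rw [val_ne_top_iff]; rfl

open Classical in
theorem val_relax (a : ℕ) (i : NatExpr) (b : Test) (e : RealExpr) (s : State) (k : ℕ) :
    ((relax a i b e).run s).val a k = if k = i.eval s then
      min (s.val a k) (if b.Holds s then (e.eval s : WithTop ℝ) else ⊤) else s.val a k := by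
  have hset : ((ForProg.seq (.setR a i e) (.setA a i (.lit 1))).run s).val a k =
      if k = i.eval s then (e.eval s : WithTop ℝ) else s.val a k := by
    have h0 : i.eval ((ForProg.setR a i e).run s) = i.eval s :=
      natExpr_eval_congr (s := s) (σ := (ForProg.setR a i e).run s) rfl rfl i
    simp only [run] at h0 ⊢
    rw [h0]
    simp only [State.val, updateArr_apply, NatExpr.eval]
    by_cases hk : k = i.eval s <;> simp [hk]
  rw [relax, run]
  by_cases hb : b.Holds s
  · by_cases hlt : s.val a (i.eval s) ≠ ⊤ ∧ ¬ e.eval s < s.realArr a (i.eval s)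
    · rw [if_neg]
      · split_ifs with hk
        · subst hk
          rw [min_eq_left]
          · rfl
          · rw [val_of_ne (val_ne_top_iff.1 hlt.1), WithTop.coe_le_coe]
            exact not_lt.1 hlt.2
        · rfl
      · rintro ⟨-, h⟩
        exact h ⟨finite_holds.2 hlt.1, hlt.2⟩
    · rw [if_pos, hset, if_pos hb]
      · split_ifs with hk
        · subst hk
          rw [min_eq_right]
          by_cases ht : s.val a (i.eval s) = ⊤
          · rw [ht]; exact le_top
          · rw [val_of_ne (val_ne_top_iff.1 ht), WithTop.coe_le_coe]
            have := not_and.1 hlt ht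
            exact (not_not.1 this).le
        · rfl
      · refine ⟨hb, fun h => hlt ⟨finite_holds.1 h.1, h.2⟩⟩
  · rw [if_neg (fun h => hb h.1), if_neg hb, min_eq_left le_top]
    simp [run]

/-- The memory `σ` arises from `s` by lowering entries of table `a`, where property `P` of all
entries is preserved. -/
def Lowers (X : List ℕ) (a : ℕ) (P : ℕ → ℝ → Prop) (s σ : State) : Prop :=
  Agree X [a] s σ ∧ (∀ k, σ.val a k ≤ s.val a k) ∧
    ((∀ k x, s.val a k = (x : ℝ) → P k x) → ∀ k x, σ.val a k = (x : ℝ) → P k x)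

variable {X : List ℕ} {a : ℕ} {P : ℕ → ℝ → Prop} {s σ τ : State}

theorem Lowers.refl (s : State) : Lowers X a P s s :=
  ⟨Agree.refl s, fun _ => le_rfl, id⟩

theorem Lowers.trans (h : Lowers X a P s σ) (h' : Lowers X a P σ τ) : Lowers X a P s τ :=
  ⟨h.1.trans h'.1, fun k => (h'.2.1 k).trans (h.2.1 k), fun hs => h'.2.2 (h.2.2 hs)⟩

theorem Lowers.mono {X' : List ℕ} (h : Lowers X a P s σ) (hX : X ⊆ X') : Lowers X' a P s σ :=
  ⟨h.1.mono hX (fun _ h => h), h.2⟩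

theorem lowers_setVar {x v : ℕ} (hx : x ∈ X) : Lowers X a P s (s.setVar x v) :=
  ⟨agree_setVar s v hx, fun _ => le_rfl, id⟩

theorem lowers_relax {i : NatExpr} {b : Test} {e : RealExpr}
    (h : (∀ k x, s.val a k = (x : ℝ) → P k x) → b.Holds s → P (i.eval s) (e.eval s)) :
    Lowers X a P s ((relax a i b e).run s) ∧
      (b.Holds s → ((relax a i b e).run s).val a (i.eval s) ≤ (e.eval s : ℝ)) := by
  classical
  refine ⟨⟨?_, fun k => ?_, fun hs k x hx => ?_⟩, fun hb => ?_⟩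
  · exact ((relax a i b e).agree_run s).mono (by simp [relax, vars]) (by simp [relax, arrs])
  · rw [val_relax]
    split_ifs with hk
    · exact min_le_left _ _
    · exact min_le_left _ _
    · exact le_rfl
  · rw [val_relax] at hx
    split_ifs at hx with hk hb
    · rcases min_choice (s.val a k) (e.eval s : WithTop ℝ) with hm | hm
      · exact hs k x (hm ▸ hx)
      · rw [hm, WithTop.coe_eq_coe] at hx
        rw [hk, ← hx]
        exact h hs hb
    · rw [min_eq_left le_top] at hx
      exact hs k x hx
    · exact hs k x hx
  · rw [val_relax, if_pos rfl, if_pos hb]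
    exact min_le_right _ _

/-- Two nested loops each round of which changes the memory along a preorder `R` and establishes a
property that persists along `R`. -/
theorem run_for2_rel {p : ForProg} {x y n : ℕ} {s : State} (R : State → State → Prop)
    (Q : ℕ → ℕ → State → Prop) (htrans : ∀ σ τ υ, R σ τ → R τ υ → R σ υ)
    (hxvar : ∀ σ v, R σ (σ.setVar x v)) (hyvar : ∀ σ v, R σ (σ.setVar y v))
    (hR0 : ∀ σ τ, R σ τ → τ.natVar 0 = σ.natVar 0)
    (hQ : ∀ i j σ τ, R σ τ → Q i j σ → Q i j τ) (hxy : x ≠ y) (hxp : x ∉ p.vars)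
    (hn : s.natVar 0 = n)
    (hs : ∀ i j σ, i < n → j < n → σ.natVar x = i → σ.natVar y = j → R s σ →
      R σ (p.run σ) ∧ Q i j (p.run σ)) :
    R s ((for_ x 0 (for_ y 0 p)).run s) ∧
      ∀ i < n, ∀ j < n, Q i j ((for_ x 0 (for_ y 0 p)).run s) := by
  subst hn
  refine run_for_rel R (fun i σ => ∀ j < s.natVar 0, Q i j σ) htrans hxvar
    (fun i σ τ h hσ j hj => hQ i j σ τ h (hσ j hj)) ?_
  intro i σ hi hx hsσ
  have h0 := hR0 _ _ hsσ
  have := run_for_rel (p := p) (x := y) (y := 0) (s := σ)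
    (fun σ τ => R σ τ ∧ τ.natVar x = σ.natVar x) (fun j σ => Q i j σ)
    (fun σ τ υ h h' => ⟨htrans _ _ _ h.1 h'.1, h'.2.trans h.2⟩)
    (fun σ v => ⟨hyvar σ v, setVar_natVar_of_ne _ _ hxy⟩)
    (fun j σ τ h hσ => hQ i j σ τ h.1 hσ) ?_
  · rw [h0] at this
    exact ⟨this.1.1, this.2⟩
  · intro j τ hj hy hτ
    rw [h0] at hj
    obtain ⟨h1, h2⟩ := hs i j τ hi hj (hτ.2.trans hx) hy (htrans _ _ _ hsσ hτ.1)
    exact ⟨⟨h1, (p.agree_run τ).1 x hxp⟩, h2⟩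

theorem run_for2_lowers {p : ForProg} {x y n : ℕ} {s : State} (Q : ℕ → ℕ → State → Prop)
    (hx : x ∈ X) (hy : y ∈ X) (h0 : 0 ∉ X)
    (hQ : ∀ i j σ τ, Lowers X a P σ τ → Q i j σ → Q i j τ) (hxy : x ≠ y) (hxp : x ∉ p.vars)
    (hn : s.natVar 0 = n)
    (hs : ∀ i j σ, i < n → j < n → σ.natVar x = i → σ.natVar y = j → Lowers X a P s σ →
      Lowers X a P σ (p.run σ) ∧ Q i j (p.run σ)) :
    Lowers X a P s ((for_ x 0 (for_ y 0 p)).run s) ∧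
      ∀ i < n, ∀ j < n, Q i j ((for_ x 0 (for_ y 0 p)).run s) :=
  run_for2_rel (Lowers X a P) Q (fun _ _ _ h h' => h.trans h')
    (fun _ _ => lowers_setVar hx) (fun _ _ => lowers_setVar hy) (fun _ _ h => h.1.1 0 h0) hQ hxy hxp
    hn hs

theorem run_for_lowers {p : ForProg} {x n : ℕ} {s : State} (Q : ℕ → State → Prop)
    (hx : x ∈ X) (hQ : ∀ i σ τ, Lowers X a P σ τ → Q i σ → Q i τ) (hn : s.natVar 0 = n)
    (hs : ∀ i σ, i < n → σ.natVar x = i → Lowers X a P s σ →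
      Lowers X a P σ (p.run σ) ∧ Q i (p.run σ)) :
    Lowers X a P s ((for_ x 0 p).run s) ∧ ∀ i < n, Q i ((for_ x 0 p).run s) := by
  subst hn
  exact run_for_rel (Lowers X a P) Q (fun _ _ _ h h' => h.trans h')
    (fun _ _ => lowers_setVar hx) hQ hs

/-- The algorithm of Floyd and Warshall on table `a`, where an intermediate vertex is used only if
the test `b` holds. -/
def floydWarshall (a : ℕ) (b : Test) : ForProg :=
  .for_ 10 0 (.for_ 11 0 (.for_ 12 0 (relax a (ix 11 12)
    (.and b (.and (finite a (ix 11 10)) (finite a (ix 10 12))))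
    (.add (.get a (ix 11 10)) (.get a (ix 10 12))))))

theorem eval_ix {n x y : ℕ} (hn : s.natVar 0 = n) :
    (ix x y).eval s = s.natVar x * n + s.natVar y := by
  simp [ix, NatExpr.eval, hn]

/-- Updating in place is harmless. Entries only decrease during the round, so what is read in row
and column k is at most its value at the beginning, and every single relaxation preserves P. -/
theorem floydWarshall_round {n : ℕ} {b : Test} {Z : Fin n → Fin n → Fin n → Prop}
    {P : Fin n → Fin n → ℝ → Prop}
    (hP : ∀ i k j x y, Z k i j → P i k x → P k j y → P i j (x + y)) (k : Fin n)
    (hn : s.natVar 0 = n) (hk : s.natVar 10 = k)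
    (hb : ∀ σ, Agree [10, 11, 12] [a] s σ → ∀ k i j : Fin n, σ.natVar 10 = k → σ.natVar 11 = i →
      σ.natVar 12 = j → (b.Holds σ ↔ Z k i j)) :
    let s' := (ForProg.for_ 11 0 (.for_ 12 0 (relax a (ix 11 12)
      (.and b (.and (finite a (ix 11 10)) (finite a (ix 10 12))))
      (.add (.get a (ix 11 10)) (.get a (ix 10 12)))))).run s
    Lowers [11, 12] a (fun m x => ∀ i j : Fin n, m = i * n + j → P i j x) s s' ∧
      ∀ i j : Fin n, Z k i j → s'.tab n a i j ≤ s.tab n a i k + s.tab n a k j := by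
  intro s'
  have := run_for2_lowers (X := [11, 12]) (a := a) (s := s) (x := 11) (y := 12)
    (P := fun m x => ∀ i j : Fin n, m = i * n + j → P i j x)
    (p := relax a (ix 11 12)
      (.and b (.and (finite a (ix 11 10)) (finite a (ix 10 12))))
      (.add (.get a (ix 11 10)) (.get a (ix 10 12))))
    (fun i j σ => ∀ i' j' : Fin n, (i' : ℕ) = i → (j' : ℕ) = j → Z k i' j' →
      σ.tab n a i' j' ≤ s.tab n a i' k + s.tab n a k j')
    (by simp) (by simp) (by simp) ?_ (by simp) (by simp [relax, vars]) hn ?_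
  · exact ⟨this.1, fun i j h => this.2 i i.2 j j.2 i j rfl rfl h⟩
  · intro i j σ τ h hσ i' j' hi hj hZ
    exact (h.2.1 _).trans (hσ i' j' hi hj hZ)
  · intro i j σ hi hj h11 h12 hsσ
    have hn' : σ.natVar 0 = n := (hsσ.1.1 0 (by simp)).trans hn
    have hk' : σ.natVar 10 = k := (hsσ.1.1 10 (by simp)).trans hk
    have e1 : (ix 11 12).eval σ = i * n + j := by rw [eval_ix hn', h11, h12]
    have e2 : (ix 11 10).eval σ = i * n + k := by rw [eval_ix hn', h11, hk']
    have e3 : (ix 10 12).eval σ = k * n + j := by rw [eval_ix hn', h12, hk']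
    have hb' := hb σ (hsσ.1.mono (by simp) (by simp)) k ⟨i, hi⟩ ⟨j, hj⟩ hk' h11 h12
    have hr := lowers_relax (X := [11, 12]) (s := σ) (a := a)
      (P := fun m x => ∀ i j : Fin n, m = i * n + j → P i j x) (i := ix 11 12)
      (b := .and b (.and (finite a (ix 11 10)) (finite a (ix 10 12))))
      (e := .add (.get a (ix 11 10)) (.get a (ix 10 12))) ?_
    · refine ⟨hr.1, ?_⟩
      rintro i' j' rfl rfl hZ
      have h1 : σ.tab n a i' k ≤ s.tab n a i' k := hsσ.2.1 _
      have h2 : σ.tab n a k j' ≤ s.tab n a k j' := hsσ.2.1 _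
      by_cases hfin : σ.tab n a i' k ≠ ⊤ ∧ σ.tab n a k j' ≠ ⊤
      · refine le_trans ?_ (add_le_add h1 h2)
        have := hr.2 ⟨hb'.2 hZ, finite_holds.2 (by rw [e2]; exact hfin.1),
          finite_holds.2 (by rw [e3]; exact hfin.2)⟩
        rw [e1] at this
        refine this.trans (le_of_eq ?_)
        have h3 := val_of_ne (val_ne_top_iff.1 hfin.1)
        have h4 := val_of_ne (val_ne_top_iff.1 hfin.2)
        simp only [State.tab, h3, h4, RealExpr.eval, e2, e3, WithTop.coe_add]
      · have : s.tab n a i' k + s.tab n a k j' = ⊤ := by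
          rw [WithTop.add_eq_top]
          by_contra hno
          push Not at hno
          exact hfin ⟨ne_top_of_le_ne_top hno.1 h1, ne_top_of_le_ne_top hno.2 h2⟩
        rw [this]
        exact le_top
    · rintro hs ⟨hbz, hf1, hf2⟩ i' j' heq
      rw [finite_holds, e2] at hf1
      rw [finite_holds, e3] at hf2
      rw [e1] at heq
      obtain ⟨rfl, rfl⟩ := index_inj hj j'.2 heq
      simp only [RealExpr.eval, e2, e3]
      exact hP i' k j' _ _ (hb'.1 hbz) (hs _ _ (val_of_ne (val_ne_top_iff.1 hf1)) i' k rfl)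
        (hs _ _ (val_of_ne (val_ne_top_iff.1 hf2)) k j' rfl)

open MixedGraph in
theorem run_floydWarshall {n : ℕ} {b : Test} {Z : Fin n → Fin n → Fin n → Prop}
    (hn : s.natVar 0 = n)
    (hb : ∀ σ, Agree [10, 11, 12] [a] s σ → ∀ k i j : Fin n, σ.natVar 10 = k → σ.natVar 11 = i →
      σ.natVar 12 = j → (b.Holds σ ↔ Z k i j)) :
    Agree [10, 11, 12] [a] s ((floydWarshall a b).run s) ∧
      IsClosure Z (s.tab n a) (((floydWarshall a b).run s).tab n a) := by
  have hag : ((floydWarshall a b).run s).natVar 0 = s.natVar 0 :=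
    ((floydWarshall a b).agree_run s).1 0 (by simp [floydWarshall, vars, relax])
  have hround : ∀ (P : Fin n → Fin n → ℝ → Prop),
      (∀ i k j x y, Z k i j → P i k x → P k j y → P i j (x + y)) →
      ∀ (k : Fin n) σ, Agree [10, 11, 12] [a] s σ → σ.natVar 10 = k → _ := fun P hP k σ hσ hk =>
    floydWarshall_round (s := σ) (a := a) (b := b) (Z := Z) (P := P) hP k
      ((hσ.1 0 (by simp)).trans hn) hk (fun τ hτ => hb τ (hσ.trans hτ))
  refine ⟨((floydWarshall a b).agree_run s).mono (by simp [floydWarshall, vars, relax])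
    (by simp [floydWarshall, arrs, relax]), ⟨fun P hP h0 => ?_, ?_⟩⟩
  · have := run_for_lowers (X := [10, 11, 12]) (a := a) (s := s) (x := 10)
      (P := fun m x => ∀ i j : Fin n, m = i * n + j → P i j x) (fun _ _ => True) (by simp)
      (fun _ _ _ _ _ => trivial) hn (p := .for_ 11 0 (.for_ 12 0 (relax a (ix 11 12)
        (.and b (.and (finite a (ix 11 10)) (finite a (ix 10 12))))
        (.add (.get a (ix 11 10)) (.get a (ix 10 12)))))) ?_
    · intro i j x hx
      refine this.1.2.2 ?_ _ x hx i j rfl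
      rintro k x hx i j rfl
      exact h0 i j x hx
    · intro k σ hk h10 hsσ
      exact ⟨(hround P hP ⟨k, hk⟩ σ hsσ.1 h10).1.mono (by simp), trivial⟩
  · have := run_for (s := s) (x := 10) (y := 0) (p := .for_ 11 0 (.for_ 12 0 (relax a (ix 11 12)
        (.and b (.and (finite a (ix 11 10)) (finite a (ix 10 12))))
        (.add (.get a (ix 11 10)) (.get a (ix 10 12))))))
      (fun m σ => Agree [10, 11, 12] [a] s σ ∧ ∃ f : ℕ → Fin n → Fin n → WithTop ℝ,
        f 0 = s.tab n a ∧ f m = σ.tab n a ∧ ∀ (k i j : Fin n), (k : ℕ) < m →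
          f (k + 1) i j ≤ f k i j ∧ (Z k i j → f (k + 1) i j ≤ f k i k + f k k j)) ?_ ?_
    · obtain ⟨-, f, h0, h1, h2⟩ := this
      rw [hn] at h1 h2
      exact ⟨f, h0, h1, fun k i j => h2 k i j k.2⟩
    · exact ⟨agree_setVar s 0 (by simp), fun _ => s.tab n a, rfl, rfl, by simp⟩
    · rintro m σ hm h10 ⟨hσ, f, h0, h1, h2⟩
      rw [hn] at hm
      obtain ⟨h3, h4⟩ := hround (fun _ _ _ => True) (by simp) ⟨m, hm⟩ σ hσ h10
      refine ⟨(hσ.trans (h3.1.mono (by simp) (by simp))).trans (agree_setVar _ _ (by simp)),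
        Function.update f (m + 1) (State.tab ((ForProg.for_ 11 0 (.for_ 12 0 (relax a (ix 11 12)
        (.and b (.and (finite a (ix 11 10)) (finite a (ix 10 12))))
        (.add (.get a (ix 11 10)) (.get a (ix 10 12)))))).run σ) n a),
        by simp [h0], by rw [Function.update_self]; rfl, ?_⟩
      intro k i j hk
      rcases Nat.lt_succ_iff_lt_or_eq.1 hk with hk | hk
      · have e1 : (k : ℕ) + 1 ≠ m + 1 := by omega
        have e2 : (k : ℕ) ≠ m + 1 := by omega
        rw [Function.update_of_ne e1, Function.update_of_ne e2]
        exact h2 k i j hk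
      · have e2 : m ≠ m + 1 := by omega
        obtain rfl : k = ⟨m, hm⟩ := Fin.ext hk
        simp only
        rw [Function.update_self, Function.update_of_ne e2, h1]
        exact ⟨h3.2.1 _, h4 i j⟩

end ForProg

end RAM

/-! ## Reachability, closures of links, and the test for cycles of negative edges -/

namespace RAM

open MixedGraph

/-- The arrays `0` and `1` hold the graph. -/
structure HoldsGraph {n : ℕ} (G : MixedGraph (Fin n)) (s : State) : Prop where
  size : s.natVar 0 = n
  edge : ∀ u v : Fin n, s.natArr 0 (u * n + v) ≠ 0 ↔ G.edges.Adj u v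
  arc : ∀ u v : Fin n, s.natArr 1 (u * n + v) ≠ 0 ↔ G.arcs.Adj u v
  edgeWeight : ∀ u v : Fin n, G.edges.Adj u v → s.realArr 0 (u * n + v) = G.edgeWeight s(u, v)
  arcWeight : ∀ u v : Fin n, G.arcs.Adj u v → s.realArr 1 (u * n + v) = G.arcWeight (u, v)

variable {n : ℕ} {G : MixedGraph (Fin n)} {s σ : State} {X A : List ℕ}

theorem HoldsGraph.of_agree (h : HoldsGraph G s) (hs : Agree X A s σ) (h0 : 0 ∉ X) (h1 : 0 ∉ A)
    (h2 : 1 ∉ A) : HoldsGraph G σ where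
  size := (hs.1 0 h0).trans h.size
  edge := by rw [hs.2.1 0 h1]; exact h.edge
  arc := by rw [hs.2.1 1 h2]; exact h.arc
  edgeWeight := by rw [hs.2.2 0 h1]; exact h.edgeWeight
  arcWeight := by rw [hs.2.2 1 h2]; exact h.arcWeight

theorem HoldsGraph.neg_iff (h : HoldsGraph G s) (u v : Fin n) :
    (s.natArr 0 (u * n + v) ≠ 0 ∧ s.realArr 0 (u * n + v) < 0) ↔ G.negEdges.Adj u v := by
  rw [h.edge]
  constructor
  · rintro ⟨h1, h2⟩; exact ⟨h1, by rwa [← h.edgeWeight u v h1]⟩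
  · rintro ⟨h1, h2⟩; exact ⟨h1, by rwa [h.edgeWeight u v h1]⟩

/-- There is a walk from `u` to `v` that avoids the vertex with number `c`. -/
def ConnAvoidNat (G : MixedGraph (Fin n)) (c : ℕ) (u v : Fin n) : Prop :=
  ∃ l, G.Steps u l v ∧ ∀ z ∈ u :: l.map Prod.snd, (z : ℕ) ≠ c

theorem connAvoidNat_iff {c u v : Fin n} : ConnAvoidNat G c u v ↔ G.ConnAvoid c u v := by
  refine exists_congr fun l => and_congr_right fun _ => ?_
  constructor
  · intro h hc; exact h c hc rfl
  · intro h z hz hzc; exact h (Fin.ext hzc ▸ hz)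

/-- The number n belongs to no vertex, so removing it removes nothing; in this way one array also
holds plain reachability. -/
theorem connAvoidNat_size {u v : Fin n} : ConnAvoidNat G n u v ↔ G.Conn u v :=
  exists_congr fun _ => ⟨fun h => h.1, fun h => ⟨h, fun z _ => z.2.ne⟩⟩

/-- The position of the entry for the removed vertex `x` and the end vertices `y` and `z`. -/
def ix3 (x y z : NatExpr) : NatExpr :=
  .add (.mul (.add (.mul x (.var 0)) y) (.var 0)) z

theorem index3_inj {i j k i' j' k' : ℕ} (hj : j < n) (hj' : j' < n) (hk : k < n) (hk' : k' < n)
    (h : (i * n + j) * n + k = (i' * n + j') * n + k') : i = i' ∧ j = j' ∧ k = k' := by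
  obtain ⟨h1, h2⟩ := index_inj hk hk' h
  obtain ⟨h3, h4⟩ := index_inj hj hj' h1
  exact ⟨h3, h4, h2⟩

namespace ForProg

/-- Two nested loops that fill in entries of a table. -/
theorem run_for2_fill {α : Type} {p : ForProg} {x y : ℕ} (f : State → ℕ → α)
    (Gd : ℕ → α → Prop) (pos : ℕ → ℕ → ℕ) (hx : x ∈ X) (hy : y ∈ X) (h0 : 0 ∉ X)
    (hf : ∀ (σ : State) x v, f (σ.setVar x v) = f σ) (hxy : x ≠ y) (hxp : x ∉ p.vars)
    (hn : s.natVar 0 = n)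
    (hs : ∀ i j σ, i < n → j < n → σ.natVar x = i → σ.natVar y = j → Agree X A s σ →
      Agree X A σ (p.run σ) ∧ (∀ k, Gd k (f σ k) → Gd k (f (p.run σ) k)) ∧
      Gd (pos i j) (f (p.run σ) (pos i j))) :
    Agree X A s ((for_ x 0 (for_ y 0 p)).run s) ∧
      (∀ k, Gd k (f s k) → Gd k (f ((for_ x 0 (for_ y 0 p)).run s) k)) ∧
      ∀ i < n, ∀ j < n, Gd (pos i j) (f ((for_ x 0 (for_ y 0 p)).run s) (pos i j)) := by
  have := run_for2_rel (p := p) (x := x) (y := y) (s := s) (n := n)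
    (fun σ τ => Agree X A σ τ ∧ ∀ k, Gd k (f σ k) → Gd k (f τ k))
    (fun i j σ => Gd (pos i j) (f σ (pos i j)))
    (fun σ τ υ h h' => ⟨h.1.trans h'.1, fun k hk => h'.2 k (h.2 k hk)⟩)
    (fun σ v => ⟨agree_setVar σ v hx, fun k => by rw [hf]; exact id⟩)
    (fun σ v => ⟨agree_setVar σ v hy, fun k => by rw [hf]; exact id⟩)
    (fun σ τ h => h.1.1 0 h0) (fun i j σ τ h => h.2 _) hxy hxp hn
    (fun i j σ hi hj h1 h2 h3 => by
      obtain ⟨h4, h5, h6⟩ := hs i j σ hi hj h1 h2 h3.1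
      exact ⟨⟨h4, h5⟩, h6⟩)
  exact ⟨this.1.1, this.1.2, this.2⟩

/-- The test that the link of `x` and `y` can be used when the vertex `c` is removed. -/
def linkTest : Test :=
  .and (.not (.natEq (.var 14) (.var 13))) (.and (.not (.natEq (.var 15) (.var 13)))
    (.not (.and (.not (.natEq (.var 14) (.var 15)))
      (.not (.not (.and (.not (finite 0 (ix 14 15))) (.not (finite 1 (ix 14 15)))))))))

/-- Compute the pairs of vertices that are connected when vertex `c` (variable `13`) is removed. -/
def reachRound : ForProg :=
  .seq (.for_ 14 0 (.for_ 15 0 (.seq (.setA 3 (ix 14 15) (.lit 0))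
      (relax 3 (ix 14 15) linkTest .zero))))
    (.seq (floydWarshall 3 (.natEq (.lit 0) (.lit 0)))
      (.for_ 14 0 (.for_ 15 0
        (.setA 4 (ix3 (.var 13) (.var 14) (.var 15)) (.get 3 (ix 14 15))))))

/-- Compute for all `c` the pairs of vertices that are connected when vertex `c` is removed. -/
def reachProg : ForProg :=
  .seq (.setN 2 (.add (.var 0) (.lit 1))) (.for_ 13 2 reachRound)

theorem reachRound_init (hG : HoldsGraph G s) :
    let s' := (ForProg.for_ 14 0 (.for_ 15 0 (.seq (.setA 3 (ix 14 15) (.lit 0))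
      (relax 3 (ix 14 15) linkTest .zero)))).run s
    Agree [14, 15] [3] s s' ∧ ∀ u v : Fin n,
      (s'.tab n 3 u v = 0 ∧ (u : ℕ) ≠ s.natVar 13 ∧ (v : ℕ) ≠ s.natVar 13 ∧
        (u = v ∨ G.edges.Adj u v ∨ G.arcs.Adj u v)) ∨
      (s'.tab n 3 u v = ⊤ ∧ ¬ ((u : ℕ) ≠ s.natVar 13 ∧ (v : ℕ) ≠ s.natVar 13 ∧
        (u = v ∨ G.edges.Adj u v ∨ G.arcs.Adj u v))) := by
  classical
  intro s'
  have := run_for2_fill (X := [14, 15]) (A := [3]) (s := s) (n := n) (x := 14) (y := 15)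
    (p := .seq (.setA 3 (ix 14 15) (.lit 0)) (relax 3 (ix 14 15) linkTest .zero))
    (fun σ => σ.val 3) (fun k x => ∀ u v : Fin n, k = u * n + v →
      (x = 0 ∧ (u : ℕ) ≠ s.natVar 13 ∧ (v : ℕ) ≠ s.natVar 13 ∧
        (u = v ∨ G.edges.Adj u v ∨ G.arcs.Adj u v)) ∨
      (x = ⊤ ∧ ¬ ((u : ℕ) ≠ s.natVar 13 ∧ (v : ℕ) ≠ s.natVar 13 ∧
        (u = v ∨ G.edges.Adj u v ∨ G.arcs.Adj u v)))) (fun i j => i * n + j)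
    (by simp) (by simp) (by simp) (fun _ _ _ => rfl) (by simp) (by simp [relax, vars]) hG.size ?_
  · exact ⟨this.1, fun u v => this.2.2 u u.2 v v.2 u v rfl⟩
  · intro i j σ hi hj h14 h15 hσ
    have hGσ := hG.of_agree hσ (by simp) (by simp) (by simp)
    set τ := (ForProg.setA 3 (ix 14 15) (.lit 0)).run σ with hτ
    have hστ : Agree [14, 15] [3] σ τ :=
      ((ForProg.setA 3 (ix 14 15) (.lit 0)).agree_run σ).mono (by simp [vars]) (by simp [arrs])
    have hGτ := hGσ.of_agree hστ (by simp) (by simp) (by simp)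
    have e0 : (ix 14 15).eval σ = i * n + j := by rw [eval_ix hGσ.size, h14, h15]
    have t14 : τ.natVar 14 = i := h14
    have t15 : τ.natVar 15 = j := h15
    have t13 : τ.natVar 13 = s.natVar 13 := hσ.1 13 (by simp)
    have e1 : (ix 14 15).eval τ = i * n + j := by rw [eval_ix hGτ.size, t14, t15]
    have hval : ∀ k, ((relax 3 (ix 14 15) linkTest .zero).run τ).val 3 k =
        if k = i * n + j then (if linkTest.Holds τ then 0 else ⊤) else σ.val 3 k := by
      intro k
      have h1 : τ.val 3 k = if k = i * n + j then ⊤ else σ.val 3 k := by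
        simp only [hτ, run, State.val, updateArr_apply, e0, NatExpr.eval]
        by_cases hk : k = i * n + j <;> simp [hk]
      rw [val_relax, e1, h1]
      by_cases hk : k = i * n + j
      · simp only [hk, if_true, RealExpr.eval, WithTop.coe_zero]
        rw [min_eq_right le_top]
      · simp [hk]
    have hlink : linkTest.Holds τ ↔ (i ≠ s.natVar 13 ∧ j ≠ s.natVar 13 ∧
        (i = j ∨ G.edges.Adj ⟨i, hi⟩ ⟨j, hj⟩ ∨ G.arcs.Adj ⟨i, hi⟩ ⟨j, hj⟩)) := by
      have a1 := hGτ.edge ⟨i, hi⟩ ⟨j, hj⟩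
      have a2 := hGτ.arc ⟨i, hi⟩ ⟨j, hj⟩
      dsimp only at a1 a2
      simp only [linkTest, finite, Test.Holds, NatExpr.eval, t14, t15, t13, e1]
      rw [← a1, ← a2]
      tauto
    refine ⟨hστ.trans (((relax 3 (ix 14 15) linkTest .zero).agree_run τ).mono
      (by simp [relax, vars]) (by simp [relax, arrs])), ?_, ?_⟩
    · intro k hk u v hkuv
      rw [run, hval]
      split_ifs with h1 h2
      · rw [hlink] at h2
        rw [h1] at hkuv
        obtain ⟨rfl, rfl⟩ := index_inj hj v.2 hkuv
        exact .inl ⟨rfl, h2.1, h2.2.1, by simpa [Fin.ext_iff] using h2.2.2⟩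
      · rw [hlink] at h2
        rw [h1] at hkuv
        obtain ⟨rfl, rfl⟩ := index_inj hj v.2 hkuv
        exact .inr ⟨rfl, by simpa [Fin.ext_iff] using h2⟩
      · exact hk u v hkuv
    · intro u v hkuv
      obtain ⟨rfl, rfl⟩ := index_inj hj v.2 hkuv
      rw [run, hval, if_pos rfl]
      split_ifs with h2
      · rw [hlink] at h2
        exact .inl ⟨rfl, h2.1, h2.2.1, by simpa [Fin.ext_iff] using h2.2.2⟩
      · rw [hlink] at h2
        exact .inr ⟨rfl, by simpa [Fin.ext_iff] using h2⟩

/-- Closures of the table of links describe connectedness. -/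
theorem closure_ne_top_iff {c : ℕ} {w v : Fin n → Fin n → WithTop ℝ}
    (hw : ∀ u v : Fin n,
      (w u v = 0 ∧ (u : ℕ) ≠ c ∧ (v : ℕ) ≠ c ∧ (u = v ∨ G.edges.Adj u v ∨ G.arcs.Adj u v)) ∨
      (w u v = ⊤ ∧ ¬ ((u : ℕ) ≠ c ∧ (v : ℕ) ≠ c ∧ (u = v ∨ G.edges.Adj u v ∨ G.arcs.Adj u v))))
    (h : IsClosure (fun _ _ _ => True) w v) (x y : Fin n) :
    v x y ≠ ⊤ ↔ ConnAvoidNat G c x y := by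
  constructor
  · intro hne
    obtain ⟨r, hr⟩ := WithTop.ne_top_iff_exists.1 hne
    refine h.sound (fun i j _ => ConnAvoidNat G c i j) ?_ ?_ x y r hr.symm
    · rintro i k j - - - ⟨l, hl, hc⟩ ⟨m, hm, hc'⟩
      refine ⟨l ++ m, hl.append hm, fun z hz => ?_⟩
      rw [List.map_append, ← List.cons_append, List.mem_append] at hz
      rcases hz with hz | hz
      · exact hc z hz
      · exact hc' z (List.mem_cons_of_mem _ hz)
    · intro i j r hr
      rcases hw i j with ⟨-, h1, h2, h3⟩ | ⟨h1, -⟩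
      · rcases h3 with rfl | h3 | h3
        · exact ⟨[], rfl, by simpa using h1⟩
        · exact ⟨[(.inl s(i, j), j)], ⟨⟨h3, rfl⟩, rfl⟩, by simpa using ⟨h1, h2⟩⟩
        · exact ⟨[(.inr (i, j), j)], ⟨⟨h3, rfl⟩, rfl⟩, by simpa using ⟨h1, h2⟩⟩
      · rw [h1] at hr; exact absurd hr WithTop.top_ne_coe
  · rintro ⟨l, hl, hc⟩
    obtain ⟨m, hm, hnd, hsub⟩ := hl.exists_path
    have hc' : ∀ z ∈ x :: m.map Prod.snd, (z : ℕ) ≠ c := by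
      intro z hz
      rcases List.mem_cons.1 hz with rfl | hz
      · exact hc z (by simp)
      · obtain ⟨p, hp, rfl⟩ := List.mem_map.1 hz
        exact hc p.2 (List.mem_cons_of_mem _ (List.mem_map.2 ⟨p, hsub hp, rfl⟩))
    have key := h.le_sum hm hnd (fun _ => 0) ?_ ?_
    · exact ne_top_of_le_ne_top WithTop.coe_ne_top key
    · rcases hw x x with ⟨h1, -⟩ | ⟨-, h1⟩
      · exact h1.le
      · exact absurd ⟨hc' x (by simp), hc' x (by simp), .inl rfl⟩ h1
    · intro y hy p hp hj
      rcases hw y p.2 with ⟨h1, -⟩ | ⟨-, h1⟩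
      · rw [h1]; rfl
      · refine absurd ⟨hc' y hy, hc' p.2 (List.mem_cons_of_mem _ (List.mem_map.2 ⟨p, hp, rfl⟩)),
          .inr ?_⟩ h1
        obtain ⟨a, z⟩ := p
        cases a with
        | inl e => exact .inl hj.1
        | inr e => exact .inr hj.1

/-- Array `4` describes connectedness after removal of a vertex. -/
def HoldsReach (G : MixedGraph (Fin n)) (s : State) : Prop :=
  ∀ c ≤ n, ∀ u v : Fin n, s.natArr 4 ((c * n + u) * n + v) ≠ 0 ↔ ConnAvoidNat G c u v

/-- Correctness is a property `Gd` of single positions, so that a round is seen to preserve what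
earlier rounds have written for other removed vertices. -/
theorem run_reachRound (hG : HoldsGraph G s) (Gd : ℕ → ℕ → Prop)
    (hGd : Gd = fun k x => ∀ c ≤ n, ∀ u v : Fin n, k = (c * n + u) * n + v →
      (x ≠ 0 ↔ ConnAvoidNat G c u v)) :
    let s' := reachRound.run s
    Agree [10, 11, 12, 14, 15] [3, 4] s s' ∧
      (∀ k, Gd k (s.natArr 4 k) → Gd k (s'.natArr 4 k)) ∧
      ∀ u v : Fin n, Gd ((s.natVar 13 * n + u) * n + v)
        (s'.natArr 4 ((s.natVar 13 * n + u) * n + v)) := by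
  intro s'
  obtain ⟨h1, h2⟩ := reachRound_init hG
  set s1 := (ForProg.for_ 14 0 (.for_ 15 0 (.seq (.setA 3 (ix 14 15) (.lit 0))
      (relax 3 (ix 14 15) linkTest .zero)))).run s with hs1
  have hG1 := hG.of_agree h1 (by simp) (by simp) (by simp)
  obtain ⟨h3, h4⟩ := run_floydWarshall (a := 3) (b := .natEq (.lit 0) (.lit 0))
    (Z := fun _ _ _ => True) hG1.size (fun σ _ _ _ _ _ _ _ => by simp [Test.Holds, NatExpr.eval])
  set s2 := (floydWarshall 3 (.natEq (.lit 0) (.lit 0))).run s1 with hs2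
  have hG2 := hG1.of_agree h3 (by simp) (by simp) (by simp)
  have h12 : Agree [10, 11, 12, 14, 15] [3, 4] s s2 :=
    (h1.mono (by simp) (by simp)).trans (h3.mono (by simp) (by simp))
  have h13 : s2.natVar 13 = s.natVar 13 := h12.1 13 (by simp)
  have hreach := closure_ne_top_iff h2 h4
  have := run_for2_fill (X := [14, 15]) (A := [4]) (s := s2) (n := n) (x := 14) (y := 15)
    (p := .setA 4 (ix3 (.var 13) (.var 14) (.var 15)) (.get 3 (ix 14 15)))
    (fun σ => σ.natArr 4) Gd (fun i j => (s.natVar 13 * n + i) * n + j)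
    (by simp) (by simp) (by simp) (fun _ _ _ => rfl) (by simp) (by simp [vars]) hG2.size ?_
  · refine ⟨h12.trans (this.1.mono (by simp) (by simp)), ?_, fun u v => this.2.2 u u.2 v v.2⟩
    intro k hk
    refine this.2.1 k ?_
    rwa [h3.2.1 4 (by simp), h1.2.1 4 (by simp)]
  · intro i j σ hi hj h14 h15 hσ
    have hGσ := hG2.of_agree hσ (by simp) (by simp) (by simp)
    have e0 : (ix 14 15).eval σ = i * n + j := by rw [eval_ix hGσ.size, h14, h15]
    have e1 : (ix3 (.var 13) (.var 14) (.var 15)).eval σ = (s.natVar 13 * n + i) * n + j := by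
      simp only [ix3, NatExpr.eval, hGσ.size, h14, h15, (hσ.1 13 (by simp)).trans h13]
    have hgood : Gd ((s.natVar 13 * n + i) * n + j) (σ.natArr 3 (i * n + j)) := by
      subst hGd
      intro c hc u v huv
      obtain ⟨rfl, rfl, rfl⟩ := index3_inj hi u.2 hj v.2 huv
      rw [← hreach u v, hσ.2.1 3 (by simp)]
      exact val_ne_top_iff.symm
    have hset : ∀ k, ((ForProg.setA 4 (ix3 (.var 13) (.var 14) (.var 15))
        (.get 3 (ix 14 15))).run σ).natArr 4 k = if k = (s.natVar 13 * n + i) * n + j then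
        σ.natArr 3 (i * n + j) else σ.natArr 4 k := by
      intro k
      simp only [run, updateArr_apply, e1, NatExpr.eval, e0]
    refine ⟨((ForProg.setA 4 (ix3 (.var 13) (.var 14) (.var 15))
        (.get 3 (ix 14 15))).agree_run σ).mono (by simp [vars]) (by simp [arrs]), ?_, ?_⟩
    · intro k hk
      rw [hset]
      split_ifs with h
      · rw [h]; exact hgood
      · exact hk
    · rw [hset, if_pos rfl]; exact hgood

theorem run_reachProg (hG : HoldsGraph G s) :
    let s' := reachProg.run s
    Agree [2, 10, 11, 12, 13, 14, 15] [3, 4] s s' ∧ HoldsReach G s' := by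
  intro s'
  set s1 := (ForProg.setN 2 (.add (.var 0) (.lit 1))).run s with hs1
  have h1 : Agree [2, 10, 11, 12, 13, 14, 15] [3, 4] s s1 := agree_setVar s _ (by simp)
  have hG1 := hG.of_agree h1 (by simp) (by simp) (by simp)
  have hN : s1.natVar 2 = n + 1 := by
    simp [hs1, run, NatExpr.eval, hG.size]
  let Gd : ℕ → ℕ → Prop := fun k x => ∀ c ≤ n, ∀ u v : Fin n, k = (c * n + u) * n + v →
      (x ≠ 0 ↔ ConnAvoidNat G c u v)
  have := run_for_rel (p := reachRound) (x := 13) (y := 2) (s := s1)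
    (fun σ τ => Agree [2, 10, 11, 12, 13, 14, 15] [3, 4] σ τ ∧
      ∀ k, Gd k (σ.natArr 4 k) → Gd k (τ.natArr 4 k))
    (fun c σ => ∀ u v : Fin n, Gd ((c * n + u) * n + v) (σ.natArr 4 ((c * n + u) * n + v)))
    (fun σ τ υ h h' => ⟨h.1.trans h'.1, fun k hk => h'.2 k (h.2 k hk)⟩)
    (fun σ v => ⟨agree_setVar σ v (by simp), fun k => id⟩)
    (fun i σ τ h hσ u v => h.2 _ (hσ u v)) ?_
  · refine ⟨h1.trans this.1.1, fun c hc u v => ?_⟩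
    exact this.2 c (by omega) u v c hc u v rfl
  · intro c σ hc h13 hσ
    obtain ⟨h3, h4, h5⟩ := run_reachRound (s := σ)
      (hG1.of_agree hσ.1 (by simp) (by simp) (by simp)) Gd rfl
    rw [h13] at h5
    exact ⟨⟨h3.mono (by simp) (by simp), h4⟩, h5⟩

end ForProg

end RAM

/-! ## Tables of links and of trees, and tests -/

namespace RAM

open MixedGraph

variable {n : ℕ} {G : MixedGraph (Fin n)} {s σ : State} {X A : List ℕ}

namespace ForProg

section RelaxAll

variable {a : ℕ} {P : ℕ → ℝ → Prop}

/-- Relax an entry of a table by several values, each of them guarded by a test. -/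
def relaxAll (a : ℕ) (i : NatExpr) : List (Test × RealExpr) → ForProg
  | [] => .skip
  | q :: qs => .seq (relax a i q.1 q.2) (relaxAll a i qs)

theorem vars_relaxAll (i : NatExpr) (qs : List (Test × RealExpr)) :
    (relaxAll a i qs).vars = [] := by
  induction qs with
  | nil => rfl
  | cons q qs ih => simp [relaxAll, vars, relax, ih]

/-- The conditions are imposed in every memory that arises by lowering the table, because earlier
relaxations of the list may have changed it before a later one is executed. -/
theorem lowers_relaxAll {i : NatExpr} {k : ℕ} {qs : List (Test × RealExpr)}
    (hi : ∀ τ, Lowers X a P s τ → i.eval τ = k)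
    (h : ∀ τ, Lowers X a P s τ → ∀ q ∈ qs, q.1.Holds τ → P k (q.2.eval τ)) :
    Lowers X a P s ((relaxAll a i qs).run s) ∧
      ∀ c : ℝ, (∃ q ∈ qs, ∀ τ, Lowers X a P s τ → q.1.Holds τ ∧ q.2.eval τ ≤ c) →
        ((relaxAll a i qs).run s).val a k ≤ c := by
  induction qs generalizing s with
  | nil => exact ⟨Lowers.refl s, by simp⟩
  | cons q qs ih =>
    have e0 := hi s (Lowers.refl s)
    have h1 := lowers_relax (X := X) (a := a) (P := P) (s := s) (i := i) (b := q.1) (e := q.2)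
      (fun _ hb => e0 ▸ h s (Lowers.refl s) q (by simp) hb)
    obtain ⟨h2, h3⟩ := ih (s := (relax a i q.1 q.2).run s) (fun τ hτ => hi τ (h1.1.trans hτ))
      (fun τ hτ r hr => h τ (h1.1.trans hτ) r (List.mem_cons_of_mem _ hr))
    refine ⟨h1.1.trans h2, fun c hc => ?_⟩
    obtain ⟨r, hr, hrc⟩ := hc
    rcases List.mem_cons.1 hr with rfl | hr
    · obtain ⟨h4, h5⟩ := hrc s (Lowers.refl s)
      refine (h2.2.1 k).trans ?_
      rw [← e0]
      exact (h1.2 h4).trans (WithTop.coe_le_coe.2 h5)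
    · exact h3 c ⟨r, hr, fun τ hτ => hrc τ (h1.1.trans hτ)⟩

/-- Two nested loops that relax entries of a table. -/
theorem run_for2_relaxAll {x y : ℕ} {i : NatExpr} {qs : List (Test × RealExpr)}
    (pos : ℕ → ℕ → ℕ) (C : ℕ → ℕ → ℝ → Prop) (hx : x ∈ X) (hy : y ∈ X) (h0 : 0 ∉ X)
    (hxy : x ≠ y) (hn : s.natVar 0 = n)
    (hpos : ∀ τ, Lowers X a P s τ → i.eval τ = pos (τ.natVar x) (τ.natVar y))
    (hP : ∀ u v τ, u < n → v < n → τ.natVar x = u → τ.natVar y = v → Lowers X a P s τ →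
      ∀ q ∈ qs, q.1.Holds τ → P (pos u v) (q.2.eval τ))
    (hC : ∀ u v c, u < n → v < n → C u v c → ∃ q ∈ qs, ∀ τ, τ.natVar x = u → τ.natVar y = v →
      Lowers X a P s τ → q.1.Holds τ ∧ q.2.eval τ ≤ c) :
    Lowers X a P s ((for_ x 0 (for_ y 0 (relaxAll a i qs))).run s) ∧
      ∀ u < n, ∀ v < n, ∀ c, C u v c →
        ((for_ x 0 (for_ y 0 (relaxAll a i qs))).run s).val a (pos u v) ≤ c := by
  refine run_for2_lowers (fun u v σ => ∀ c, C u v c → σ.val a (pos u v) ≤ c) hx hy h0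
    (fun u v σ τ h hσ c hc => (h.2.1 _).trans (hσ c hc)) hxy (by simp [vars_relaxAll]) hn ?_
  intro u v σ hu hv hxu hyv hσ
  have e : ∀ τ, Lowers [] a P σ τ → τ.natVar x = u ∧ τ.natVar y = v ∧ Lowers X a P s τ :=
    fun τ hτ => ⟨(hτ.1.1 x (by simp)).trans hxu, (hτ.1.1 y (by simp)).trans hyv,
      hσ.trans (hτ.mono (by simp))⟩
  obtain ⟨h1, h2⟩ := lowers_relaxAll (X := []) (a := a) (P := P) (s := σ) (i := i)
    (k := pos u v) (qs := qs)
    (fun τ hτ => by obtain ⟨h1, h2, h3⟩ := e τ hτ; rw [hpos τ h3, h1, h2])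
    (fun τ hτ => by obtain ⟨h1, h2, h3⟩ := e τ hτ; exact hP u v τ hu hv h1 h2 h3)
  refine ⟨h1.mono (by simp), fun c hc => h2 c ?_⟩
  obtain ⟨q, hq, hqc⟩ := hC u v c hu hv hc
  exact ⟨q, hq, fun τ hτ => by obtain ⟨h1, h2, h3⟩ := e τ hτ; exact hqc τ h1 h2 h3⟩

end RelaxAll

theorem tab_eq_top {a : ℕ} (h : ∀ k, s.natArr a k = 0) (k : ℕ) : s.val a k = ⊤ := by
  simp [State.val, h]

/-- Compute the weights of walks that use no negative edge. -/
def linkProg : ForProg :=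
  .seq (.for_ 14 0 (.for_ 15 0 (relaxAll 5 (ix 14 15)
    [(.natEq (.var 14) (.var 15), .zero),
     (.and (finite 0 (ix 14 15)) (.not (.realLt (.get 0 (ix 14 15)) .zero)), .get 0 (ix 14 15)),
     (finite 1 (ix 14 15), .get 1 (ix 14 15))])))
    (floydWarshall 5 (.natEq (.lit 0) (.lit 0)))

/-- Compute the lengths of walks along negative edges. -/
def treeProg : ForProg :=
  .seq (.for_ 14 0 (.for_ 15 0 (relaxAll 6 (ix 14 15)
    [(.natEq (.var 14) (.var 15), .zero),
     (.and (finite 0 (ix 14 15)) (.realLt (.get 0 (ix 14 15)) .zero),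
      .sub .zero (.get 0 (ix 14 15)))])))
    (floydWarshall 6 (.natEq (.lit 0) (.lit 0)))

/-- Single links satisfy the claims, which pass to walks by the closure: `R` is preserved by
concatenation, and `IsClosure.le_sum` bounds the entry by the weight of any path without negative
edges. -/
theorem run_linkProg (hG : HoldsGraph G s) (h5 : ∀ k, s.natArr 5 k = 0) :
    Agree [10, 11, 12, 14, 15] [5] s (linkProg.run s) ∧
      G.IsNonnegTable ((linkProg.run s).tab n 5) := by
  let R : Fin n → Fin n → ℝ → Prop := fun u v c =>
    ∃ l, G.Steps u l v ∧ (∀ p ∈ l, ¬ G.IsNeg p.1) ∧ G.wt l = c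
  have h1 := run_for2_relaxAll (X := [14, 15]) (a := 5) (s := s) (n := n) (x := 14) (y := 15)
    (P := fun k c => ∀ u v : Fin n, k = u * n + v → R u v c) (i := ix 14 15)
    (qs := [(.natEq (.var 14) (.var 15), .zero),
     (.and (finite 0 (ix 14 15)) (.not (.realLt (.get 0 (ix 14 15)) .zero)), .get 0 (ix 14 15)),
     (finite 1 (ix 14 15), .get 1 (ix 14 15))])
    (fun u v => u * n + v)
    (fun u v c => ∀ u' v' : Fin n, u = u' → v = v' → (u' = v' ∧ c = 0) ∨
      ∃ l, G.Joins l u' v' ∧ ¬ G.IsNeg l ∧ c = G.weight l) (by simp) (by simp) (by simp) (by simp)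
    hG.size ?_ ?_ ?_
  · obtain ⟨h1, h2⟩ := h1
    have hG1 := hG.of_agree h1.1 (by simp) (by simp) (by simp)
    obtain ⟨h3, h4⟩ := run_floydWarshall (a := 5) (b := .natEq (.lit 0) (.lit 0))
      (Z := fun _ _ _ => True) hG1.size (fun σ _ _ _ _ _ _ _ => by simp [Test.Holds, NatExpr.eval])
    refine ⟨(h1.1.mono (by simp) (by simp)).trans (h3.mono (by simp) (by simp)), ?_, ?_⟩
    · refine h4.sound R ?_ ?_
      · rintro i k j x y - ⟨l, h1, h2, rfl⟩ ⟨m, h3, h4, rfl⟩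
        refine ⟨l ++ m, h1.append h3, fun p hp => ?_, wt_append _ _⟩
        rcases List.mem_append.1 hp with hp | hp
        · exact h2 p hp
        · exact h4 p hp
      · intro i j x hx
        refine h1.2.2 ?_ _ x hx i j rfl
        intro k x hx
        rw [tab_eq_top h5] at hx
        exact absurd hx WithTop.top_ne_coe
    · intro u v l hl hneg hnd
      refine (h4.le_sum hl hnd G.weight ?_ ?_)
      · refine h2 u u.2 u u.2 0 fun u' v' hu hv => .inl ⟨?_, rfl⟩
        exact Fin.ext (hu.symm.trans hv)
      · intro y hy p hp hj
        refine h2 y y.2 p.2 p.2.2 _ fun u' v' hu hv => .inr ⟨p.1, ?_, hneg p hp, rfl⟩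
        rwa [← Fin.ext hu, ← Fin.ext hv]
  · intro τ hτ
    exact eval_ix ((hτ.1.1 0 (by simp)).trans hG.size)
  · intro u v τ hu hv h14 h15 hτ q hq hh u' v' huv
    obtain ⟨rfl, rfl⟩ := index_inj hv v'.2 huv
    have hGτ := hG.of_agree hτ.1 (by simp) (by simp) (by simp)
    have e1 := eval_ix (x := 14) (y := 15) hGτ.size
    rw [h14, h15] at e1
    simp only [List.mem_cons, List.not_mem_nil, or_false] at hq
    rcases hq with rfl | rfl | rfl
    · simp only [Test.Holds, NatExpr.eval, h14, h15] at hh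
      exact ⟨[], Fin.ext hh, by simp, rfl⟩
    · simp only [Test.Holds, NatExpr.eval, RealExpr.eval, finite, e1] at hh ⊢
      have ha := (hGτ.edge u' v').1 hh.1
      have hw := hGτ.edgeWeight u' v' ha
      refine ⟨[(.inl s(u', v'), v')], ⟨⟨ha, rfl⟩, rfl⟩, ?_, ?_⟩
      · simp only [List.mem_singleton, forall_eq, IsNeg]
        rw [← hw]; exact hh.2
      · simp [weight, hw]
    · simp only [Test.Holds, NatExpr.eval, RealExpr.eval, finite, e1] at hh ⊢
      have ha := (hGτ.arc u' v').1 hh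
      have hw := hGτ.arcWeight u' v' ha
      refine ⟨[(.inr (u', v'), v')], ⟨⟨ha, rfl⟩, rfl⟩, ?_, ?_⟩
      · simp [IsNeg]
      · simp [weight, hw]
  · intro u v c hu hv hc
    rcases hc ⟨u, hu⟩ ⟨v, hv⟩ rfl rfl with ⟨huv, rfl⟩ | ⟨l, hl, hneg, rfl⟩
    · refine ⟨_, List.mem_cons_self .., fun τ h14 h15 hτ => ⟨?_, le_rfl⟩⟩
      simpa [Test.Holds, NatExpr.eval, h14, h15] using huv
    · have key : ∀ τ, τ.natVar 14 = u → τ.natVar 15 = v → Agree [14, 15] [5] s τ →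
          HoldsGraph G τ ∧ (ix 14 15).eval τ = u * n + v := by
        intro τ h14 h15 hτ
        have hGτ := hG.of_agree hτ (by simp) (by simp) (by simp)
        refine ⟨hGτ, ?_⟩
        rw [eval_ix hGτ.size, h14, h15]
      cases l with
      | inl e =>
        obtain ⟨ha, rfl⟩ := hl
        refine ⟨_, List.mem_cons_of_mem _ (List.mem_cons_self ..), fun τ h14 h15 hτ => ?_⟩
        obtain ⟨hGτ, e1⟩ := key τ h14 h15 hτ.1
        have h1 := (hGτ.edge ⟨u, hu⟩ ⟨v, hv⟩).2 ha
        have h2 := hGτ.edgeWeight ⟨u, hu⟩ ⟨v, hv⟩ ha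
        dsimp only at h1 h2
        simp only [Test.Holds, NatExpr.eval, RealExpr.eval, finite, e1, h2]
        exact ⟨⟨h1, hneg⟩, le_rfl⟩
      | inr e =>
        obtain ⟨ha, rfl⟩ := hl
        refine ⟨_, List.mem_cons_of_mem _ (List.mem_cons_of_mem _ (List.mem_cons_self ..)),
          fun τ h14 h15 hτ => ?_⟩
        obtain ⟨hGτ, e1⟩ := key τ h14 h15 hτ.1
        have h1 := (hGτ.arc ⟨u, hu⟩ ⟨v, hv⟩).2 ha
        have h2 := hGτ.arcWeight ⟨u, hu⟩ ⟨v, hv⟩ ha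
        dsimp only at h1 h2
        simp only [Test.Holds, NatExpr.eval, RealExpr.eval, finite, e1, h2]
        exact ⟨h1, le_rfl⟩

theorem run_treeProg (hG : HoldsGraph G s) (h6 : ∀ k, s.natArr 6 k = 0) :
    Agree [10, 11, 12, 14, 15] [6] s (treeProg.run s) ∧
      G.IsTreeTable ((treeProg.run s).tab n 6) := by
  let R : Fin n → Fin n → ℝ → Prop := fun u v c => ∃ p : G.negEdges.Walk u v, -G.wt (negSteps p) = c
  have h1 := run_for2_relaxAll (X := [14, 15]) (a := 6) (s := s) (n := n) (x := 14) (y := 15)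
    (P := fun k c => ∀ u v : Fin n, k = u * n + v → R u v c) (i := ix 14 15)
    (qs := [(.natEq (.var 14) (.var 15), .zero),
     (.and (finite 0 (ix 14 15)) (.realLt (.get 0 (ix 14 15)) .zero),
      .sub .zero (.get 0 (ix 14 15)))])
    (fun u v => u * n + v)
    (fun u v c => ∀ u' v' : Fin n, u = u' → v = v' → (u' = v' ∧ c = 0) ∨
      (G.negEdges.Adj u' v' ∧ c = -G.edgeWeight s(u', v'))) (by simp) (by simp) (by simp) (by simp)
    hG.size ?_ ?_ ?_
  · obtain ⟨h1, h2⟩ := h1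
    have hG1 := hG.of_agree h1.1 (by simp) (by simp) (by simp)
    obtain ⟨h3, h4⟩ := run_floydWarshall (a := 6) (b := .natEq (.lit 0) (.lit 0))
      (Z := fun _ _ _ => True) hG1.size (fun σ _ _ _ _ _ _ _ => by simp [Test.Holds, NatExpr.eval])
    refine ⟨(h1.1.mono (by simp) (by simp)).trans (h3.mono (by simp) (by simp)), ?_, ?_⟩
    · refine h4.sound R ?_ ?_
      · rintro i k j x y - ⟨p, rfl⟩ ⟨q, rfl⟩
        obtain ⟨r, hr⟩ := ((steps_negSteps p).append (steps_negSteps q)).exists_negWalk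
          fun z hz => (List.mem_append.1 hz).elim (isNeg_of_mem_negSteps p)
            (isNeg_of_mem_negSteps q)
        exact ⟨r, by rw [hr, wt_append]; ring⟩
      · intro i j x hx
        refine h1.2.2 ?_ _ x hx i j rfl
        intro k x hx
        rw [tab_eq_top h6] at hx
        exact absurd hx WithTop.top_ne_coe
    · intro u v p hp
      have hle := h4.le_sum (steps_negSteps p) (by rw [cons_map_negSteps]; exact hp.support_nodup)
        (fun l => -G.weight l) ?_ ?_
      · refine hle.trans (le_of_eq ?_)
        rw [wt, WithTop.coe_eq_coe]
        induction negSteps p with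
        | nil => simp
        | cons q l ih => rw [List.map_cons, List.map_cons, List.sum_cons, List.sum_cons, ih]; ring
      · refine h2 u u.2 u u.2 0 fun u' v' hu hv => .inl ⟨?_, rfl⟩
        exact Fin.ext (hu.symm.trans hv)
      · intro y hy q hq hj
        refine h2 y y.2 q.2 q.2.2 _ fun u' v' hu hv => .inr ?_
        obtain ⟨h1, h2⟩ := hj.isNeg_adj (isNeg_of_mem_negSteps p hq)
        rw [h2, ← Fin.ext hu, ← Fin.ext hv]
        exact ⟨h1, rfl⟩
  · intro τ hτ
    exact eval_ix ((hτ.1.1 0 (by simp)).trans hG.size)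
  · intro u v τ hu hv h14 h15 hτ q hq hh u' v' huv
    obtain ⟨rfl, rfl⟩ := index_inj hv v'.2 huv
    have hGτ := hG.of_agree hτ.1 (by simp) (by simp) (by simp)
    have e1 := eval_ix (x := 14) (y := 15) hGτ.size
    rw [h14, h15] at e1
    simp only [List.mem_cons, List.not_mem_nil, or_false] at hq
    rcases hq with rfl | rfl
    · simp only [Test.Holds, NatExpr.eval, h14, h15] at hh
      obtain rfl := Fin.ext hh
      exact ⟨.nil, by simp [negSteps, RealExpr.eval]⟩
    · simp only [Test.Holds, NatExpr.eval, RealExpr.eval, finite, e1] at hh ⊢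
      have ha := (hGτ.neg_iff u' v').1 hh
      refine ⟨.cons ha .nil, ?_⟩
      simp [negSteps, weight, hGτ.edgeWeight u' v' ha.1]
  · intro u v c hu hv hc
    rcases hc ⟨u, hu⟩ ⟨v, hv⟩ rfl rfl with ⟨huv, rfl⟩ | ⟨ha, rfl⟩
    · refine ⟨_, List.mem_cons_self .., fun τ h14 h15 hτ => ⟨?_, le_rfl⟩⟩
      simpa [Test.Holds, NatExpr.eval, h14, h15] using huv
    · refine ⟨_, List.mem_cons_of_mem _ (List.mem_cons_self ..), fun τ h14 h15 hτ => ?_⟩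
      have hGτ := hG.of_agree hτ.1 (by simp) (by simp) (by simp)
      have e1 := eval_ix (x := 14) (y := 15) hGτ.size
      rw [h14, h15] at e1
      have h1 := (hGτ.neg_iff ⟨u, hu⟩ ⟨v, hv⟩).2 ha
      have h2 := hGτ.edgeWeight ⟨u, hu⟩ ⟨v, hv⟩ ha.1
      dsimp only at h1 h2
      simp only [Test.Holds, NatExpr.eval, RealExpr.eval, finite, e1]
      exact ⟨h1, by rw [h2, zero_sub]⟩

/-! ### Tests -/

/-- Only the flag, variable `1`, and the variables in `X` may change, and the flag can only be
cleared, for a reason `C`. -/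
def FlagRel (X : List ℕ) (C : Prop) (s σ : State) : Prop :=
  Agree (1 :: X) [] s σ ∧ (σ.natVar 1 = s.natVar 1 ∨ σ.natVar 1 = 0 ∧ C)

theorem FlagRel.trans {C : Prop} {τ : State} (h : FlagRel X C s σ) (h' : FlagRel X C σ τ) :
    FlagRel X C s τ := by
  refine ⟨h.1.trans h'.1, ?_⟩
  rcases h'.2 with h2 | h2
  · rw [h2]; exact h.2
  · exact .inr h2

theorem flagRel_setVar {C : Prop} {x v : ℕ} (hx : x ∈ X) (h1 : 1 ≠ x) :
    FlagRel X C s (s.setVar x v) :=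
  ⟨agree_setVar s v (by simp [hx]), .inl (setVar_natVar_of_ne _ _ h1)⟩

theorem FlagRel.eq_zero {C : Prop} (h : FlagRel X C s σ) (hs : s.natVar 1 = 0) :
    σ.natVar 1 = 0 := by
  rcases h.2 with h | h
  · rw [h, hs]
  · exact h.1

/-- Clear the flag if a test succeeds. -/
def clearIf (b : Test) : ForProg := .ite b (.setN 1 (.lit 0)) .skip

theorem run_clearIf {C : Prop} {b : Test} (h : b.Holds s → C) :
    FlagRel X C s ((clearIf b).run s) ∧ (b.Holds s → ((clearIf b).run s).natVar 1 = 0) := by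
  by_cases hb : b.Holds s
  · simp only [clearIf, run, if_pos hb, NatExpr.eval]
    exact ⟨⟨agree_setVar s _ (by simp), .inr ⟨by simp, h hb⟩⟩, fun _ => by simp⟩
  · simp only [clearIf, run, if_neg hb]
    exact ⟨⟨Agree.refl s, .inl rfl⟩, fun h => absurd h hb⟩

theorem run_for2_flag {C : Prop} {p : ForProg} {x y : ℕ} (Q : ℕ → ℕ → Prop)
    (hx : x ∈ X) (hy : y ∈ X) (h0 : 0 ∉ X) (h1 : 1 ∉ X) (hxy : x ≠ y) (hxp : x ∉ p.vars)
    (hn : s.natVar 0 = n)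
    (hs : ∀ i j σ, i < n → j < n → σ.natVar x = i → σ.natVar y = j → FlagRel X C s σ →
      FlagRel X C σ (p.run σ) ∧ (Q i j → (p.run σ).natVar 1 = 0)) :
    FlagRel X C s ((for_ x 0 (for_ y 0 p)).run s) ∧
      ∀ i < n, ∀ j < n, Q i j → ((for_ x 0 (for_ y 0 p)).run s).natVar 1 = 0 :=
  run_for2_rel (FlagRel X C) (fun i j σ => Q i j → σ.natVar 1 = 0)
    (fun _ _ _ h h' => h.trans h') (fun _ _ => flagRel_setVar hx fun h => h1 (h ▸ hx))
    (fun _ _ => flagRel_setVar hy fun h => h1 (h ▸ hy))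
    (fun _ _ h => h.1.1 0 (by simpa using h0)) (fun _ _ _ _ h hσ hq => h.eq_zero (hσ hq))
    hxy hxp hn hs

/-- The test whether two vertices are joined by a negative edge. -/
def negTest (x y : ℕ) : Test :=
  .and (finite 0 (ix x y)) (.realLt (.get 0 (ix x y)) .zero)

theorem negTest_holds (hG : HoldsGraph G s) {x y : ℕ} {u v : Fin n} (hx : s.natVar x = u)
    (hy : s.natVar y = v) : (negTest x y).Holds s ↔ G.negEdges.Adj u v := by
  rw [← hG.neg_iff]
  simp only [negTest, finite, Test.Holds, NatExpr.eval, RealExpr.eval, eval_ix hG.size, hx, hy,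
    ne_eq]

theorem finite_ix_holds (hn : s.natVar 0 = n) {a x y : ℕ} {u v : Fin n} (hx : s.natVar x = u)
    (hy : s.natVar y = v) : (finite a (ix x y)).Holds s ↔ s.tab n a u v ≠ ⊤ := by
  rw [finite_holds, eval_ix hn, hx, hy]; rfl

theorem coe_realArr (hn : s.natVar 0 = n) {a x y : ℕ} {u v : Fin n} (hx : s.natVar x = u)
    (hy : s.natVar y = v) (h : s.tab n a u v ≠ ⊤) :
    (((RealExpr.get a (ix x y)).eval s : ℝ) : WithTop ℝ) = s.tab n a u v := by
  rw [RealExpr.eval, eval_ix hn, hx, hy]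
  exact (val_of_ne (val_ne_top_iff.1 h)).symm

/-- The test for the vertices in variables `16`, `17`, `18`, `19` that the forest of negative edges
has to fail. -/
def forkTest : Test :=
  .and (negTest 17 18) (.and (negTest 17 19) (.and (.not (.natEq (.var 18) (.var 19)))
    (.and (finite 6 (ix 16 17)) (.and (finite 6 (ix 16 18)) (.and (finite 6 (ix 16 19))
      (.and (.not (.realLt (.get 6 (ix 16 17)) (.get 6 (ix 16 18))))
        (.not (.realLt (.get 6 (ix 16 17)) (.get 6 (ix 16 19))))))))))

theorem and_holds {b c : Test} : (Test.and b c).Holds s ↔ b.Holds s ∧ c.Holds s := Iff.rfl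

theorem forkTest_holds (hG : HoldsGraph G s) {x y z z' : Fin n} (h16 : s.natVar 16 = x)
    (h17 : s.natVar 17 = y) (h18 : s.natVar 18 = z) (h19 : s.natVar 19 = z') :
    forkTest.Holds s ↔ G.negEdges.Adj y z ∧ G.negEdges.Adj y z' ∧ z ≠ z' ∧
      s.tab n 6 x y ≠ ⊤ ∧ s.tab n 6 x z ≤ s.tab n 6 x y ∧ s.tab n 6 x z' ≤ s.tab n 6 x y := by
  rw [forkTest, and_holds, and_holds, and_holds, and_holds, and_holds, and_holds, and_holds,
    negTest_holds hG h17 h18, negTest_holds hG h17 h19, finite_ix_holds hG.size h16 h17,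
    finite_ix_holds hG.size h16 h18, finite_ix_holds hG.size h16 h19]
  refine and_congr_right fun _ => and_congr_right fun _ => and_congr ?_ (and_congr_right fun hy => ?_)
  · simp only [Test.Holds, NatExpr.eval, h18, h19, Fin.ext_iff, ne_eq]
  · have hy' := coe_realArr hG.size h16 h17 hy
    constructor
    · rintro ⟨h1, h2, h3, h4⟩
      rw [← coe_realArr hG.size h16 h18 h1, ← coe_realArr hG.size h16 h19 h2, ← hy',
        WithTop.coe_le_coe, WithTop.coe_le_coe]
      exact ⟨not_lt.1 h3, not_lt.1 h4⟩
    · rintro ⟨h3, h4⟩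
      have h1 := ne_top_of_le_ne_top hy h3
      have h2 := ne_top_of_le_ne_top hy h4
      rw [← coe_realArr hG.size h16 h18 h1, ← hy', WithTop.coe_le_coe] at h3
      rw [← coe_realArr hG.size h16 h19 h2, ← hy', WithTop.coe_le_coe] at h4
      exact ⟨h1, h2, not_lt.2 h3, not_lt.2 h4⟩

/-- Clear the flag if the negative edges contain a cycle. -/
def forestProg : ForProg :=
  .for_ 16 0 (.for_ 17 0 (.for_ 18 0 (.for_ 19 0 (clearIf forkTest))))

theorem run_forestProg (hG : HoldsGraph G s) :
    FlagRel [16, 17, 18, 19] (¬ G.AcyclicTest (s.tab n 6)) s (forestProg.run s) ∧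
      ((forestProg.run s).natVar 1 ≠ 0 → G.AcyclicTest (s.tab n 6)) := by
  let Q : ℕ → ℕ → ℕ → ℕ → Prop := fun i j k l => ∀ x y z z' : Fin n, i = x → j = y → k = z →
    l = z' → G.negEdges.Adj y z ∧ G.negEdges.Adj y z' ∧ z ≠ z' ∧
      s.tab n 6 x y ≠ ⊤ ∧ s.tab n 6 x z ≤ s.tab n 6 x y ∧ s.tab n 6 x z' ≤ s.tab n 6 x y
  have h1 := run_for2_flag (X := [16, 17, 18, 19]) (C := ¬ G.AcyclicTest (s.tab n 6)) (s := s)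
    (n := n) (x := 16) (y := 17) (p := .for_ 18 0 (.for_ 19 0 (clearIf forkTest)))
    (fun i j => ∃ k < n, ∃ l < n, Q i j k l) (by simp) (by simp) (by simp) (by simp) (by simp)
    (by simp [vars, clearIf]) hG.size ?_
  · refine ⟨h1.1, fun hne x y z z' h2 h3 h4 h5 h6 h7 => hne ?_⟩
    refine h1.2 x x.2 y y.2 ⟨z, z.2, z', z'.2, ?_⟩
    intro a b c d e1 e2 e3 e4
    rw [← Fin.ext e1, ← Fin.ext e2, ← Fin.ext e3, ← Fin.ext e4]
    exact ⟨h2, h3, h4, h5, h6, h7⟩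
  · intro i j σ hi hj h16 h17 hσ
    have hGσ := hG.of_agree hσ.1 (by simp) (by simp) (by simp)
    have h2 := run_for2_flag (X := [18, 19]) (C := ¬ G.AcyclicTest (s.tab n 6)) (s := σ)
      (n := n) (x := 18) (y := 19) (p := clearIf forkTest)
      (fun k l => Q i j k l) (by simp) (by simp) (by simp) (by simp) (by simp)
      (by simp [vars, clearIf]) hGσ.size ?_
    · refine ⟨⟨h2.1.1.mono (by simp) (by simp), h2.1.2⟩, ?_⟩
      rintro ⟨k, hk, l, hl, hQ⟩
      exact h2.2 k hk l hl hQ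
    · intro k l τ hk hl h18 h19 hτ
      have hGτ := hGσ.of_agree hτ.1 (by simp) (by simp) (by simp)
      have := forkTest_holds hGτ (x := ⟨i, hi⟩) (y := ⟨j, hj⟩) (z := ⟨k, hk⟩) (z' := ⟨l, hl⟩)
        ((hτ.1.1 16 (by simp)).trans h16) ((hτ.1.1 17 (by simp)).trans h17) h18 h19
      rw [hτ.1.tab_eq (by simp), hσ.1.tab_eq (by simp)] at this
      have hC : forkTest.Holds τ → ¬ G.AcyclicTest (s.tab n 6) := by
        intro hh htest
        obtain ⟨a1, a2, a3, a4, a5, a6⟩ := this.1 hh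
        exact htest _ _ _ _ a1 a2 a3 a4 a5 a6
      obtain ⟨h3, h4⟩ := run_clearIf (X := [18, 19]) hC
      exact ⟨h3, fun hQ => h4 (this.2 (hQ _ _ _ _ rfl rfl rfl rfl))⟩

end ForProg

end RAM

/-! ## Labels for trees -/

namespace MixedGraph

open Classical

variable {n : ℕ} {G : MixedGraph (Fin n)} {rel : Fin n → Prop} {u v : Fin n}

/-- The vertex `u` in `rel` has another such vertex in its negative tree. -/
def InTree (G : MixedGraph (Fin n)) (rel : Fin n → Prop) (u : Fin n) : Prop :=
  rel u ∧ ∃ v, v ≠ u ∧ rel v ∧ G.negEdges.Reachable v u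

/-- The vertex `u` is the first vertex in `rel` of its negative tree, and not the only one. -/
def IsRep (G : MixedGraph (Fin n)) (rel : Fin n → Prop) (u : Fin n) : Prop :=
  G.InTree rel u ∧ ∀ x, x < u → rel x → ¬ G.negEdges.Reachable x u

/-- The representatives of trees with numbers below `m`. -/
noncomputable def repsBelow (G : MixedGraph (Fin n)) (rel : Fin n → Prop) (m : ℕ) :
    Finset (Fin n) :=
  Finset.univ.filter fun w => G.IsRep rel w ∧ (w : ℕ) < m

/-- The representatives of trees that come before the tree of `u`. -/
noncomputable def repsBefore (G : MixedGraph (Fin n)) (rel : Fin n → Prop) (u : Fin n) :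
    Finset (Fin n) :=
  Finset.univ.filter fun w => G.IsRep rel w ∧ ∀ x, rel x → G.negEdges.Reachable x u → w < x

/-- The label of the negative tree of `u`. -/
noncomputable def label (G : MixedGraph (Fin n)) (rel : Fin n → Prop) (u : Fin n) : ℕ :=
  if G.InTree rel u then 2 ^ (G.repsBefore rel u).card else 0

theorem label_ne_zero_iff : G.label rel u ≠ 0 ↔ G.InTree rel u := by
  unfold label
  split_ifs with h <;> simp [h]

theorem InTree.of_reachable (hu : G.InTree rel u) (hv : rel v) (h : G.negEdges.Reachable u v) :
    G.InTree rel v := by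
  obtain ⟨h1, x, h2, h3, h4⟩ := hu
  by_cases huv : u = v
  · subst huv; exact ⟨h1, x, h2, h3, h4⟩
  · exact ⟨hv, u, huv, h1, h⟩

theorem label_eq_of_reachable (hu : rel u) (hv : rel v) (h : G.negEdges.Reachable u v) :
    G.label rel u = G.label rel v := by
  have h1 : G.InTree rel u ↔ G.InTree rel v :=
    ⟨fun h' => h'.of_reachable hv h, fun h' => h'.of_reachable hu h.symm⟩
  have h2 : G.repsBefore rel u = G.repsBefore rel v := by
    ext w
    simp only [repsBefore, Finset.mem_filter, Finset.mem_univ, true_and]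
    exact and_congr_right fun _ => forall₂_congr fun x _ =>
      ⟨fun h' hx => h' (hx.trans h.symm), fun h' hx => h' (hx.trans h)⟩
  simp only [label, h1, h2]

theorem InTree.exists_rep (hu : G.InTree rel u) :
    ∃ w, G.IsRep rel w ∧ G.negEdges.Reachable w u ∧ ∀ x, rel x → G.negEdges.Reachable x u → w ≤ x := by
  obtain ⟨w, hw, hmin⟩ := Finset.exists_min_image
    (Finset.univ.filter fun x => rel x ∧ G.negEdges.Reachable x u) id
    ⟨u, by simpa using hu.1⟩
  simp only [Finset.mem_filter, Finset.mem_univ, true_and, id] at hw hmin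
  exact ⟨w, ⟨hu.of_reachable hw.1 hw.2.symm, fun x hx hr h => absurd (hmin x ⟨hr, h.trans hw.2⟩)
    (not_le.2 hx)⟩, hw.2, fun x h1 h2 => hmin x ⟨h1, h2⟩⟩

theorem IsRep.eq_of_reachable (hu : G.IsRep rel u) (hv : G.IsRep rel v)
    (h : G.negEdges.Reachable u v) : u = v := by
  rcases lt_trichotomy u v with h' | h' | h'
  · exact absurd h (hv.2 u h' hu.1.1)
  · exact h'
  · exact absurd h.symm (hu.2 v h' hv.1.1)

/-- This yields strict inequalities between exponents of labels. The inclusion is proper because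
`w`, being in the tree of u, does not come before that tree. -/
theorem repsBefore_ssubset {w : Fin n} {S : Finset (Fin n)} (hw : w ∈ S)
    (hwu : G.negEdges.Reachable w u) (hwr : rel w)
    (h : ∀ x, G.IsRep rel x → x < w → x ∈ S) : G.repsBefore rel u ⊂ S := by
  refine (Finset.ssubset_iff_of_subset fun x hx => ?_).2 ⟨w, hw, fun h' => ?_⟩
  · simp only [repsBefore, Finset.mem_filter, Finset.mem_univ, true_and] at hx
    exact h x hx.1 (hx.2 w hwr hwu)
  · simp only [repsBefore, Finset.mem_filter, Finset.mem_univ, true_and] at h'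
    exact lt_irrefl _ (h'.2 w hwr hwu)

/-- The exponent of a label is the rank of the first relevant vertex of the tree among all
representatives. It depends only on the tree, differs for different trees, and is below the number
of representatives. -/
theorem isTreeLabelling_label (G : MixedGraph (Fin n)) (rel : Fin n → Prop) :
    G.IsTreeLabelling rel (G.repsBelow rel n).card (G.label rel) where
  pow x hx := by
    rw [label_ne_zero_iff] at hx
    obtain ⟨w, h1, h2, h3⟩ := hx.exists_rep
    refine ⟨(G.repsBefore rel x).card, Finset.card_lt_card ?_, if_pos hx⟩
    exact repsBefore_ssubset (w := w) (by simp [repsBelow, h1]) h2 h1.1.1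
      fun z hz _ => by simp [repsBelow, hz]
  eq_iff x y hx hy := by
    rw [label_ne_zero_iff] at hx hy
    refine ⟨fun h => ?_, label_eq_of_reachable hx.1 hy.1⟩
    have key : ∀ {x y : Fin n}, G.InTree rel x → G.InTree rel y → ∀ {a b : Fin n}, a < b →
        G.IsRep rel a → G.negEdges.Reachable a x →
        (∀ z, rel z → G.negEdges.Reachable z y → b ≤ z) →
        (G.repsBefore rel x).card < (G.repsBefore rel y).card := by
      intro x y hx hy a b hab ha hax hb
      refine Finset.card_lt_card (repsBefore_ssubset (w := a) ?_ hax ha.1.1 ?_)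
      · simp only [repsBefore, Finset.mem_filter, Finset.mem_univ, true_and]
        exact ⟨ha, fun z hz hzy => hab.trans_le (hb z hz hzy)⟩
      · intro z hz hza
        simp only [repsBefore, Finset.mem_filter, Finset.mem_univ, true_and]
        exact ⟨hz, fun z' hz' hzy => (hza.trans hab).trans_le (hb z' hz' hzy)⟩
    obtain ⟨a, ha, hax, ha'⟩ := hx.exists_rep
    obtain ⟨b, hb, hby, hb'⟩ := hy.exists_rep
    rw [label, label, if_pos hx, if_pos hy] at h
    have h := Nat.pow_right_injective le_rfl h
    rcases lt_trichotomy a b with hab | rfl | hab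
    · exact absurd h (key hx hy hab ha hax hb').ne
    · exact hax.symm.trans hby
    · exact absurd h (key hy hx hab hb hby ha').ne'
  ne_zero x y hx hy hxy h := label_ne_zero_iff.2 ⟨hx, y, hxy.symm, hy, h.symm⟩

/-- For the first relevant vertex of a tree, to come before the tree is to have a smaller number.
The rank is thus known as soon as the smaller vertices have been scanned. -/
theorem IsRep.label_eq (hu : G.IsRep rel u) : G.label rel u = 2 ^ (G.repsBelow rel u).card := by
  rw [label, if_pos hu.1]
  congr 2
  ext w
  simp only [repsBefore, repsBelow, Finset.mem_filter, Finset.mem_univ, true_and, Fin.val_fin_lt]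
  refine and_congr_right fun _ => ⟨fun h => h u hu.1.1 (.refl _), fun h x hx hxu => ?_⟩
  exact h.trans_le (not_lt.1 fun h' => hu.2 x h' hx hxu)

/-- The representative w < u of the tree has been counted by the time u is reached, but it does not
precede its own tree; so the exponent of u is strictly below the current count. Comparing a label
with the current power hence recognises representatives. -/
theorem label_ne_of_not_isRep (hu : ¬ G.IsRep rel u) :
    G.label rel u ≠ 2 ^ (G.repsBelow rel u).card := by
  by_cases h : G.InTree rel u
  · rw [label, if_pos h]
    intro he
    have he := Nat.pow_right_injective le_rfl he
    obtain ⟨w, h1, h2, h3⟩ := h.exists_rep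
    have hwu : w < u := lt_of_le_of_ne (h3 u h.1 (.refl _)) fun h' => hu (h' ▸ h1)
    refine (Finset.card_lt_card (repsBefore_ssubset (w := w) (u := u) ?_ h2 h1.1.1 ?_)).ne he
    · simp [repsBelow, h1, hwu]
    · intro z hz hzw
      simp [repsBelow, hz, hzw.trans hwu]
  · rw [label, if_neg h]
    exact (Nat.two_pow_pos _).ne

theorem card_repsBelow_succ (u : Fin n) : (G.repsBelow rel (u + 1)).card =
    (G.repsBelow rel u).card + if G.IsRep rel u then 1 else 0 := by
  have h : G.repsBelow rel (u + 1) =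
      if G.IsRep rel u then insert u (G.repsBelow rel u) else G.repsBelow rel u := by
    ext w
    have : (w : ℕ) < u + 1 ↔ w = u ∨ (w : ℕ) < u := by rw [Fin.ext_iff]; omega
    by_cases hu : G.IsRep rel u
    · simp only [repsBelow, Finset.mem_filter, Finset.mem_univ, true_and, if_pos hu,
        Finset.mem_insert, this]
      by_cases hw : w = u
      · subst hw; simp [hu]
      · simp [hw]
    · simp only [repsBelow, Finset.mem_filter, Finset.mem_univ, true_and, if_neg hu, this]
      by_cases hw : w = u
      · subst hw; simp [hu]
      · simp [hw]
  rw [h]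
  by_cases hu : G.IsRep rel u
  · rw [if_pos hu, if_pos hu, Finset.card_insert_of_notMem]
    simp [repsBelow]
  · rw [if_neg hu, if_neg hu, add_zero]

theorem card_repsBelow_le {m : ℕ} : (G.repsBelow rel m).card ≤ (G.repsBelow rel n).card :=
  Finset.card_le_card fun w hw => by
    simp only [repsBelow, Finset.mem_filter, Finset.mem_univ, true_and] at hw ⊢
    exact ⟨hw.1, w.2⟩

/-- The number of representatives is bounded by the number of negative trees in a weak block. -/
theorem card_repsBelow_le_of_weakBlocks {s t : Fin n} {k : ℕ} (hne : s ≠ t) (hst : G.Conn s t)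
    (hts : G.Conn t s) (hsep : ∀ c, ¬ G.Separates c s t)
    (hk : ∀ K B : Set (Fin n), G.IsStrongComponent K → G.IsWeakBlock K B → G.numNegTrees B ≤ k) :
    (G.repsBelow (G.Relevant s t) n).card ≤ k := by
  refine card_le_of_weakBlocks hne hst hts hsep hk _ ?_ ?_
  · intro u hu
    simp only [repsBelow, Finset.mem_filter, Finset.mem_univ, true_and] at hu
    obtain ⟨⟨h1, v, h2, h3, h4⟩, -⟩ := hu.1
    exact ⟨v, h1, h3, h2.symm, h4.symm⟩
  · intro u hu v hv h
    simp only [repsBelow, Finset.mem_filter, Finset.mem_univ, true_and] at hu hv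
    exact hu.1.eq_of_reachable hv.1 h

end MixedGraph

/-! ## Computing separators, relevant vertices and labels -/

namespace RAM

open MixedGraph

variable {n : ℕ} {G : MixedGraph (Fin n)} {s σ : State} {X A : List ℕ}

theorem HoldsReach.of_agree (h : ForProg.HoldsReach G s) (hs : Agree X A s σ) (h4 : 4 ∉ A) :
    ForProg.HoldsReach G σ := by
  unfold ForProg.HoldsReach
  rw [hs.2.1 4 h4]
  exact h

namespace ForProg

/-- Loop invariants for the memories at the beginning of the rounds. -/
theorem iter_for {p : ForProg} {x y : ℕ} {s : State} (I : ℕ → State → Prop)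
    (h0 : I 0 (s.setVar x 0))
    (hs : ∀ i σ, i < s.natVar y → σ.natVar x = i → I i σ → I (i + 1) ((p.run σ).setVar x (i + 1))) :
    ∀ i ≤ s.natVar y, I i (iter p.run x s i) := by
  intro i
  induction i with
  | zero => exact fun _ => h0
  | succ i ih => exact fun hi => hs i _ (by omega) (iter_natVar p s i) (ih (by omega))

theorem agree_iter (p : ForProg) (x : ℕ) (s : State) (i : ℕ) :
    Agree (x :: p.vars) p.arrs s (iter p.run x s i) := by
  induction i with
  | zero => exact agree_setVar s _ (by simp)
  | succ i ih =>
    exact (ih.trans ((p.agree_run _).mono (by simp) (by simp))).trans (agree_setVar _ _ (by simp))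

theorem safe_for {cv : ℕ → Bd} {M m : ℕ} {p : ForProg} {x y : ℕ}
    (h : ∀ σ, Agree (x :: p.vars) p.arrs s σ → σ.natVar x < s.natVar y → p.Safe cv M m σ) :
    (for_ x y p).Safe cv M m s := fun i hi =>
  h _ (agree_iter p x s i) (by rwa [iter_natVar])

/-- The test whether there is a walk between two vertices that avoids a third one. -/
def reachTest (c : NatExpr) (x y : ℕ) : Test := finite 4 (ix3 c (.var x) (.var y))

theorem reachTest_holds (hn : s.natVar 0 = n) (hR : HoldsReach G s) {c : NatExpr} {x y : ℕ}
    {u v : Fin n} (hc : c.eval s ≤ n) (hx : s.natVar x = u) (hy : s.natVar y = v) :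
    (reachTest c x y).Holds s ↔ ConnAvoidNat G (c.eval s) u v := by
  rw [← hR _ hc]
  simp only [reachTest, finite, Test.Holds, ix3, NatExpr.eval, hn, hx, hy, ne_eq]

theorem reachTest_holds_var (hn : s.natVar 0 = n) (hR : HoldsReach G s) {c x y : ℕ}
    {w u v : Fin n} (hc : s.natVar c = w) (hx : s.natVar x = u) (hy : s.natVar y = v) :
    (reachTest (.var c) x y).Holds s ↔ G.ConnAvoid w u v := by
  rw [reachTest_holds hn hR (by simp only [NatExpr.eval, hc]; exact w.2.le) hx hy,
    NatExpr.eval, hc, connAvoidNat_iff]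

theorem reachTest_holds_zero (hn : s.natVar 0 = n) (hR : HoldsReach G s) {x y : ℕ}
    {u v : Fin n} (hx : s.natVar x = u) (hy : s.natVar y = v) :
    (reachTest (.var 0) x y).Holds s ↔ G.Conn u v := by
  rw [reachTest_holds hn hR (by simp only [NatExpr.eval, hn]; exact le_rfl) hx hy,
    NatExpr.eval, hn, connAvoidNat_size]

/-- Set variable `28` to `1` if no vertex separates the vertices in variables `20` and `21`. -/
def sepProg : ForProg :=
  .seq (.setN 28 (.lit 1)) (.for_ 24 0 (.ite (.and (.not (.natEq (.var 24) (.var 20)))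
    (.and (.not (.natEq (.var 24) (.var 21))) (.not (reachTest (.var 24) 20 21))))
      (.setN 28 (.lit 0)) .skip))

theorem run_sepProg (hn : s.natVar 0 = n) (hR : HoldsReach G s) {a b : Fin n}
    (ha : s.natVar 20 = a) (hb : s.natVar 21 = b) :
    Agree [24, 28] [] s (sepProg.run s) ∧
      ((sepProg.run s).natVar 28 = 1 ↔ ∀ c, c ≠ a → c ≠ b → G.ConnAvoid c a b) := by
  refine ⟨(sepProg.agree_run s).mono (by simp [sepProg, vars]) (by simp [sepProg, arrs]), ?_⟩
  have := run_for (s := (ForProg.setN 28 (.lit 1)).run s) (x := 24) (y := 0)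
    (p := .ite (.and (.not (.natEq (.var 24) (.var 20)))
      (.and (.not (.natEq (.var 24) (.var 21))) (.not (reachTest (.var 24) 20 21))))
      (.setN 28 (.lit 0)) .skip)
    (fun m σ => Agree [24, 28] [] s σ ∧ (σ.natVar 28 = 1 ↔ ∀ c : Fin n, (c : ℕ) < m →
      c ≠ a → c ≠ b → G.ConnAvoid c a b)) ?_ ?_
  · have h0 : ((ForProg.setN 28 (.lit 1)).run s).natVar 0 = n := by
      rw [run, setVar_natVar_of_ne _ _ (by simp), hn]
    rw [h0] at this
    rw [sepProg, run, this.2]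
    exact forall_congr' fun c => ⟨fun h => h c.2, fun h _ => h⟩
  · refine ⟨(agree_setVar s _ (by simp)).trans (agree_setVar _ _ (by simp)), ?_⟩
    rw [setVar_natVar_of_ne _ _ (by simp)]
    simp [run, NatExpr.eval]
  · rintro i σ hi h24 ⟨hσ, hiff⟩
    have hi : i < n := by rwa [run, setVar_natVar_of_ne _ _ (by simp), hn] at hi
    have e := reachTest_holds_var ((hσ.1 0 (by simp)).trans hn) (HoldsReach.of_agree hR hσ (by simp))
      (w := ⟨i, hi⟩) h24 ((hσ.1 20 (by simp)).trans ha) ((hσ.1 21 (by simp)).trans hb)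
    have e20 := (hσ.1 20 (by simp)).trans ha
    have e21 := (hσ.1 21 (by simp)).trans hb
    have hb : (Test.and (.not (.natEq (.var 24) (.var 20)))
      (.and (.not (.natEq (.var 24) (.var 21))) (.not (reachTest (.var 24) 20 21)))).Holds σ ↔
        ¬ ((⟨i, hi⟩ : Fin n) ≠ a → (⟨i, hi⟩ : Fin n) ≠ b → G.ConnAvoid ⟨i, hi⟩ a b) := by
      rw [and_holds, and_holds, Test.Holds, Test.Holds, Test.Holds, Test.Holds, Test.Holds, e]
      simp only [NatExpr.eval, h24, e20, e21, Fin.ext_iff, ne_eq]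
      tauto
    have hall : (∀ c : Fin n, (c : ℕ) < i + 1 → c ≠ a → c ≠ b → G.ConnAvoid c a b) ↔
        (∀ c : Fin n, (c : ℕ) < i → c ≠ a → c ≠ b → G.ConnAvoid c a b) ∧
        ((⟨i, hi⟩ : Fin n) ≠ a → (⟨i, hi⟩ : Fin n) ≠ b → G.ConnAvoid ⟨i, hi⟩ a b) := by
      refine ⟨fun h => ⟨fun c hc => h c (by omega), h ⟨i, hi⟩ (by simp)⟩, fun h c hc => ?_⟩
      rcases Nat.lt_succ_iff_lt_or_eq.1 hc with hc | hc
      · exact h.1 c hc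
      · obtain rfl : c = ⟨i, hi⟩ := Fin.ext hc
        exact h.2
    rw [hall, setVar_natVar_of_ne _ _ (by simp), ← hiff, run]
    split_ifs with h
    · rw [hb] at h
      exact ⟨(hσ.trans (agree_setVar _ _ (by simp))).trans (agree_setVar _ _ (by simp)),
        ⟨fun h' => by simp [run, NatExpr.eval] at h', fun h' => absurd h'.2 h⟩⟩
    · rw [hb, not_not] at h
      exact ⟨hσ.trans (agree_setVar _ _ (by simp)), (and_iff_left h).symm⟩

/-- Determine the vertices relevant for the vertices in variables `20` and `21`. -/
def relProg : ForProg :=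
  .for_ 22 0 (.seq (.setA 8 (.var 22) (.lit 1)) (.for_ 24 0 (.ite
    (.and (.not (.natEq (.var 24) (.var 22)))
      (.and (.not (reachTest (.var 24) 20 22)) (.not (reachTest (.var 24) 22 21))))
    (.setA 8 (.var 22) (.lit 0)) .skip)))

theorem run_relRound (hn : s.natVar 0 = n) (hR : HoldsReach G s) {a b u : Fin n}
    (ha : s.natVar 20 = a) (hb : s.natVar 21 = b) (hu : s.natVar 22 = u) :
    let s' := (ForProg.seq (.setA 8 (.var 22) (.lit 1)) (.for_ 24 0 (.ite
    (.and (.not (.natEq (.var 24) (.var 22)))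
      (.and (.not (reachTest (.var 24) 20 22)) (.not (reachTest (.var 24) 22 21))))
    (.setA 8 (.var 22) (.lit 0)) .skip))).run s
    (∀ k : ℕ, k ≠ u → s'.natArr 8 k = s.natArr 8 k) ∧ (s'.natArr 8 u ≠ 0 ↔ G.Relevant a b u) := by
  intro s'
  have := run_for (s := (ForProg.setA 8 (.var 22) (.lit 1)).run s) (x := 24) (y := 0)
    (p := .ite (.and (.not (.natEq (.var 24) (.var 22)))
      (.and (.not (reachTest (.var 24) 20 22)) (.not (reachTest (.var 24) 22 21))))
      (.setA 8 (.var 22) (.lit 0)) .skip)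
    (fun m σ => Agree [24] [8] s σ ∧ (∀ k : ℕ, k ≠ u → σ.natArr 8 k = s.natArr 8 k) ∧
      (σ.natArr 8 u ≠ 0 ↔ ∀ c : Fin n, (c : ℕ) < m →
      c ≠ u → G.ConnAvoid c a u ∨ G.ConnAvoid c u b)) ?_ ?_
  · have h0 : ((ForProg.setA 8 (.var 22) (.lit 1)).run s).natVar 0 = n := hn
    rw [h0] at this
    refine ⟨this.2.1, this.2.2.trans ?_⟩
    exact forall_congr' fun c => ⟨fun h => h c.2, fun h _ => h⟩
  · refine ⟨(((ForProg.setA 8 (.var 22) (.lit 1)).agree_run s).mono (by simp [vars])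
      (by simp [arrs])).trans (agree_setVar _ _ (by simp)), fun k hk => ?_, ?_⟩
    · simp [run, updateArr_apply, NatExpr.eval, hu, hk]
    · simp [run, updateArr_apply, NatExpr.eval, hu]
  · rintro i σ hi h24 ⟨hσ, hold, hiff⟩
    have hi : i < n := by rwa [show ((ForProg.setA 8 (.var 22) (.lit 1)).run s).natVar 0 = n from hn]
      at hi
    have e20 := (hσ.1 20 (by simp)).trans ha
    have e21 := (hσ.1 21 (by simp)).trans hb
    have e22 := (hσ.1 22 (by simp)).trans hu
    have hn' := (hσ.1 0 (by simp)).trans hn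
    have hR' := HoldsReach.of_agree hR hσ (by simp)
    have e := reachTest_holds_var hn' hR' (w := ⟨i, hi⟩) h24 e20 e22
    have e' := reachTest_holds_var hn' hR' (w := ⟨i, hi⟩) h24 e22 e21
    have hb : (Test.and (.not (.natEq (.var 24) (.var 22)))
      (.and (.not (reachTest (.var 24) 20 22)) (.not (reachTest (.var 24) 22 21)))).Holds σ ↔
        ¬ ((⟨i, hi⟩ : Fin n) ≠ u → G.ConnAvoid ⟨i, hi⟩ a u ∨ G.ConnAvoid ⟨i, hi⟩ u b) := by
      rw [and_holds, and_holds, Test.Holds, Test.Holds, Test.Holds, Test.Holds, e, e']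
      simp only [NatExpr.eval, h24, e22, Fin.ext_iff, ne_eq]
      tauto
    have hall : (∀ c : Fin n, (c : ℕ) < i + 1 → c ≠ u → G.ConnAvoid c a u ∨ G.ConnAvoid c u b) ↔
        (∀ c : Fin n, (c : ℕ) < i → c ≠ u → G.ConnAvoid c a u ∨ G.ConnAvoid c u b) ∧
        ((⟨i, hi⟩ : Fin n) ≠ u → G.ConnAvoid ⟨i, hi⟩ a u ∨ G.ConnAvoid ⟨i, hi⟩ u b) := by
      refine ⟨fun h => ⟨fun c hc => h c (by omega), h ⟨i, hi⟩ (by simp)⟩, fun h c hc => ?_⟩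
      rcases Nat.lt_succ_iff_lt_or_eq.1 hc with hc | hc
      · exact h.1 c hc
      · obtain rfl : c = ⟨i, hi⟩ := Fin.ext hc
        exact h.2
    rw [hall, setVar_natArr, ← hiff, run]
    split_ifs with h
    · rw [hb] at h
      refine ⟨(hσ.trans (((ForProg.setA 8 (.var 22) (.lit 0)).agree_run σ).mono (by simp [vars])
        (by simp [arrs]))).trans (agree_setVar _ _ (by simp)), fun k hk => ?_, ?_⟩
      · simp [run, updateArr_apply, NatExpr.eval, e22, hk, hold]
      · simp [run, updateArr_apply, NatExpr.eval, e22, h]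
    · rw [hb, not_not] at h
      exact ⟨hσ.trans (agree_setVar _ _ (by simp)), hold, (and_iff_left h).symm⟩

theorem run_relProg (hn : s.natVar 0 = n) (hR : HoldsReach G s) {a b : Fin n}
    (ha : s.natVar 20 = a) (hb : s.natVar 21 = b) :
    Agree [22, 24] [8] s (relProg.run s) ∧
      ∀ u : Fin n, (relProg.run s).natArr 8 u ≠ 0 ↔ G.Relevant a b u := by
  have hag : ∀ s, Agree [22, 24] [8] s (relProg.run s) := fun s =>
    (relProg.agree_run s).mono (by simp [relProg, vars]) (by simp [relProg, arrs])
  refine ⟨hag s, ?_⟩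
  have := run_for (s := s) (x := 22) (y := 0) (p := .seq (.setA 8 (.var 22) (.lit 1))
    (.for_ 24 0 (.ite (.and (.not (.natEq (.var 24) (.var 22)))
      (.and (.not (reachTest (.var 24) 20 22)) (.not (reachTest (.var 24) 22 21))))
    (.setA 8 (.var 22) (.lit 0)) .skip)))
    (fun m σ => Agree [22, 24] [8] s σ ∧ ∀ u : Fin n, (u : ℕ) < m →
      (σ.natArr 8 u ≠ 0 ↔ G.Relevant a b u)) ?_ ?_
  · exact fun u => this.2 u (by rw [hn]; exact u.2)
  · exact ⟨agree_setVar _ _ (by simp), by simp⟩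
  · rintro i σ hi h22 ⟨hσ, h⟩
    rw [hn] at hi
    obtain ⟨h1, h2⟩ := run_relRound ((hσ.1 0 (by simp)).trans hn)
      (HoldsReach.of_agree hR hσ (by simp)) ((hσ.1 20 (by simp)).trans ha)
      ((hσ.1 21 (by simp)).trans hb) (u := ⟨i, hi⟩) h22
    refine ⟨(hσ.trans ((agree_run _ σ).mono (by simp [vars]) (by simp [arrs]))).trans
      (agree_setVar _ _ (by simp)), fun u hu => ?_⟩
    rw [setVar_natArr]
    rcases Nat.lt_succ_iff_lt_or_eq.1 hu with hu | hu
    · rw [h1 u hu.ne]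
      exact h u hu
    · obtain rfl : u = ⟨i, hi⟩ := Fin.ext hu
      exact h2

/-! ### Labels -/

/-- Compare the vertices in variables `22` and `23`. -/
def labelStep : ForProg :=
  .ite (.and (.and (finite 8 (.var 23)) (finite 6 (ix 23 22))) (.natLt (.var 23) (.var 22)))
    (.setA 9 (.var 22) (.get 9 (.var 23)))
    (.ite (.and (.and (finite 8 (.var 23)) (finite 6 (ix 23 22)))
        (.and (.natLt (.var 22) (.var 23)) (.natEq (.get 9 (.var 22)) (.lit 0))))
      (.setA 9 (.var 22) (.var 3)) .skip)

/-- Compute the label of the vertex in variable `22`. -/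
def labelRow : ForProg :=
  .seq (.setA 9 (.var 22) (.lit 0)) (.ite (finite 8 (.var 22)) (.for_ 23 0 labelStep) .skip)

/-- Compute the labels of the vertices that array `8` declares relevant. -/
def labelProg : ForProg :=
  .seq (.setN 3 (.lit 1)) (.for_ 22 0 (.seq labelRow
    (.ite (.natEq (.get 9 (.var 22)) (.var 3)) (.setB 3 (.add (.var 3) (.var 3))) .skip)))

theorem run_labelRow {rel : Fin n → Prop} (hn : s.natVar 0 = n)
    (h8 : ∀ x : Fin n, s.natArr 8 x ≠ 0 ↔ rel x) (hδ : G.IsTreeTable (s.tab n 6)) {u : Fin n}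
    (hu : s.natVar 22 = u) (h3 : s.natVar 3 = 2 ^ (G.repsBelow rel u).card)
    (h9 : ∀ x : Fin n, x < u → s.natArr 9 x = G.label rel x) :
    Agree [23] [9] s (labelRow.run s) ∧
      (∀ k : ℕ, k ≠ u → (labelRow.run s).natArr 9 k = s.natArr 9 k) ∧
      (labelRow.run s).natArr 9 u = G.label rel u := by
  classical
  refine ⟨(labelRow.agree_run s).mono (by simp [labelRow, labelStep, vars])
    (by simp [labelRow, labelStep, arrs]), ?_⟩
  set s1 := (ForProg.setA 9 (.var 22) (.lit 0)).run s with hs1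
  have hs1a : Agree [23] [9] s s1 :=
    ((ForProg.setA 9 (.var 22) (.lit 0)).agree_run s).mono (by simp [vars]) (by simp [arrs])
  have h1 : ∀ k, s1.natArr 9 k = if k = u then 0 else s.natArr 9 k := by
    intro k
    simp only [hs1, run, updateArr_apply, NatExpr.eval, hu]
  have hrun : labelRow.run s = if rel u then (ForProg.for_ 23 0 labelStep).run s1 else s1 := by
    have : (finite 8 (.var 22)).Holds s1 ↔ rel u := by
      rw [← h8]
      simp only [finite, Test.Holds, NatExpr.eval, hs1a.2.1 8 (by simp), hs1a.1 22 (by simp), hu,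
        ne_eq]
    change (ForProg.ite (finite 8 (.var 22)) (.for_ 23 0 labelStep) .skip).run s1 = _
    rw [run]
    simp only [this]
    rfl
  rw [hrun]
  by_cases hrel : rel u
  · rw [if_pos hrel]
    -- `N1` and `N2` mark relevant vertices of the tree of u that are smaller or larger than u. A
    -- smaller one passes on its label; if there are only larger ones, u is a representative and
    -- takes the fresh power; if there are none, the label stays 0.
    let N1 : ℕ → Prop := fun x => ∃ x' : Fin n, x = x' ∧ x' < u ∧ rel x' ∧ G.negEdges.Reachable x' u
    let N2 : ℕ → Prop := fun x => ∃ x' : Fin n, x = x' ∧ u < x' ∧ rel x' ∧ G.negEdges.Reachable x' u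
    have hsucc : ∀ (N : ℕ → Prop) (i : ℕ), (∃ x < i + 1, N x) ↔ (∃ x < i, N x) ∨ N i := by
      intro N i
      constructor
      · rintro ⟨x, hx, h⟩
        rcases Nat.lt_succ_iff_lt_or_eq.1 hx with hx | rfl
        · exact .inl ⟨x, hx, h⟩
        · exact .inr h
      · rintro (⟨x, hx, h⟩ | h)
        · exact ⟨x, by omega, h⟩
        · exact ⟨i, by omega, h⟩
    have hpos : ∀ i, (∃ x < i, N1 x) → G.label rel u ≠ 0 := by
      rintro i ⟨x, -, x', rfl, h1, h2, h3⟩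
      exact label_ne_zero_iff.2 ⟨hrel, x', h1.ne, h2, h3⟩
    have := run_for (s := s1) (x := 23) (y := 0) (p := labelStep)
      (fun i τ => Agree [23] [9] s τ ∧ (∀ k : ℕ, k ≠ u → τ.natArr 9 k = s.natArr 9 k) ∧
        ((∃ x < i, N1 x) → τ.natArr 9 u = G.label rel u) ∧
        (¬ (∃ x < i, N1 x) → (∃ x < i, N2 x) → τ.natArr 9 u = s.natVar 3) ∧
        (¬ (∃ x < i, N1 x) → ¬ (∃ x < i, N2 x) → τ.natArr 9 u = 0)) ?_ ?_
    · rw [show s1.natVar 0 = n from hn] at this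
      obtain ⟨-, h2, h4, h5, h6⟩ := this
      refine ⟨h2, ?_⟩
      by_cases hN1 : ∃ x < n, N1 x
      · exact h4 hN1
      have hmin : ∀ x, x < u → rel x → ¬ G.negEdges.Reachable x u := fun x hx hr hxu =>
        hN1 ⟨x, x.2, x, rfl, hx, hr, hxu⟩
      by_cases hN2 : ∃ x < n, N2 x
      · rw [h5 hN1 hN2, h3, IsRep.label_eq]
        obtain ⟨x, -, x', rfl, h7, h8, h9⟩ := hN2
        exact ⟨⟨hrel, x', h7.ne', h8, h9⟩, hmin⟩
      · rw [h6 hN1 hN2, eq_comm, ← not_ne_iff, label_ne_zero_iff]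
        rintro ⟨-, x, hx, hrx, hxu⟩
        rcases lt_or_gt_of_ne hx with h | h
        · exact hmin x h hrx hxu
        · exact hN2 ⟨x, x.2, x, rfl, h, hrx, hxu⟩
    · refine ⟨hs1a.trans (agree_setVar _ _ (by simp)), fun k hk => ?_, by simp, by simp, ?_⟩
      · rw [setVar_natArr, h1, if_neg hk]
      · intro _ _
        rw [setVar_natArr, h1, if_pos rfl]
    · rintro i τ hi h23 ⟨hτ, hold, g1, g2, g3⟩
      rw [show s1.natVar 0 = n from hn] at hi
      have e0 := (hτ.1 0 (by simp)).trans hn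
      have e22 := (hτ.1 22 (by simp)).trans hu
      have e3 := hτ.1 3 (by simp)
      have e8 := hτ.2.1 8 (by simp)
      have hfin := finite_ix_holds (a := 6) e0 (u := ⟨i, hi⟩) h23 e22
      rw [hτ.tab_eq (by simp), hδ.ne_top_iff] at hfin
      have hr8 : (finite 8 (.var 23)).Holds τ ↔ rel ⟨i, hi⟩ := by
        rw [← h8]
        simp only [finite, Test.Holds, NatExpr.eval, e8, h23, ne_eq]
      have hN1 : N1 i ↔ i < u ∧ rel ⟨i, hi⟩ ∧ G.negEdges.Reachable ⟨i, hi⟩ u := by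
        constructor
        · rintro ⟨x, rfl, h⟩; exact h
        · intro h; exact ⟨⟨i, hi⟩, rfl, h⟩
      have hN2 : N2 i ↔ (u : ℕ) < i ∧ rel ⟨i, hi⟩ ∧ G.negEdges.Reachable ⟨i, hi⟩ u := by
        constructor
        · rintro ⟨x, rfl, h⟩; exact h
        · intro h; exact ⟨⟨i, hi⟩, rfl, h⟩
      have hb1 : (Test.and (.and (finite 8 (.var 23)) (finite 6 (ix 23 22)))
          (.natLt (.var 23) (.var 22))).Holds τ ↔ N1 i := by
        rw [and_holds, and_holds, hr8, hfin, hN1]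
        simp only [Test.Holds, NatExpr.eval, h23, e22]
        exact ⟨fun ⟨⟨a, b⟩, c⟩ => ⟨c, a, b⟩, fun ⟨c, a, b⟩ => ⟨⟨a, b⟩, c⟩⟩
      have hb2 : (Test.and (.and (finite 8 (.var 23)) (finite 6 (ix 23 22)))
          (.and (.natLt (.var 22) (.var 23)) (.natEq (.get 9 (.var 22)) (.lit 0)))).Holds τ ↔
          N2 i ∧ τ.natArr 9 u = 0 := by
        rw [and_holds, and_holds, hr8, hfin, hN2]
        simp only [Test.Holds, NatExpr.eval, h23, e22]
        exact ⟨fun ⟨⟨a, b⟩, c, d⟩ => ⟨⟨c, a, b⟩, d⟩, fun ⟨⟨c, a, b⟩, d⟩ => ⟨⟨a, b⟩, c, d⟩⟩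
      have hset : ∀ (e : NatExpr) k, ((ForProg.setA 9 (.var 22) e).run τ).natArr 9 k =
          if k = u then e.eval τ else τ.natArr 9 k := by
        intro e k
        simp only [run, updateArr_apply, NatExpr.eval, e22]
      refine ⟨(hτ.trans ((labelStep.agree_run τ).mono (by simp [labelStep, vars])
        (by simp [labelStep, arrs]))).trans (agree_setVar _ _ (by simp)), ?_⟩
      rw [setVar_natArr, hsucc N1, hsucc N2, labelStep, run]
      simp only [hb1]
      by_cases hn1 : N1 i
      · rw [if_pos hn1]
        refine ⟨fun k hk => by rw [hset, if_neg hk, hold k hk], fun _ => ?_, fun h => ?_, fun h => ?_⟩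
        · rw [hset, if_pos rfl, NatExpr.eval, NatExpr.eval, h23]
          rw [hN1] at hn1
          have := hold i hn1.1.ne
          rw [this]
          exact (h9 ⟨i, hi⟩ hn1.1).trans (label_eq_of_reachable hn1.2.1 hrel hn1.2.2)
        · exact absurd (.inr hn1) h
        · exact absurd (.inr hn1) h
      · rw [if_neg hn1, run]
        simp only [hb2, hn1, or_false]
        by_cases hn2 : N2 i ∧ τ.natArr 9 u = 0
        · rw [if_pos hn2]
          refine ⟨fun k hk => by rw [hset, if_neg hk, hold k hk], fun h => ?_, fun _ _ => ?_,
            fun _ h => absurd (.inr hn2.1) h⟩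
          · exact absurd ((g1 h).symm.trans hn2.2) (hpos i h)
          · rw [hset, if_pos rfl, NatExpr.eval, e3]
        · rw [if_neg hn2]
          refine ⟨hold, g1, fun h h' => ?_, fun h h' => g3 h fun h'' => h' (.inl h'')⟩
          by_cases h'' : ∃ x < i, N2 x
          · exact g2 h h''
          · exact absurd ⟨h'.resolve_left h'', g3 h h''⟩ hn2
  · rw [if_neg hrel]
    refine ⟨fun k hk => by rw [h1, if_neg hk], ?_⟩
    rw [h1, if_pos rfl, eq_comm, ← not_ne_iff, label_ne_zero_iff]
    exact fun h => hrel h.1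

/-- The state of the computation of labels after `m` rounds. -/
def LabelInv (G : MixedGraph (Fin n)) (rel : Fin n → Prop) (s : State) (m : ℕ) (σ : State) : Prop :=
  Agree [3, 22, 23] [9] s σ ∧ σ.natVar 3 = 2 ^ (G.repsBelow rel m).card ∧
    ∀ u : Fin n, (u : ℕ) < m → σ.natArr 9 u = G.label rel u

theorem labelInv_init (G : MixedGraph (Fin n)) (rel : Fin n → Prop) (s : State) :
    LabelInv G rel s 0 (((ForProg.setN 3 (.lit 1)).run s).setVar 22 0) := by
  refine ⟨(agree_setVar s _ (by simp)).trans (agree_setVar _ _ (by simp)), ?_, by simp⟩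
  rw [setVar_natVar_of_ne _ _ (by simp)]
  simp [run, NatExpr.eval, repsBelow]

theorem LabelInv.row {rel : Fin n → Prop} (hn : s.natVar 0 = n)
    (h8 : ∀ x : Fin n, s.natArr 8 x ≠ 0 ↔ rel x) (hδ : G.IsTreeTable (s.tab n 6)) {u : Fin n}
    (h : LabelInv G rel s u σ) (hu : σ.natVar 22 = u) :
    Agree [3, 22, 23] [9] s (labelRow.run σ) ∧
      (labelRow.run σ).natVar 3 = 2 ^ (G.repsBelow rel u).card ∧
      (labelRow.run σ).natVar 22 = u ∧
      ∀ x : Fin n, (x : ℕ) < u + 1 → (labelRow.run σ).natArr 9 x = G.label rel x := by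
  obtain ⟨h1, h2, h3⟩ := h
  obtain ⟨h4, h5, h6⟩ := run_labelRow (G := G) (rel := rel) (s := σ) ((h1.1 0 (by simp)).trans hn)
    (by rw [h1.2.1 8 (by simp)]; exact h8) (by rw [h1.tab_eq (by simp)]; exact hδ) hu h2
    (fun x hx => h3 x hx)
  refine ⟨h1.trans (h4.mono (by simp) (by simp)), (h4.1 3 (by simp)).trans h2,
    (h4.1 22 (by simp)).trans hu, fun x hx => ?_⟩
  rcases Nat.lt_succ_iff_lt_or_eq.1 hx with hx | hx
  · rw [h5 x hx.ne]; exact h3 x hx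
  · obtain rfl := Fin.ext hx
    exact h6

theorem label_test {rel : Fin n → Prop} {u : Fin n} {τ : State}
    (h3 : τ.natVar 3 = 2 ^ (G.repsBelow rel u).card) (h22 : τ.natVar 22 = u)
    (h9 : τ.natArr 9 u = G.label rel u) :
    (Test.natEq (.get 9 (.var 22)) (.var 3)).Holds τ ↔ G.IsRep rel u := by
  simp only [Test.Holds, NatExpr.eval, h22, h9, h3]
  by_cases h : G.IsRep rel u
  · simp [h, h.label_eq]
  · simp [h, label_ne_of_not_isRep h]

theorem LabelInv.step {rel : Fin n → Prop} (hn : s.natVar 0 = n)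
    (h8 : ∀ x : Fin n, s.natArr 8 x ≠ 0 ↔ rel x) (hδ : G.IsTreeTable (s.tab n 6)) {i : ℕ}
    (hi : i < n) (h : LabelInv G rel s i σ) (hu : σ.natVar 22 = i) :
    LabelInv G rel s (i + 1) (((ForProg.seq labelRow (.ite (.natEq (.get 9 (.var 22)) (.var 3))
      (.setB 3 (.add (.var 3) (.var 3))) .skip)).run σ).setVar 22 (i + 1)) := by
  obtain ⟨h1, h2, h3, h4⟩ := LabelInv.row (u := ⟨i, hi⟩) hn h8 hδ h hu
  set τ := labelRow.run σ with hτ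
  have ht := label_test h2 h3 (h4 ⟨i, hi⟩ (by simp))
  have hcard := card_repsBelow_succ (G := G) (rel := rel) ⟨i, hi⟩
  dsimp only at hcard h2 h4
  have hrun : (ForProg.seq labelRow (.ite (.natEq (.get 9 (.var 22)) (.var 3))
      (.setB 3 (.add (.var 3) (.var 3))) .skip)).run σ =
      (ForProg.ite (.natEq (.get 9 (.var 22)) (.var 3))
      (.setB 3 (.add (.var 3) (.var 3))) .skip).run τ := rfl
  rw [hrun, run]
  by_cases hrep : G.IsRep rel ⟨i, hi⟩
  · rw [if_pos hrep] at hcard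
    rw [if_pos (ht.2 hrep)]
    refine ⟨(h1.trans (agree_setVar _ _ (by simp))).trans (agree_setVar _ _ (by simp)), ?_, h4⟩
    rw [setVar_natVar_of_ne _ _ (by simp), hcard, pow_succ]
    simp only [run, setVar_natVar_self, NatExpr.eval, h2]
    ring
  · rw [if_neg hrep] at hcard
    rw [if_neg (mt ht.1 hrep)]
    refine ⟨h1.trans (agree_setVar _ _ (by simp)), ?_, h4⟩
    rw [setVar_natVar_of_ne _ _ (by simp), hcard, add_zero]
    exact h2

theorem run_labelProg {rel : Fin n → Prop} (hn : s.natVar 0 = n)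
    (h8 : ∀ x : Fin n, s.natArr 8 x ≠ 0 ↔ rel x) (hδ : G.IsTreeTable (s.tab n 6)) :
    LabelInv G rel s n (labelProg.run s) := by
  have h0 : ((ForProg.setN 3 (.lit 1)).run s).natVar 0 = n := by
    rw [run, setVar_natVar_of_ne _ _ (by simp), hn]
  have := run_for (s := (ForProg.setN 3 (.lit 1)).run s) (x := 22) (y := 0) (LabelInv G rel s)
    (labelInv_init G rel s) (fun i σ hi h22 h => LabelInv.step hn h8 hδ (h0 ▸ hi) h h22)
  rwa [h0] at this

/-- The counter is doubled only at representatives, so it never exceeds two to their number. Here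
the bound on negative trees enters the word size and, as the counter later limits the loop over sets
of trees, the running time. -/
theorem safe_labelProg {rel : Fin n → Prop} (hn : s.natVar 0 = n)
    (h8 : ∀ x : Fin n, s.natArr 8 x ≠ 0 ↔ rel x) (hδ : G.IsTreeTable (s.tab n 6)) {k m : ℕ}
    (hk : (G.repsBelow rel n).card ≤ k) {cv : ℕ → Bd} (hcv : cv 3 = ⟨1, 1, 0⟩) :
    labelProg.Safe cv (2 ^ k) m s := by
  have h0 : ((ForProg.setN 3 (.lit 1)).run s).natVar 0 = n := by
    rw [run, setVar_natVar_of_ne _ _ (by simp), hn]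
  refine ⟨trivial, fun i hi => ?_⟩
  have hinv := iter_for (s := (ForProg.setN 3 (.lit 1)).run s) (x := 22) (y := 0)
    (LabelInv G rel s) (labelInv_init G rel s)
    (fun i σ hi h22 h => LabelInv.step hn h8 hδ (h0 ▸ hi) h h22) i hi.le
  have h22 := iter_natVar (.seq labelRow (.ite (.natEq (.get 9 (.var 22)) (.var 3))
      (.setB 3 (.add (.var 3) (.var 3))) .skip)) (x := 22) ((ForProg.setN 3 (.lit 1)).run s) i
  rw [h0] at hi
  obtain ⟨h1, h2, h3, h4⟩ := LabelInv.row (u := ⟨i, hi⟩) hn h8 hδ hinv h22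
  refine ⟨safe_of_static cv rfl _, fun hb => ?_, fun _ => trivial⟩
  rw [label_test h2 h3 (h4 ⟨i, hi⟩ (by simp))] at hb
  have hcard := card_repsBelow_succ (G := G) (rel := rel) ⟨i, hi⟩
  rw [if_pos hb] at hcard
  have hle := (card_repsBelow_le (G := G) (rel := rel) (m := i + 1)).trans hk
  dsimp only at hcard h2
  rw [Safe, hcv]
  simp only [NatExpr.eval, Bd.val, one_mul, pow_one, pow_zero, mul_one, h2]
  calc _ = 2 ^ ((G.repsBelow rel i).card + 1) := by ring
    _ ≤ 2 ^ k := Nat.pow_le_pow_right (by norm_num) (hcard ▸ hle)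

end ForProg

end RAM

/-! ## Dynamic programming over sets of trees -/

namespace RAM

open MixedGraph

variable {n : ℕ} {G : MixedGraph (Fin n)} {s σ : State} {X A : List ℕ}
  {L δ : Fin n → Fin n → WithTop ℝ} {pw : Fin n → ℕ} {a b : Fin n}

/-- The data needed to treat the pair of vertices in variables `20` and `21`. -/
structure HoldsPair (L δ : Fin n → Fin n → WithTop ℝ) (pw : Fin n → ℕ) (a b : Fin n)
    (s : State) : Prop where
  size : s.natVar 0 = n
  src : s.natVar 20 = a
  tgt : s.natVar 21 = b
  links : s.tab n 5 = L
  trees : s.tab n 6 = δ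
  labels : ∀ x : Fin n, s.natArr 9 x = pw x

theorem HoldsPair.of_agree (h : HoldsPair L δ pw a b s) (hs : Agree X A s σ) (h0 : 0 ∉ X)
    (h20 : 20 ∉ X) (h21 : 21 ∉ X) (h5 : 5 ∉ A) (h6 : 6 ∉ A) (h9 : 9 ∉ A) :
    HoldsPair L δ pw a b σ where
  size := (hs.1 0 h0).trans h.size
  src := (hs.1 20 h20).trans h.src
  tgt := (hs.1 21 h21).trans h.tgt
  links := (hs.tab_eq h5 n).trans h.links
  trees := (hs.tab_eq h6 n).trans h.trees
  labels := by rw [hs.2.1 9 h9]; exact h.labels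

namespace ForProg

/-- Clear the rows of tables `10` and `11` for the set of trees in variable `25`. -/
def clearRow : ForProg :=
  .for_ 26 0 (.seq (.setA 10 (ix 25 26) (.lit 0)) (.setA 11 (ix 25 26) (.lit 0)))

/-- The two tables still contain the rows of the previous pair, so a row is cleared before it is
computed; the rows of smaller sets have to survive. -/
theorem run_clearRow {S : ℕ} (hn : s.natVar 0 = n) (hS : s.natVar 25 = S) :
    Agree [26] [10, 11] s (clearRow.run s) ∧
    (∀ k < S * n, (clearRow.run s).val 10 k = s.val 10 k ∧
      (clearRow.run s).val 11 k = s.val 11 k) ∧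
    ∀ v < n, (clearRow.run s).val 10 (S * n + v) = ⊤ ∧ (clearRow.run s).val 11 (S * n + v) = ⊤ := by
  have hag := (clearRow.agree_run s).mono (X' := [26]) (A' := [10, 11]) (by simp [clearRow, vars])
    (by simp [clearRow, arrs])
  have := run_for (s := s) (x := 26) (y := 0)
    (p := .seq (.setA 10 (ix 25 26) (.lit 0)) (.setA 11 (ix 25 26) (.lit 0)))
    (fun m σ => Agree [26] [10, 11] s σ ∧ σ.realArr = s.realArr ∧
      (∀ k < S * n, σ.natArr 10 k = s.natArr 10 k ∧ σ.natArr 11 k = s.natArr 11 k) ∧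
      ∀ v < m, σ.natArr 10 (S * n + v) = 0 ∧ σ.natArr 11 (S * n + v) = 0) ?_ ?_
  · rw [hn] at this
    obtain ⟨-, h1, h2, h3⟩ := this
    change ((clearRow.run s).realArr = _) at h1
    refine ⟨hag, fun k hk => ?_, fun v hv => ?_⟩
    · have := h2 k hk
      change (clearRow.run s).natArr 10 k = _ ∧ (clearRow.run s).natArr 11 k = _ at this
      simp [State.val, this, h1]
    · have := h3 v hv
      change (clearRow.run s).natArr 10 _ = _ ∧ (clearRow.run s).natArr 11 _ = _ at this
      simp [State.val, this]
  · exact ⟨agree_setVar _ _ (by simp), rfl, fun k _ => ⟨rfl, rfl⟩, by simp⟩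
  · rintro i σ hi h26 ⟨hσ, hre, h1, h2⟩
    have e0 := (hσ.1 0 (by simp)).trans hn
    have e25 := (hσ.1 25 (by simp)).trans hS
    have e : (ix 25 26).eval σ = S * n + i := by rw [eval_ix e0, h26, e25]
    set τ := (ForProg.setA 10 (ix 25 26) (.lit 0)).run σ with hτ
    have e' : (ix 25 26).eval τ = S * n + i := e
    have e10 : ∀ k, ((ForProg.setA 11 (ix 25 26) (.lit 0)).run τ).natArr 10 k =
        if k = S * n + i then 0 else σ.natArr 10 k := by
      intro k
      simp only [run, updateArr_of_ne _ _ _ (show 10 ≠ 11 by simp), hτ, updateArr_apply, e,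
        NatExpr.eval]
    have e11 : ∀ k, ((ForProg.setA 11 (ix 25 26) (.lit 0)).run τ).natArr 11 k =
        if k = S * n + i then 0 else σ.natArr 11 k := by
      intro k
      simp only [run, updateArr_apply, e', NatExpr.eval]
      simp only [hτ, run, updateArr_of_ne _ _ _ (show 11 ≠ 10 by simp)]
    have hrun : (ForProg.seq (.setA 10 (ix 25 26) (.lit 0)) (.setA 11 (ix 25 26) (.lit 0))).run σ =
        (ForProg.setA 11 (ix 25 26) (.lit 0)).run τ := rfl
    refine ⟨(hσ.trans ((agree_run _ σ).mono (by simp [vars]) (by simp [arrs]))).trans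
      (agree_setVar _ _ (by simp)), hre, fun k hk => ?_, fun v hv => ?_⟩
    · rw [setVar_natArr, hrun, e10, e11, if_neg (by omega), if_neg (by omega)]
      exact h1 k hk
    · rw [setVar_natArr, hrun, e10, e11]
      rcases Nat.lt_succ_iff_lt_or_eq.1 hv with hv | rfl
      · rw [if_neg (by omega), if_neg (by omega)]
        exact h2 v hv
      · simp

/-- The test whether the walks for the set of trees in variable `25` may end with a path through the
tree of the vertices in variables `23` and `26`. -/
def treeTest : Test :=
  .and (.not (.natEq (.get 9 (.var 23)) (.lit 0)))
    (.and (.natEq (.get 9 (.var 23)) (.get 9 (.var 26)))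
    (.and (.natEq (.sub (.div (.var 25) (.get 9 (.var 23)))
      (.mul (.div (.div (.var 25) (.get 9 (.var 23))) (.lit 2)) (.lit 2))) (.lit 1))
    (.and (finite 10 (.add (.mul (.sub (.var 25) (.get 9 (.var 23))) (.var 0)) (.var 23)))
      (finite 6 (ix 23 26)))))

/-- The weight of the walks that `treeTest` allows. -/
def treeValue : RealExpr :=
  .sub (.get 10 (.add (.mul (.sub (.var 25) (.get 9 (.var 23))) (.var 0)) (.var 23)))
    (.get 6 (ix 23 26))

/-- Extend walks by paths through trees. -/
def treeRow : ForProg := .for_ 23 0 (.for_ 26 0 (relaxAll 11 (ix 25 26) [(treeTest, treeValue)]))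

/-- Extend walks by links that are not negative. -/
def linkRow : ForProg := .for_ 26 0 (.for_ 27 0 (relaxAll 10 (ix 25 27)
  [(.and (finite 11 (ix 25 26)) (finite 5 (ix 26 27)),
    .add (.get 11 (ix 25 26)) (.get 5 (ix 26 27))),
   (.and (.natEq (.var 25) (.lit 0)) (.and (.natEq (.var 26) (.var 20)) (finite 5 (ix 26 27))),
    .get 5 (ix 26 27))]))

/-- Treat the set of trees in variable `25`. -/
def dpRound : ForProg :=
  .seq clearRow (.seq treeRow (.seq linkRow
    (relaxAll 7 (ix 20 21) [(finite 10 (ix 25 21), .get 10 (ix 25 21))])))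

theorem treeTest_holds (h : HoldsPair L δ pw a b s) {S : ℕ} (hS : s.natVar 25 = S) {x y : Fin n}
    (hx : s.natVar 23 = x) (hy : s.natVar 26 = y) :
    treeTest.Holds s ↔ pw x ≠ 0 ∧ pw x = pw y ∧ S / pw x % 2 = 1 ∧
      s.val 10 ((S - pw x) * n + x) ≠ ⊤ ∧ δ x y ≠ ⊤ := by
  rw [treeTest, and_holds, and_holds, and_holds, and_holds, finite_ix_holds h.size hx hy, h.trees,
    finite_holds]
  simp only [Test.Holds, NatExpr.eval, hx, hy, h.labels, hS, h.size]
  refine and_congr_right fun _ => and_congr_right fun _ => and_congr ?_ Iff.rfl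
  -- For the quotient q, the test computes q - q / 2 * 2, which is the remainder of q modulo 2.
  omega

theorem treeValue_eval (h : HoldsPair L δ pw a b s) {S : ℕ} (hS : s.natVar 25 = S) {x y : Fin n}
    (hx : s.natVar 23 = x) (hy : s.natVar 26 = y) {c d : ℝ}
    (hc : s.val 10 ((S - pw x) * n + x) = c) (hd : δ x y = d) : treeValue.eval s = c - d := by
  rw [← h.trees] at hd
  have h1 : s.natArr 10 ((S - pw x) * n + x) ≠ 0 := val_ne_top_iff.1 (hc ▸ WithTop.coe_ne_top)
  have h2 : s.natArr 6 (x * n + y) ≠ 0 := val_ne_top_iff.1 (by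
    change s.val 6 (x * n + y) = d at hd; rw [hd]; exact WithTop.coe_ne_top)
  rw [val_of_ne h1, WithTop.coe_eq_coe] at hc
  change s.val 6 (x * n + y) = d at hd
  rw [val_of_ne h2, WithTop.coe_eq_coe] at hd
  simp only [treeValue, RealExpr.eval, eval_ix h.size, NatExpr.eval, hx, hy, h.labels, hS, h.size,
    hc, hd]

/-- Only entries of table 10 for the smaller set `S - pw x` are read, and these are final when the
sets are treated in increasing order. -/
theorem run_treeRow (hac : G.negEdges.IsAcyclic) (hδ : G.IsTreeTable δ) {rel : Fin n → Prop}
    {k : ℕ} (hpw : G.IsTreeLabelling rel k pw) (h : HoldsPair L δ pw a b s) {S : ℕ}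
    (hS : s.natVar 25 = S)
    (hA : ∀ S' < S, ∀ (v : Fin n) (c : ℝ), s.val 10 (S' * n + v) = c → G.TreeWalk pw a S' v c)
    (hclear : ∀ v < n, s.val 11 (S * n + v) = ⊤) :
    Agree [23, 26] [11] s (treeRow.run s) ∧
    (∀ k < S * n, (treeRow.run s).val 11 k = s.val 11 k) ∧
    (∀ (y : Fin n) (c : ℝ), (treeRow.run s).val 11 (S * n + y) = c → G.TreeWalk pw a S y c) ∧
    ∀ (x y : Fin n) (c d : ℝ), pw x ≠ 0 → pw x = pw y → S / pw x % 2 = 1 →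
      s.val 10 ((S - pw x) * n + x) ≤ c → δ x y = d →
      (treeRow.run s).val 11 (S * n + y) ≤ ((c - d : ℝ) : WithTop ℝ) := by
  have hlt : ∀ x : Fin n, pw x ≠ 0 → S / pw x % 2 = 1 → S - pw x < S := by
    intro x h0 h1
    have : pw x ≤ S := by
      by_contra hlt
      rw [Nat.div_eq_of_lt (not_le.1 hlt)] at h1
      simp at h1
    omega
  -- Besides soundness of the current row, the property pins finite entries of earlier rows to their
  -- old values; as entries are only lowered, this shows that the earlier rows do not change.
  let P : ℕ → ℝ → Prop := fun k c => (k < S * n → s.val 11 k = c) ∧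
    ∀ y : Fin n, k = S * n + y → G.TreeWalk pw a S y c
  have h1 := run_for2_relaxAll (X := [23, 26]) (a := 11) (s := s) (n := n) (x := 23) (y := 26)
    (P := P) (i := ix 25 26) (qs := [(treeTest, treeValue)]) (fun _ v => S * n + v)
    (fun x y e => ∀ x' y' : Fin n, x = x' → y = y' → ∃ c d : ℝ, pw x' ≠ 0 ∧ pw x' = pw y' ∧
      S / pw x' % 2 = 1 ∧ s.val 10 ((S - pw x') * n + x') = c ∧ δ x' y' = d ∧ e = c - d)
    (by simp) (by simp) (by simp) (by simp) h.size ?_ ?_ ?_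
  · obtain ⟨⟨h1, h2, h3⟩, h4⟩ := h1
    refine ⟨h1, fun k hk => le_antisymm (h2 k) ?_, fun y c hc => ?_, ?_⟩
    · change s.val 11 k ≤ (treeRow.run s).val 11 k
      by_cases htop : (treeRow.run s).val 11 k = ⊤
      · rw [htop]; exact le_top
      · obtain ⟨c, hc⟩ := WithTop.ne_top_iff_exists.1 htop
        rw [← hc]
        refine ((h3 ?_ k c hc.symm).1 hk).le
        intro k' c' hc'
        refine ⟨fun _ => hc', ?_⟩
        rintro y rfl
        rw [hclear y y.2] at hc'
        exact absurd hc' WithTop.top_ne_coe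
    · refine (h3 ?_ _ c hc).2 y rfl
      intro k' c' hc'
      refine ⟨fun _ => hc', ?_⟩
      rintro y rfl
      rw [hclear y y.2] at hc'
      exact absurd hc' WithTop.top_ne_coe
    · intro x y c d hx hxy hbit hc hd
      obtain ⟨c', hc'⟩ := WithTop.ne_top_iff_exists.1 (ne_top_of_le_ne_top WithTop.coe_ne_top hc)
      rw [← hc', WithTop.coe_le_coe] at hc
      refine (h4 x x.2 y y.2 (c' - d) ?_).trans (WithTop.coe_le_coe.2 (by linarith))
      intro x' y' hx' hy'
      rw [← Fin.ext hx', ← Fin.ext hy']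
      exact ⟨c', d, hx, hxy, hbit, hc'.symm, hd, rfl⟩
  · intro τ hτ
    rw [eval_ix ((hτ.1.1 0 (by simp)).trans h.size), hτ.1.1 25 (by simp), hS]
  · intro x y τ hx hy h23 h26 hτ q hq hh
    obtain rfl := List.mem_singleton.1 hq
    have hp := h.of_agree hτ.1 (by simp) (by simp) (by simp) (by simp) (by simp) (by simp)
    have e25 := (hτ.1.1 25 (by simp)).trans hS
    rw [treeTest_holds hp e25 (x := ⟨x, hx⟩) (y := ⟨y, hy⟩) h23 h26] at hh
    obtain ⟨hx0, hxy, hbit, hf1, hf2⟩ := hh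
    obtain ⟨c, hc⟩ := WithTop.ne_top_iff_exists.1 hf1
    obtain ⟨d, hd⟩ := WithTop.ne_top_iff_exists.1 hf2
    dsimp only
    rw [treeValue_eval hp e25 (x := ⟨x, hx⟩) (y := ⟨y, hy⟩) h23 h26 hc.symm hd.symm]
    refine ⟨fun h => absurd h (by omega), fun y' hy' => ?_⟩
    obtain rfl : (⟨y, hy⟩ : Fin n) = y' := Fin.ext (by simpa using hy')
    rw [hτ.1.val_eq (by simp)] at hc
    exact (hA _ (hlt _ hx0 hbit) _ c hc.symm).append_tree hac hδ hpw hx0 hbit hd.symm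
  · intro x y e hx hy hC
    obtain ⟨c, d, hx0, hxy, hbit, hc, hd, rfl⟩ := hC ⟨x, hx⟩ ⟨y, hy⟩ rfl rfl
    refine ⟨_, List.mem_singleton_self _, fun τ h23 h26 hτ => ?_⟩
    have hp := h.of_agree hτ.1 (by simp) (by simp) (by simp) (by simp) (by simp) (by simp)
    have e25 := (hτ.1.1 25 (by simp)).trans hS
    rw [← hτ.1.val_eq (show 10 ∉ [11] by simp)] at hc
    refine ⟨(treeTest_holds hp e25 (x := ⟨x, hx⟩) (y := ⟨y, hy⟩) h23 h26).2
      ⟨hx0, hxy, hbit, hc ▸ WithTop.coe_ne_top, hd ▸ WithTop.coe_ne_top⟩, ?_⟩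
    exact (treeValue_eval hp e25 (x := ⟨x, hx⟩) (y := ⟨y, hy⟩) h23 h26 hc hd).le

/-- For the empty set of trees there is no tree path to start from; there the row is filled with the
walks without negative edges from a itself. -/
theorem run_linkRow (hL : G.IsNonnegTable L) (h : HoldsPair L δ pw a b s) {S : ℕ}
    (hS : s.natVar 25 = S)
    (hB : ∀ (v : Fin n) (c : ℝ), s.val 11 (S * n + v) = c → G.TreeWalk pw a S v c)
    (hclear : ∀ v < n, s.val 10 (S * n + v) = ⊤) :
    Agree [26, 27] [10] s (linkRow.run s) ∧
    (∀ k < S * n, (linkRow.run s).val 10 k = s.val 10 k) ∧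
    (∀ (y : Fin n) (c : ℝ), (linkRow.run s).val 10 (S * n + y) = c → G.TreeWalk pw a S y c) ∧
    (∀ y v : Fin n, (linkRow.run s).val 10 (S * n + v) ≤ s.val 11 (S * n + y) + L y v) ∧
    (S = 0 → ∀ v : Fin n, (linkRow.run s).val 10 (S * n + v) ≤ L a v) := by
  let P : ℕ → ℝ → Prop := fun k c => (k < S * n → s.val 10 k = c) ∧
    ∀ y : Fin n, k = S * n + y → G.TreeWalk pw a S y c
  have h1 := run_for2_relaxAll (X := [26, 27]) (a := 10) (s := s) (n := n) (x := 26) (y := 27)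
    (P := P) (i := ix 25 27)
    (qs := [(.and (finite 11 (ix 25 26)) (finite 5 (ix 26 27)),
      .add (.get 11 (ix 25 26)) (.get 5 (ix 26 27))),
      (.and (.natEq (.var 25) (.lit 0)) (.and (.natEq (.var 26) (.var 20)) (finite 5 (ix 26 27))),
        .get 5 (ix 26 27))]) (fun _ v => S * n + v)
    (fun y v e => ∀ y' v' : Fin n, y = y' → v = v' →
      (∃ c d : ℝ, s.val 11 (S * n + y') = c ∧ L y' v' = d ∧ e = c + d) ∨
      S = 0 ∧ y' = a ∧ L y' v' = e)
    (by simp) (by simp) (by simp) (by simp) h.size ?_ ?_ ?_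
  · obtain ⟨⟨h1, h2, h3⟩, h4⟩ := h1
    have hP : ∀ k (x : ℝ), s.val 10 k = x → P k x := by
      intro k' c' hc'
      refine ⟨fun _ => hc', ?_⟩
      rintro y rfl
      rw [hclear y y.2] at hc'
      exact absurd hc' WithTop.top_ne_coe
    refine ⟨h1, fun k hk => le_antisymm (h2 k) ?_, fun y c hc => (h3 hP _ c hc).2 y rfl, ?_, ?_⟩
    · change s.val 10 k ≤ (linkRow.run s).val 10 k
      by_cases htop : (linkRow.run s).val 10 k = ⊤
      · rw [htop]; exact le_top
      · obtain ⟨c, hc⟩ := WithTop.ne_top_iff_exists.1 htop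
        rw [← hc]
        exact ((h3 hP k c hc.symm).1 hk).le
    · intro y v
      by_cases htop : s.val 11 (S * n + y) + L y v = ⊤
      · rw [htop]; exact le_top
      · obtain ⟨c, hc⟩ := WithTop.ne_top_iff_exists.1 (WithTop.add_ne_top.1 htop).1
        obtain ⟨d, hd⟩ := WithTop.ne_top_iff_exists.1 (WithTop.add_ne_top.1 htop).2
        rw [← hc, ← hd, ← WithTop.coe_add]
        refine h4 y y.2 v v.2 (c + d) fun y' v' hy' hv' => .inl ?_
        rw [← Fin.ext hy', ← Fin.ext hv']
        exact ⟨c, d, hc.symm, hd.symm, rfl⟩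
    · intro hS0 v
      by_cases htop : L a v = ⊤
      · rw [htop]; exact le_top
      · obtain ⟨d, hd⟩ := WithTop.ne_top_iff_exists.1 htop
        rw [← hd]
        refine h4 a a.2 v v.2 d fun y' v' hy' hv' => .inr ?_
        rw [← Fin.ext hy', ← Fin.ext hv']
        exact ⟨hS0, rfl, hd.symm⟩
  · intro τ hτ
    rw [eval_ix ((hτ.1.1 0 (by simp)).trans h.size), hτ.1.1 25 (by simp), hS]
  · intro y v τ hy hv h26 h27 hτ q hq hh
    have hp := h.of_agree hτ.1 (by simp) (by simp) (by simp) (by simp) (by simp) (by simp)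
    have e25 := (hτ.1.1 25 (by simp)).trans hS
    have e11 : ((finite 11 (ix 25 26)).Holds τ ↔ s.val 11 (S * n + y) ≠ ⊤) := by
      rw [finite_holds, eval_ix hp.size, e25, h26, hτ.1.val_eq (by simp)]
    have e5 := finite_ix_holds hp.size (a := 5) (u := ⟨y, hy⟩) (v := ⟨v, hv⟩) h26 h27
    have c5 := coe_realArr hp.size (a := 5) (u := ⟨y, hy⟩) (v := ⟨v, hv⟩) h26 h27
    rw [hp.links] at e5 c5
    simp only [List.mem_cons, List.not_mem_nil, or_false] at hq
    refine ⟨fun h => absurd h (by omega), fun v' hv' => ?_⟩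
    obtain rfl : (⟨v, hv⟩ : Fin n) = v' := Fin.ext (by simpa using hv')
    rcases hq with rfl | rfl
    · rw [and_holds, e11, e5] at hh
      obtain ⟨c, hc⟩ := WithTop.ne_top_iff_exists.1 hh.1
      have hce : (RealExpr.get 11 (ix 25 26)).eval τ = c := by
        have h1 := hh.1
        rw [← hτ.1.val_eq (show 11 ∉ [10] by simp)] at hc h1
        rw [val_of_ne (val_ne_top_iff.1 h1), WithTop.coe_eq_coe] at hc
        rw [RealExpr.eval, eval_ix hp.size, e25, h26, hc]
      have := (hB ⟨y, hy⟩ c hc.symm).append_nonneg hL (c5 hh.2).symm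
      rwa [← hce] at this
    · rw [and_holds, and_holds, e5] at hh
      obtain ⟨hh1, hh2, hh3⟩ := hh
      simp only [Test.Holds, NatExpr.eval, h26, hp.src] at hh2
      obtain rfl : (⟨y, hy⟩ : Fin n) = a := Fin.ext hh2
      have := (treeWalk_nil (G := G) pw ⟨y, hy⟩ S).append_nonneg hL (c5 hh3).symm
      rwa [zero_add] at this
  · intro y v e hy hv hC
    have key : ∀ τ, τ.natVar 26 = y → τ.natVar 27 = v → Lowers [26, 27] 10 P s τ → 
        HoldsPair L δ pw a b τ ∧ τ.natVar 25 = S := fun τ h26 h27 hτ =>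
      ⟨h.of_agree hτ.1 (by simp) (by simp) (by simp) (by simp) (by simp) (by simp),
        (hτ.1.1 25 (by simp)).trans hS⟩
    rcases hC ⟨y, hy⟩ ⟨v, hv⟩ rfl rfl with ⟨c, d, hc, hd, rfl⟩ | ⟨hS0, hya, hd⟩
    · refine ⟨_, List.mem_cons_self .., fun τ h26 h27 hτ => ?_⟩
      obtain ⟨hp, e25⟩ := key τ h26 h27 hτ
      have e5 := finite_ix_holds hp.size (a := 5) (u := ⟨y, hy⟩) (v := ⟨v, hv⟩) h26 h27
      have c5 := coe_realArr hp.size (a := 5) (u := ⟨y, hy⟩) (v := ⟨v, hv⟩) h26 h27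
      rw [hp.links] at e5 c5
      have e11 : ((finite 11 (ix 25 26)).Holds τ ↔ s.val 11 (S * n + y) ≠ ⊤) := by
        rw [finite_holds, eval_ix hp.size, e25, h26, hτ.1.val_eq (by simp)]
      have hLne : L ⟨y, hy⟩ ⟨v, hv⟩ ≠ ⊤ := hd ▸ WithTop.coe_ne_top
      have hcne : s.val 11 (S * n + y) ≠ ⊤ := by
        change s.val 11 (S * n + y) = c at hc
        rw [hc]; exact WithTop.coe_ne_top
      refine ⟨⟨e11.2 hcne, e5.2 hLne⟩, ?_⟩
      have h5 := c5 hLne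
      rw [hd, WithTop.coe_eq_coe] at h5
      change s.val 11 (S * n + y) = c at hc
      rw [← hτ.1.val_eq (show 11 ∉ [10] by simp)] at hc hcne
      rw [val_of_ne (val_ne_top_iff.1 hcne), WithTop.coe_eq_coe] at hc
      have h11 : (RealExpr.get 11 (ix 25 26)).eval τ = c := by
        rw [RealExpr.eval, eval_ix hp.size, e25, h26, hc]
      exact (congrArg₂ (· + ·) h11 h5).le
    · refine ⟨_, List.mem_cons_of_mem _ (List.mem_cons_self ..), fun τ h26 h27 hτ => ?_⟩
      obtain ⟨hp, e25⟩ := key τ h26 h27 hτ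
      have e5 := finite_ix_holds hp.size (a := 5) (u := ⟨y, hy⟩) (v := ⟨v, hv⟩) h26 h27
      have c5 := coe_realArr hp.size (a := 5) (u := ⟨y, hy⟩) (v := ⟨v, hv⟩) h26 h27
      rw [hp.links] at e5 c5
      have hLne : L ⟨y, hy⟩ ⟨v, hv⟩ ≠ ⊤ := hd ▸ WithTop.coe_ne_top
      have h5 := c5 hLne
      rw [hd, WithTop.coe_eq_coe] at h5
      refine ⟨⟨?_, ?_, e5.2 hLne⟩, h5.le⟩
      · simp only [Test.Holds, NatExpr.eval, e25, hS0]
      · simp only [Test.Holds, NatExpr.eval, h26, hp.src, ← hya]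

end ForProg

end RAM

/-! ### Correctness of the dynamic programming, and distances of pairs that no vertex separates -/

namespace RAM

open MixedGraph

variable {n : ℕ} {G : MixedGraph (Fin n)} {s σ τ : State} {X A : List ℕ}
  {L δ : Fin n → Fin n → WithTop ℝ} {pw : Fin n → ℕ} {a b : Fin n} {P : ℕ → ℝ → Prop}

namespace ForProg

/-- The rows of tables `10` and `11` for the set `S` of trees are correct. -/
structure RowCorrect (G : MixedGraph (Fin n)) (L δ : Fin n → Fin n → WithTop ℝ) (pw : Fin n → ℕ)
    (a b : Fin n) (s : State) (S : ℕ) : Prop where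
  sound : ∀ (v : Fin n) (c : ℝ), s.val 10 (S * n + v) = c → G.TreeWalk pw a S v c
  base : S = 0 → ∀ v : Fin n, s.val 10 (S * n + v) ≤ L a v
  tree : ∀ (x y : Fin n) (c d : ℝ), pw x ≠ 0 → pw x = pw y → S / pw x % 2 = 1 →
    s.val 10 ((S - pw x) * n + x) ≤ c → δ x y = d →
    s.val 11 (S * n + y) ≤ ((c - d : ℝ) : WithTop ℝ)
  link : ∀ y v : Fin n, s.val 10 (S * n + v) ≤ s.val 11 (S * n + y) + L y v
  out : s.val 7 (a * n + b) ≤ s.val 10 (S * n + b)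

/-- The claims about row S involve only rows up to S and an upper bound for the result, so later
rounds, which leave these rows alone and only lower the result, preserve them. -/
theorem RowCorrect.of_eq {S : ℕ} (h : RowCorrect G L δ pw a b s S)
    (h' : ∀ k < (S + 1) * n, σ.val 10 k = s.val 10 k ∧ σ.val 11 k = s.val 11 k)
    (h7 : σ.val 7 (a * n + b) ≤ s.val 7 (a * n + b)) : RowCorrect G L δ pw a b σ S := by
  have hle : ∀ S' ≤ S, ∀ v : Fin n, S' * n + v < (S + 1) * n := by
    intro S' hS' v
    have h1 := Nat.mul_le_mul_right n hS'
    have h2 := v.2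
    rw [Nat.succ_mul]
    omega
  have e10 : ∀ S' ≤ S, ∀ v : Fin n, σ.val 10 (S' * n + v) = s.val 10 (S' * n + v) :=
    fun S' hS' v => (h' _ (hle S' hS' v)).1
  have e11 : ∀ v : Fin n, σ.val 11 (S * n + v) = s.val 11 (S * n + v) :=
    fun v => (h' _ (hle S le_rfl v)).2
  refine ⟨?_, ?_, ?_, ?_, ?_⟩
  · intro v c; rw [e10 S le_rfl]; exact h.sound v c
  · intro h0 v; rw [e10 S le_rfl]; exact h.base h0 v
  · intro x y c d; rw [e10 _ (Nat.sub_le _ _), e11]; exact h.tree x y c d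
  · intro y v; rw [e10 S le_rfl, e11]; exact h.link y v
  · rw [e10 S le_rfl]; exact h7.trans h.out

/-- Apart from the variables in `X` and the arrays in `A`, only table `7` changes: its entries are
lowered, and property `P` of all entries is preserved. -/
def DistRel (X A : List ℕ) (P : ℕ → ℝ → Prop) (s σ : State) : Prop :=
  Agree X (7 :: A) s σ ∧ (∀ k, σ.val 7 k ≤ s.val 7 k) ∧
    ((∀ k x, s.val 7 k = (x : ℝ) → P k x) → ∀ k x, σ.val 7 k = (x : ℝ) → P k x)

theorem DistRel.trans (h : DistRel X A P s σ) (h' : DistRel X A P σ τ) : DistRel X A P s τ :=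
  ⟨h.1.trans h'.1, fun k => (h'.2.1 k).trans (h.2.1 k), fun hs => h'.2.2 (h.2.2 hs)⟩

theorem DistRel.of_agree (h : Agree X A s σ) (h7 : 7 ∉ A) : DistRel X A P s σ := by
  refine ⟨h.mono (by simp) (by simp), ?_, ?_⟩
  · rw [h.val_eq h7]; exact fun _ => le_rfl
  · rw [h.val_eq h7]; exact id

theorem DistRel.mono {X' A' : List ℕ} (h : DistRel X A P s σ) (hX : X ⊆ X') (hA : A ⊆ A') :
    DistRel X' A' P s σ :=
  ⟨h.1.mono hX (List.cons_subset_cons 7 hA), h.2⟩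

theorem Lowers.distRel (h : Lowers X 7 P s σ) : DistRel X A P s σ :=
  ⟨h.1.mono (fun _ h => h) (by simp), h.2⟩

theorem distRel_setVar {x v : ℕ} (hx : x ∈ X) : DistRel X A P s (s.setVar x v) :=
  ⟨agree_setVar s v hx, fun _ => le_rfl, id⟩

theorem run_dpRound (hac : G.negEdges.IsAcyclic) (hL : G.IsNonnegTable L) (hδ : G.IsTreeTable δ)
    {rel : Fin n → Prop} {k : ℕ} (hpw : G.IsTreeLabelling rel k pw) (h : HoldsPair L δ pw a b s)
    {S : ℕ} (hS : s.natVar 25 = S)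
    (hA : ∀ S' < S, ∀ (v : Fin n) (c : ℝ), s.val 10 (S' * n + v) = c → G.TreeWalk pw a S' v c)
    (hP : ∀ S c, G.TreeWalk pw a S b c → P (a * n + b) c) :
    DistRel [23, 26, 27] [10, 11] P s (dpRound.run s) ∧
    (∀ k < S * n, (dpRound.run s).val 10 k = s.val 10 k ∧
      (dpRound.run s).val 11 k = s.val 11 k) ∧
    RowCorrect G L δ pw a b (dpRound.run s) S := by
  obtain ⟨c1, c2, c3⟩ := run_clearRow h.size hS
  set s1 := clearRow.run s with hs1
  have h1 := h.of_agree c1 (by simp) (by simp) (by simp) (by simp) (by simp) (by simp)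
  have hS1 : s1.natVar 25 = S := (c1.1 25 (by simp)).trans hS
  have hpos : ∀ S' < S, ∀ v : Fin n, S' * n + v < S * n := by
    intro S' hS' v
    have h1 := Nat.mul_le_mul_right n (Nat.succ_le_of_lt hS')
    have h2 := v.2
    rw [Nat.succ_mul] at h1
    omega
  obtain ⟨t1, t2, t3, t4⟩ := run_treeRow hac hδ hpw h1 hS1
    (fun S' hS' v c hc => hA S' hS' v c (by rwa [(c2 _ (hpos S' hS' v)).1] at hc))
    (fun v hv => (c3 v hv).2)
  set s2 := treeRow.run s1 with hs2
  have h2 := h1.of_agree t1 (by simp) (by simp) (by simp) (by simp) (by simp) (by simp)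
  have hS2 : s2.natVar 25 = S := (t1.1 25 (by simp)).trans hS1
  have e10 : s2.val 10 = s1.val 10 := t1.val_eq (by simp)
  obtain ⟨l1, l2, l3, l4, l5⟩ := run_linkRow hL h2 hS2 t3
    (fun v hv => by rw [e10]; exact (c3 v hv).1)
  set s3 := linkRow.run s2 with hs3
  have h3 := h2.of_agree l1 (by simp) (by simp) (by simp) (by simp) (by simp) (by simp)
  have hS3 : s3.natVar 25 = S := (l1.1 25 (by simp)).trans hS2
  have e11 : s3.val 11 = s2.val 11 := l1.val_eq (by simp)
  have hr := lowers_relaxAll (X := []) (a := 7) (P := P) (s := s3) (i := ix 20 21)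
    (k := a * n + b) (qs := [(finite 10 (ix 25 21), .get 10 (ix 25 21))]) ?_ ?_
  · obtain ⟨r1, r2⟩ := hr
    have hrun : dpRound.run s = (relaxAll 7 (ix 20 21)
      [(finite 10 (ix 25 21), .get 10 (ix 25 21))]).run s3 := rfl
    rw [← hrun] at r1 r2
    have f10 : (dpRound.run s).val 10 = s3.val 10 := r1.1.val_eq (by simp)
    have f11 : (dpRound.run s).val 11 = s3.val 11 := r1.1.val_eq (by simp)
    have hag : Agree [23, 26, 27] [10, 11] s s3 :=
      ((c1.mono (by simp) (by simp)).trans (t1.mono (by simp) (by simp))).trans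
        (l1.mono (by simp) (by simp))
    refine ⟨(DistRel.of_agree hag (by simp)).trans ((Lowers.distRel r1).mono (by simp) (fun _ h => h)),
      fun k hk => ⟨?_, ?_⟩, ?_, ?_, ?_, ?_, ?_⟩
    · rw [f10, l2 k hk, e10, (c2 k hk).1]
    · rw [f11, e11, t2 k hk, (c2 k hk).2]
    · rw [f10]; exact l3
    · rw [f10]; exact l5
    · intro x y c d hx hxy hbit hc
      have hlt : S - pw x < S := by
        have : pw x ≤ S := by
          by_contra hlt
          rw [Nat.div_eq_of_lt (not_le.1 hlt)] at hbit
          simp at hbit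
        omega
      rw [f10, l2 _ (hpos _ hlt x), e10] at hc
      rw [f11, e11]
      exact t4 x y c d hx hxy hbit hc
    · rw [f10, f11, e11]; exact l4
    · rw [f10]
      by_cases htop : s3.val 10 (S * n + b) = ⊤
      · rw [htop]; exact le_top
      · have hc := val_of_ne (val_ne_top_iff.1 htop)
        rw [hc]
        refine r2 _ ⟨_, List.mem_singleton_self _, fun τ hτ => ?_⟩
        have hp := h3.of_agree hτ.1 (by simp) (by simp) (by simp) (by simp) (by simp) (by simp)
        have e25 := (hτ.1.1 25 (by simp)).trans hS3
        have e : (ix 25 21).eval τ = S * n + b := by rw [eval_ix hp.size, e25, hp.tgt]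
        refine ⟨?_, ?_⟩
        · rw [finite_holds, e, hτ.1.val_eq (by simp)]; exact htop
        · rw [RealExpr.eval, e, hτ.1.2.2 10 (by simp)]
  · intro τ hτ
    have hp := h3.of_agree hτ.1 (by simp) (by simp) (by simp) (by simp) (by simp) (by simp)
    rw [eval_ix hp.size, hp.src, hp.tgt]
  · intro τ hτ q hq hh
    obtain rfl := List.mem_singleton.1 hq
    have hp := h3.of_agree hτ.1 (by simp) (by simp) (by simp) (by simp) (by simp) (by simp)
    have e25 := (hτ.1.1 25 (by simp)).trans hS3
    have e : (ix 25 21).eval τ = S * n + b := by rw [eval_ix hp.size, e25, hp.tgt]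
    rw [finite_holds, e, hτ.1.val_eq (by simp)] at hh
    refine hP S _ (l3 b _ ?_)
    rw [RealExpr.eval, e, hτ.1.2.2 10 (by simp)]
    exact val_of_ne (val_ne_top_iff.1 hh)

/-- Sets of trees are coded by the numbers below 2 ^ k. Removing a tree makes the number smaller, so
each round finds the rows that it needs. -/
theorem run_dpLoop (hac : G.negEdges.IsAcyclic) (hL : G.IsNonnegTable L) (hδ : G.IsTreeTable δ)
    {rel : Fin n → Prop} {k : ℕ} (hpw : G.IsTreeLabelling rel k pw) (h : HoldsPair L δ pw a b s)
    (hk : s.natVar 3 = 2 ^ k) (hP : ∀ S c, G.TreeWalk pw a S b c → P (a * n + b) c) :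
    DistRel [23, 25, 26, 27] [10, 11] P s ((ForProg.for_ 25 3 dpRound).run s) ∧
    ∀ l, G.Steps a l b → (a :: l.map Prod.snd).Nodup → G.ExcursionsHeavy l →
      (∀ v ∈ a :: l.map Prod.snd, rel v) →
      ((ForProg.for_ 25 3 dpRound).run s).val 7 (a * n + b) ≤ (G.wt l : ℝ) := by
  have := run_for (s := s) (x := 25) (y := 3) (p := dpRound)
    (fun m σ => DistRel [23, 25, 26, 27] [10, 11] P s σ ∧
      ∀ S < m, RowCorrect G L δ pw a b σ S) ⟨distRel_setVar (by simp), by simp⟩ ?_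
  · rw [hk] at this
    obtain ⟨h1, h2⟩ := this
    refine ⟨h1, fun l hl hnd hheavy hrel => ?_⟩
    set τ := (ForProg.for_ 25 3 dpRound).run s with hτ
    exact dp_le_wt hac hL hδ hpw (A := fun S v => τ.val 10 (S * n + v))
      (B := fun S v => τ.val 11 (S * n + v)) (D := τ.val 7 (a * n + b))
      ((h2 0 (by positivity)).base rfl) (fun S x y c d hS => (h2 S hS).tree x y c d)
      (fun S y v hS => (h2 S hS).link y v) (fun S hS => (h2 S hS).out) hl hnd hheavy hrel
  · rintro S σ hS h25 ⟨hσ, hrows⟩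
    obtain ⟨h1, h2, h3⟩ := run_dpRound hac hL hδ hpw (h.of_agree hσ.1 (by simp) (by simp) (by simp)
      (by simp) (by simp) (by simp)) h25 (fun S' hS' => (hrows S' hS').sound) hP
    refine ⟨(hσ.trans (h1.mono (by simp) (by simp))).trans (distRel_setVar (by simp)),
      fun S' hS' => ?_⟩
    rcases Nat.lt_succ_iff_lt_or_eq.1 hS' with hS' | rfl
    · refine (hrows S' hS').of_eq (fun k hk => ?_) ?_
      · have := Nat.mul_le_mul_right n (Nat.succ_le_of_lt hS')
        exact h2 k (hk.trans_le this)
      · exact h1.2.1 _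
    · exact h3.of_eq (fun k hk => ⟨rfl, rfl⟩) le_rfl

/-- Compute the distance for the pair of vertices in variables `20` and `21`, which no vertex
separates. -/
def pairProg : ForProg := .seq relProg (.seq labelProg (.for_ 25 3 dpRound))

/-- Restricting the labels to relevant vertices loses nothing, because every vertex of a path from a
to b is relevant. -/
theorem run_pairProg (hac : G.negEdges.IsAcyclic) (hn : s.natVar 0 = n) (hR : HoldsReach G s)
    (hL : G.IsNonnegTable (s.tab n 5)) (hδ : G.IsTreeTable (s.tab n 6))
    (ha : s.natVar 20 = a) (hb : s.natVar 21 = b)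
    (hP : ∀ pw S c, G.TreeWalk pw a S b c → P (a * n + b) c) :
    DistRel [3, 22, 23, 24, 25, 26, 27] [8, 9, 10, 11] P s (pairProg.run s) ∧
    ∀ l, G.Steps a l b → (a :: l.map Prod.snd).Nodup → G.ExcursionsHeavy l →
      (pairProg.run s).val 7 (a * n + b) ≤ (G.wt l : ℝ) := by
  obtain ⟨h1, h2⟩ := run_relProg hn hR ha hb
  set s1 := relProg.run s with hs1
  have t5 := h1.tab_eq (show 5 ∉ [8] by simp) n
  have t6 := h1.tab_eq (show 6 ∉ [8] by simp) n
  obtain ⟨h3, h4, h5⟩ := run_labelProg (G := G) (s := s1) ((h1.1 0 (by simp)).trans hn) h2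
    (by rw [t6]; exact hδ)
  set s2 := labelProg.run s1 with hs2
  have hp : HoldsPair (s.tab n 5) (s.tab n 6) (G.label (G.Relevant a b)) a b s2 :=
    ⟨(h3.1 0 (by simp)).trans ((h1.1 0 (by simp)).trans hn),
      (h3.1 20 (by simp)).trans ((h1.1 20 (by simp)).trans ha),
      (h3.1 21 (by simp)).trans ((h1.1 21 (by simp)).trans hb),
      (h3.tab_eq (by simp) n).trans t5, (h3.tab_eq (by simp) n).trans t6, fun x => h5 x x.2⟩
  obtain ⟨h6, h7⟩ := run_dpLoop (P := P) hac hL hδ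
    (isTreeLabelling_label G (G.Relevant a b)) hp h4 (hP _)
  refine ⟨((DistRel.of_agree (h1.mono (by simp) (by simp)) (by simp)).trans
    (DistRel.of_agree (h3.mono (by simp) (by simp)) (by simp))).trans
    (h6.mono (by simp) (by simp)), fun l hl hnd hheavy => ?_⟩
  exact h7 l hl hnd hheavy fun v hv => hl.relevant hnd hv

/-- Compute the distance for the pair of vertices in variables `20` and `21`, unless they are in
different strong components or some vertex separates them. -/
def distBody : ForProg :=
  .ite (.natEq (.var 20) (.var 21))
    (relaxAll 7 (ix 20 21) [(.natEq (.lit 0) (.lit 0), .zero)])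
    (.ite (.and (reachTest (.var 0) 20 21) (reachTest (.var 0) 21 20))
      (.seq sepProg (.ite (.natEq (.var 28) (.lit 1)) pairProg .skip)) .skip)

/-- Compute distances for all pairs of vertices that no vertex separates. -/
def distProg : ForProg := .for_ 20 0 (.for_ 21 0 distBody)

theorem run_distBody (hac : G.negEdges.IsAcyclic) (hn : s.natVar 0 = n) (hR : HoldsReach G s)
    (hL : G.IsNonnegTable (s.tab n 5)) (hδ : G.IsTreeTable (s.tab n 6))
    (ha : s.natVar 20 = a) (hb : s.natVar 21 = b)
    (hP0 : ∀ u : Fin n, P (u * n + u) 0)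
    (hP : G.Conn b a → ∀ pw S c, G.TreeWalk pw a S b c → P (a * n + b) c) :
    DistRel [3, 20, 21, 22, 23, 24, 25, 26, 27, 28] [8, 9, 10, 11] P s (distBody.run s) ∧
    ∀ l, G.Conn b a → (∀ c, ¬ G.Separates c a b) → G.Steps a l b → (a :: l.map Prod.snd).Nodup →
      G.ExcursionsHeavy l → (distBody.run s).val 7 (a * n + b) ≤ (G.wt l : ℝ) := by
  have hab : (Test.natEq (.var 20) (.var 21)).Holds s ↔ a = b := by
    simp only [Test.Holds, NatExpr.eval, ha, hb, Fin.ext_iff]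
  have hcc : (Test.and (reachTest (.var 0) 20 21) (reachTest (.var 0) 21 20)).Holds s ↔
      G.Conn a b ∧ G.Conn b a := by
    rw [and_holds, reachTest_holds_zero hn hR ha hb, reachTest_holds_zero hn hR hb ha]
  by_cases heq : a = b
  · have hrun : distBody.run s =
        (relaxAll 7 (ix 20 21) [(.natEq (.lit 0) (.lit 0), .zero)]).run s := by
      rw [distBody, run, if_pos (hab.2 heq)]
    obtain ⟨r1, r2⟩ := lowers_relaxAll (X := []) (a := 7) (P := P) (s := s) (i := ix 20 21)
      (k := a * n + b) (qs := [(.natEq (.lit 0) (.lit 0), .zero)])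
      (fun τ hτ => by
        rw [eval_ix ((hτ.1.1 0 (by simp)).trans hn), hτ.1.1 20 (by simp), hτ.1.1 21 (by simp), ha,
          hb])
      (fun τ hτ q hq _ => by
        obtain rfl := List.mem_singleton.1 hq
        subst heq
        exact hP0 a)
    rw [hrun]
    refine ⟨(Lowers.distRel r1).mono (by simp) (fun _ h => h), fun l _ _ hl hnd _ => ?_⟩
    subst heq
    rw [hl.eq_nil hnd, wt_nil]
    exact r2 0 ⟨_, List.mem_singleton_self _, fun τ _ => ⟨rfl, le_rfl⟩⟩
  by_cases hconn : G.Conn a b ∧ G.Conn b a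
  · obtain ⟨h1, h2⟩ := run_sepProg hn hR ha hb
    have hrun : distBody.run s =
        (ForProg.ite (.natEq (.var 28) (.lit 1)) pairProg .skip).run (sepProg.run s) := by
      rw [distBody, run, if_neg (mt hab.1 heq), run, if_pos (hcc.2 hconn), run]
    have ht : (Test.natEq (.var 28) (.lit 1)).Holds (sepProg.run s) ↔
        ∀ c, c ≠ a → c ≠ b → G.ConnAvoid c a b := h2
    have h1' : DistRel [3, 20, 21, 22, 23, 24, 25, 26, 27, 28] [8, 9, 10, 11] P s (sepProg.run s) :=
      (DistRel.of_agree h1 (by simp)).mono (by simp) (by simp)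
    rw [hrun, run]
    by_cases hsep : ∀ c, c ≠ a → c ≠ b → G.ConnAvoid c a b
    · rw [if_pos (ht.2 hsep)]
      obtain ⟨h3, h4⟩ := run_pairProg (P := P) hac ((h1.1 0 (by simp)).trans hn)
        (HoldsReach.of_agree hR h1 (by simp)) (by rw [h1.tab_eq (by simp)]; exact hL)
        (by rw [h1.tab_eq (by simp)]; exact hδ) ((h1.1 20 (by simp)).trans ha)
        ((h1.1 21 (by simp)).trans hb) (hP hconn.2)
      exact ⟨h1'.trans (h3.mono (by simp) (by simp)), fun l _ _ => h4 l⟩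
    · rw [if_neg (mt ht.1 hsep)]
      refine ⟨h1', fun l _ hno => ?_⟩
      exfalso
      apply hsep
      intro c hca hcb
      by_contra hc
      exact hno c ⟨hconn.1, hconn.2, hca, hcb, hc⟩
  · have hrun : distBody.run s = s := by
      rw [distBody, run, if_neg (mt hab.1 heq), run, if_neg (mt hcc.1 hconn), run]
    rw [hrun]
    exact ⟨DistRel.of_agree (Agree.refl s) (by simp), fun l hba _ hl => absurd ⟨hl.conn, hba⟩ hconn⟩

theorem run_distProg (hac : G.negEdges.IsAcyclic) (hn : s.natVar 0 = n) (hR : HoldsReach G s)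
    (hL : G.IsNonnegTable (s.tab n 5)) (hδ : G.IsTreeTable (s.tab n 6))
    (hP0 : ∀ u : Fin n, P (u * n + u) 0)
    (hP : ∀ a b : Fin n, G.Conn b a → ∀ pw S c, G.TreeWalk pw a S b c → P (a * n + b) c) :
    DistRel [3, 20, 21, 22, 23, 24, 25, 26, 27, 28] [8, 9, 10, 11] P s (distProg.run s) ∧
    ∀ (a b : Fin n) l, G.Conn b a → (∀ c, ¬ G.Separates c a b) → G.Steps a l b →
      (a :: l.map Prod.snd).Nodup → G.ExcursionsHeavy l →
      (distProg.run s).tab n 7 a b ≤ (G.wt l : ℝ) := by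
  have := run_for2_rel (s := s) (n := n) (x := 20) (y := 21) (p := distBody)
    (DistRel [3, 20, 21, 22, 23, 24, 25, 26, 27, 28] [8, 9, 10, 11] P)
    (fun i j σ => ∀ (a b : Fin n) l, i = a → j = b → G.Conn b a → (∀ c, ¬ G.Separates c a b) →
      G.Steps a l b → (a :: l.map Prod.snd).Nodup → G.ExcursionsHeavy l →
      σ.val 7 (a * n + b) ≤ (G.wt l : ℝ)) (fun _ _ _ h h' => h.trans h')
    (fun _ _ => distRel_setVar (by simp)) (fun _ _ => distRel_setVar (by simp))
    (fun _ _ h => h.1.1 0 (by simp))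
    (fun i j σ τ h hσ a b l h1 h2 h3 h4 h5 h6 h7 =>
      (h.2.1 _).trans (hσ a b l h1 h2 h3 h4 h5 h6 h7)) (by simp)
    (by decide) hn ?_
  · exact ⟨this.1, fun a b l => this.2 a a.2 b b.2 a b l rfl rfl⟩
  · intro i j σ hi hj h20 h21 hσ
    obtain ⟨h1, h2⟩ := run_distBody (a := ⟨i, hi⟩) (b := ⟨j, hj⟩) hac ((hσ.1.1 0 (by simp)).trans hn)
      (HoldsReach.of_agree hR hσ.1 (by simp)) (by rw [hσ.1.tab_eq (by simp)]; exact hL)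
      (by rw [hσ.1.tab_eq (by simp)]; exact hδ) h20 h21 hP0 (hP _ _)
    refine ⟨h1, ?_⟩
    intro a b l ha hb
    rw [← Fin.ext (a := ⟨i, hi⟩) ha, ← Fin.ext (a := ⟨j, hj⟩) hb]
    exact h2 l

/-- Labels are computed only for different vertices that reach each other and that no vertex
separates, and for these the representatives are counted by the negative trees of one weak block.
The argument covers graphs whose negative edges contain cycles, on which the program runs as well.
-/
theorem safe_distProg (hn : s.natVar 0 = n) (hR : HoldsReach G s)
    (hδ : G.IsTreeTable (s.tab n 6)) {k m : ℕ}
    (hk : ∀ K B : Set (Fin n), G.IsStrongComponent K → G.IsWeakBlock K B → G.numNegTrees B ≤ k)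
    {cv : ℕ → Bd} (hcv : cv 3 = ⟨1, 1, 0⟩) : distProg.Safe cv (2 ^ k) m s := by
  refine safe_for fun σ hσ h20 => safe_for fun τ hτ h21 => ?_
  have h0 := (hσ.1 0 (by decide)).trans hn
  have h0' := (hτ.1 0 (by decide)).trans h0
  have hR' := HoldsReach.of_agree (HoldsReach.of_agree hR hσ (by decide)) hτ (by decide)
  have hδ' : G.IsTreeTable (τ.tab n 6) := by
    rw [hτ.tab_eq (by decide), hσ.tab_eq (by decide)]
    exact hδ
  have h20' := hτ.1 20 (by decide)
  rw [hn, ← h20'] at h20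
  rw [h0] at h21
  have ha : τ.natVar 20 = (⟨_, h20⟩ : Fin n) := rfl
  have hb : τ.natVar 21 = (⟨_, h21⟩ : Fin n) := rfl
  generalize (⟨_, h20⟩ : Fin n) = a at ha
  generalize (⟨_, h21⟩ : Fin n) = b at hb
  refine ⟨fun _ => safe_of_static cv rfl _, fun hab => ⟨fun hcc => ⟨safe_of_static cv rfl _, fun hsep =>
    ⟨safe_of_static cv rfl _, ?_, safe_of_static cv rfl _⟩, fun _ => trivial⟩, fun _ => trivial⟩⟩
  have hab : a ≠ b := by
    rintro rfl
    exact hab (ha.trans hb.symm)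
  rw [and_holds, reachTest_holds_zero h0' hR' ha hb, reachTest_holds_zero h0' hR' hb ha] at hcc
  obtain ⟨h1, h2⟩ := run_sepProg h0' hR' ha hb
  have hsep' := h2.1 hsep
  set υ := sepProg.run τ
  obtain ⟨h3, h4⟩ := run_relProg ((h1.1 0 (by simp)).trans h0')
    (HoldsReach.of_agree hR' h1 (by simp)) ((h1.1 20 (by simp)).trans ha)
    ((h1.1 21 (by simp)).trans hb)
  refine safe_labelProg ((h3.1 0 (by simp)).trans ((h1.1 0 (by simp)).trans h0')) h4 ?_
    (card_repsBelow_le_of_weakBlocks hab hcc.1 hcc.2 ?_ hk) hcv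
  · rw [h3.tab_eq (by simp), h1.tab_eq (by simp)]
    exact hδ'
  · rintro c ⟨-, -, h5, h6, h7⟩
    exact h7 (hsep' c h5 h6)

end ForProg

end RAM

/-! ## Composition of distances and the complete algorithm -/

namespace RAM

open MixedGraph

variable {n : ℕ} {G : MixedGraph (Fin n)} {s σ τ : State} {X A : List ℕ}

namespace ForProg

/-- Three nested loops that relax the entries of a table. -/
theorem run_for3_relaxAll {a : ℕ} {qs : List (Test × RealExpr)} (P : Fin n → Fin n → ℝ → Prop)
    (C : Fin n → Fin n → Fin n → ℝ → Prop) (hn : s.natVar 0 = n)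
    (hempty : ∀ k, s.natArr a k = 0)
    (hP : ∀ (u i j : Fin n) τ, Agree [14, 15, 16] [a] s τ → τ.natVar 16 = u → τ.natVar 14 = i →
      τ.natVar 15 = j → ∀ q ∈ qs, q.1.Holds τ → P i j (q.2.eval τ))
    (hC : ∀ (u i j : Fin n) c, C u i j c → ∃ q ∈ qs, ∀ τ, Agree [14, 15, 16] [a] s τ →
      τ.natVar 16 = u → τ.natVar 14 = i → τ.natVar 15 = j → q.1.Holds τ ∧ q.2.eval τ ≤ c) :
    let s' := (ForProg.for_ 16 0 (.for_ 14 0 (.for_ 15 0 (relaxAll a (ix 14 15) qs)))).run s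
    Agree [14, 15, 16] [a] s s' ∧ (∀ i j (c : ℝ), s'.tab n a i j = c → P i j c) ∧
      ∀ u i j c, C u i j c → s'.tab n a i j ≤ c := by
  intro s'
  have := run_for_lowers (X := [14, 15, 16]) (a := a) (s := s) (x := 16) (n := n)
    (P := fun k c => ∀ i j : Fin n, k = i * n + j → P i j c)
    (p := .for_ 14 0 (.for_ 15 0 (relaxAll a (ix 14 15) qs)))
    (fun m σ => ∀ (u i j : Fin n) c, m = (u : ℕ) → C u i j c → σ.tab n a i j ≤ c) (by simp)
    (fun m σ τ h hσ u i j c hu hc => (h.2.1 _).trans (hσ u i j c hu hc)) hn ?_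
  · refine ⟨this.1.1, fun i j c hc => this.1.2.2 ?_ _ c hc i j rfl,
      fun u i j c => this.2 u u.2 u i j c rfl⟩
    intro k x hx
    rw [tab_eq_top hempty] at hx
    exact absurd hx WithTop.top_ne_coe
  · intro m σ hm h16 hσ
    have e : ∀ τ, Agree [14, 15] [a] σ τ → Agree [14, 15, 16] [a] s τ ∧ τ.natVar 16 = m :=
      fun τ hτ => ⟨hσ.1.trans (hτ.mono (by simp) (by simp)), (hτ.1 16 (by simp)).trans h16⟩
    have h0 := (hσ.1.1 0 (by simp)).trans hn
    have h2 := run_for2_relaxAll (X := [14, 15]) (a := a) (s := σ) (n := n) (x := 14) (y := 15)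
      (P := fun k c => ∀ i j : Fin n, k = i * n + j → P i j c) (i := ix 14 15) (qs := qs)
      (fun u v => u * n + v)
      (fun i j c => ∀ i' j' : Fin n, i = i' → j = j' → C ⟨m, hm⟩ i' j' c) (by simp) (by simp)
      (by simp) (by simp) h0 ?_ ?_ ?_
    · refine ⟨h2.1.mono (by simp), ?_⟩
      intro u i j c hu hc
      refine h2.2 i i.2 j j.2 c fun i' j' hi hj => ?_
      rw [← Fin.ext hi, ← Fin.ext hj]
      obtain rfl : u = ⟨m, hm⟩ := Fin.ext hu.symm
      exact hc
    · exact fun τ hτ => eval_ix ((hτ.1.1 0 (by simp)).trans h0)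
    · intro i j τ hi hj h14 h15 hτ q hq hh i' j' hij
      obtain ⟨rfl, rfl⟩ := index_inj hj j'.2 hij
      obtain ⟨h3, h4⟩ := e τ hτ.1
      exact hP ⟨m, hm⟩ i' j' τ h3 h4 h14 h15 q hq hh
    · intro i j c hi hj hc
      obtain ⟨q, hq, hqc⟩ := hC ⟨m, hm⟩ ⟨i, hi⟩ ⟨j, hj⟩ c (hc _ _ rfl rfl)
      refine ⟨q, hq, fun τ h14 h15 hτ => ?_⟩
      obtain ⟨h3, h4⟩ := e τ hτ.1
      exact hqc τ h3 h4 h14 h15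

/-- Compose distances at separating vertices. -/
def composeProg : ForProg := floydWarshall 7
  (.and (reachTest (.var 0) 11 12) (.and (reachTest (.var 0) 12 11)
    (.and (.not (.natEq (.var 10) (.var 11))) (.and (.not (.natEq (.var 10) (.var 12)))
      (.not (reachTest (.var 10) 11 12))))))

theorem run_composeProg (hn : s.natVar 0 = n) (hR : HoldsReach G s) :
    Agree [10, 11, 12] [7] s (composeProg.run s) ∧
      IsClosure G.Separates (s.tab n 7) ((composeProg.run s).tab n 7) := by
  refine run_floydWarshall hn fun σ hσ k i j h10 h11 h12 => ?_
  have h0 := (hσ.1 0 (by simp)).trans hn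
  have hR' := HoldsReach.of_agree hR hσ (by simp)
  rw [and_holds, and_holds, and_holds, and_holds, reachTest_holds_zero h0 hR' h11 h12,
    reachTest_holds_zero h0 hR' h12 h11]
  refine and_congr_right fun _ => and_congr_right fun _ => and_congr ?_ (and_congr ?_ ?_)
  · simp only [Test.Holds, NatExpr.eval, h10, h11, Fin.ext_iff, ne_eq]
  · simp only [Test.Holds, NatExpr.eval, h10, h12, Fin.ext_iff, ne_eq]
  · rw [Test.Holds, reachTest_holds_var h0 hR' h10 h11 h12]

/-- Clear the flag if some path together with a link back has negative weight. -/
def cycleProg : ForProg := .for_ 14 0 (.for_ 15 0 (clearIf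
  (.and (finite 7 (ix 14 15)) (.and (finite 5 (ix 15 14))
    (.realLt (.add (.get 7 (ix 14 15)) (.get 5 (ix 15 14))) .zero)))))

theorem run_cycleProg (hn : s.natVar 0 = n) :
    FlagRel [14, 15] (¬ CycleTest (s.tab n 7) (s.tab n 5)) s (cycleProg.run s) ∧
      ((cycleProg.run s).natVar 1 ≠ 0 → CycleTest (s.tab n 7) (s.tab n 5)) := by
  have h1 := run_for2_flag (X := [14, 15]) (C := ¬ CycleTest (s.tab n 7) (s.tab n 5)) (s := s)
    (n := n) (x := 14) (y := 15) (p := clearIf (.and (finite 7 (ix 14 15))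
      (.and (finite 5 (ix 15 14))
      (.realLt (.add (.get 7 (ix 14 15)) (.get 5 (ix 15 14))) .zero))))
    (fun i j => ∀ u v : Fin n, i = u → j = v → s.tab n 7 u v + s.tab n 5 v u < 0)
    (by simp) (by simp) (by simp) (by simp) (by simp) (by simp [vars, clearIf]) hn ?_
  · refine ⟨h1.1, fun hne u v h => hne (h1.2 u u.2 v v.2 fun u' v' hu hv => ?_)⟩
    rw [← Fin.ext hu, ← Fin.ext hv]
    exact h
  · intro i j σ hi hj h14 h15 hσ
    have h0 := (hσ.1.1 0 (by simp)).trans hn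
    have f7 := finite_ix_holds h0 (a := 7) (u := ⟨i, hi⟩) (v := ⟨j, hj⟩) h14 h15
    have f5 := finite_ix_holds h0 (a := 5) (u := ⟨j, hj⟩) (v := ⟨i, hi⟩) h15 h14
    have c7 := coe_realArr h0 (a := 7) (u := ⟨i, hi⟩) (v := ⟨j, hj⟩) h14 h15
    have c5 := coe_realArr h0 (a := 5) (u := ⟨j, hj⟩) (v := ⟨i, hi⟩) h15 h14
    rw [hσ.1.tab_eq (by simp)] at f7 f5 c7 c5
    have hb : (Test.and (finite 7 (ix 14 15)) (.and (finite 5 (ix 15 14))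
        (.realLt (.add (.get 7 (ix 14 15)) (.get 5 (ix 15 14))) .zero))).Holds σ ↔
        s.tab n 7 ⟨i, hi⟩ ⟨j, hj⟩ + s.tab n 5 ⟨j, hj⟩ ⟨i, hi⟩ < 0 := by
      rw [and_holds, and_holds, f7, f5]
      constructor
      · rintro ⟨h1, h2, h3⟩
        rw [← c7 h1, ← c5 h2, ← WithTop.coe_add, ← WithTop.coe_zero, WithTop.coe_lt_coe]
        exact h3
      · intro h
        obtain ⟨h1, h2⟩ := WithTop.add_ne_top.1 (ne_top_of_lt h)
        rw [← c7 h1, ← c5 h2, ← WithTop.coe_add, ← WithTop.coe_zero, WithTop.coe_lt_coe] at h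
        exact ⟨h1, h2, h⟩
    have hC := run_clearIf (X := [14, 15]) (s := σ) (C := ¬ CycleTest (s.tab n 7) (s.tab n 5))
      (fun hh htest => htest _ _ (hb.1 hh))
    exact ⟨hC.1, fun hQ => hC.2 (hb.2 (hQ _ _ rfl rfl))⟩

/-- Compute the weights of walks that enter a strong component by their last arc. -/
def leaveProg : ForProg :=
  .for_ 16 0 (.for_ 14 0 (.for_ 15 0 (relaxAll 12 (ix 14 15)
    [(.and (finite 7 (ix 14 16)) (.and (finite 1 (ix 16 15)) (.not (reachTest (.var 0) 15 16))),
      .add (.get 7 (ix 14 16)) (.get 1 (ix 16 15)))])))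

theorem run_leaveProg (hG : HoldsGraph G s) (hR : HoldsReach G s)
    (h12 : ∀ k, s.natArr 12 k = 0) :
    Agree [14, 15, 16] [12] s (leaveProg.run s) ∧
      G.IsLeaveTable (s.tab n 7) ((leaveProg.run s).tab n 12) := by
  have hb : ∀ (u i j : Fin n) τ, Agree [14, 15, 16] [12] s τ → τ.natVar 16 = u →
      τ.natVar 14 = i → τ.natVar 15 = j →
      ((Test.and (finite 7 (ix 14 16)) (.and (finite 1 (ix 16 15))
        (.not (reachTest (.var 0) 15 16)))).Holds τ ↔
        s.tab n 7 i u ≠ ⊤ ∧ G.arcs.Adj u j ∧ ¬ G.Conn j u) := by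
    intro u i j τ hτ h16 h14 h15
    have hG' := hG.of_agree hτ (by simp) (by simp) (by simp)
    rw [and_holds, and_holds, Test.Holds, reachTest_holds_zero hG'.size
      (HoldsReach.of_agree hR hτ (by simp)) h15 h16, finite_ix_holds hG'.size h14 h16,
      hτ.tab_eq (by simp), ← hG'.arc]
    simp only [finite, Test.Holds, NatExpr.eval, eval_ix hG'.size, h15, h16, ne_eq]
  have he : ∀ (u i j : Fin n) τ, Agree [14, 15, 16] [12] s τ → τ.natVar 16 = u →
      τ.natVar 14 = i → τ.natVar 15 = j → G.arcs.Adj u j → ∀ c : ℝ, s.tab n 7 i u = c →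
      (RealExpr.add (.get 7 (ix 14 16)) (.get 1 (ix 16 15))).eval τ = c + G.arcWeight (u, j) := by
    intro u i j τ hτ h16 h14 h15 hadj c hc
    have hG' := hG.of_agree hτ (by simp) (by simp) (by simp)
    have h7 := coe_realArr hG'.size (a := 7) h14 h16
    rw [hτ.tab_eq (by simp), hc, WithTop.coe_eq_coe] at h7
    have h1 : (RealExpr.get 1 (ix 16 15)).eval τ = G.arcWeight (u, j) := by
      rw [RealExpr.eval, eval_ix hG'.size, h15, h16, hG'.arcWeight u j hadj]
    rw [RealExpr.eval, h7 WithTop.coe_ne_top, h1]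
  obtain ⟨h1, h2, h3⟩ := run_for3_relaxAll (s := s) (a := 12) (n := n) (qs := [(.and
      (finite 7 (ix 14 16)) (.and (finite 1 (ix 16 15)) (.not (reachTest (.var 0) 15 16))),
      .add (.get 7 (ix 14 16)) (.get 1 (ix 16 15)))])
    (fun i j x => ∃ u, G.arcs.Adj u j ∧ ¬ G.Conn j u ∧
      ∃ y : ℝ, s.tab n 7 i u = y ∧ y + G.arcWeight (u, j) = x)
    (fun u i j x => G.arcs.Adj u j ∧ ¬ G.Conn j u ∧
      ∃ y : ℝ, s.tab n 7 i u = y ∧ y + G.arcWeight (u, j) = x) hG.size h12 (by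
      intro u i j τ hτ h16 h14 h15 q hq hh
      obtain rfl := List.mem_singleton.1 hq
      obtain ⟨a1, a2, a3⟩ := (hb u i j τ hτ h16 h14 h15).1 hh
      obtain ⟨c, hc⟩ := WithTop.ne_top_iff_exists.1 a1
      exact ⟨u, a2, a3, c, hc.symm, (he u i j τ hτ h16 h14 h15 a2 c hc.symm).symm⟩) (by
      rintro u i j _ ⟨a2, a3, c, hc, rfl⟩
      refine ⟨_, List.mem_singleton_self _, fun τ hτ h16 h14 h15 => ⟨?_, ?_⟩⟩
      · exact (hb u i j τ hτ h16 h14 h15).2 ⟨hc ▸ WithTop.coe_ne_top, a2, a3⟩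
      · exact (he u i j τ hτ h16 h14 h15 a2 c hc).le)
  refine ⟨h1, h2, fun i u j hadj hno => ?_⟩
  by_cases htop : s.tab n 7 i u = ⊤
  · rw [htop, WithTop.top_add]; exact le_top
  · obtain ⟨c, hc⟩ := WithTop.ne_top_iff_exists.1 htop
    rw [← hc, ← WithTop.coe_add]
    exact h3 u i j _ ⟨hadj, hno, c, hc.symm, rfl⟩

/-- Combine the distances in strong components with those between different ones. -/
def joinProg : ForProg :=
  .for_ 16 0 (.for_ 14 0 (.for_ 15 0 (relaxAll 2 (ix 14 15)
    [(finite 7 (ix 14 15), .get 7 (ix 14 15)),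
     (.and (finite 12 (ix 14 16)) (finite 7 (ix 16 15)),
      .add (.get 12 (ix 14 16)) (.get 7 (ix 16 15)))])))

theorem run_joinProg (hn : s.natVar 0 = n) (h2 : ∀ k, s.natArr 2 k = 0) :
    Agree [14, 15, 16] [2] s (joinProg.run s) ∧
      IsJoinTable (s.tab n 7) (s.tab n 12) ((joinProg.run s).tab n 2) := by
  have hget : ∀ τ, Agree [14, 15, 16] [2] s τ → ∀ {a x y : ℕ} {u v : Fin n}, a ≠ 2 →
      τ.natVar x = u → τ.natVar y = v → ((finite a (ix x y)).Holds τ ↔ s.tab n a u v ≠ ⊤) ∧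
      ∀ c : ℝ, s.tab n a u v = c → (RealExpr.get a (ix x y)).eval τ = c := by
    intro τ hτ a x y u v ha hx hy
    have h0 := (hτ.1 0 (by simp)).trans hn
    have h1 := finite_ix_holds h0 (a := a) hx hy
    have h3 := coe_realArr h0 (a := a) hx hy
    rw [hτ.tab_eq (by simpa using ha)] at h1 h3
    refine ⟨h1, fun c hc => ?_⟩
    rw [hc, WithTop.coe_eq_coe] at h3
    exact h3 WithTop.coe_ne_top
  obtain ⟨h3, h4, h5⟩ := run_for3_relaxAll (s := s) (a := 2) (n := n)
    (qs := [(finite 7 (ix 14 15), .get 7 (ix 14 15)),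
      (.and (finite 12 (ix 14 16)) (finite 7 (ix 16 15)),
      .add (.get 12 (ix 14 16)) (.get 7 (ix 16 15)))])
    (fun i j x => s.tab n 7 i j = x ∨ ∃ v, ∃ y z : ℝ, s.tab n 12 i v = y ∧ s.tab n 7 v j = z ∧
      y + z = x)
    (fun v i j x => s.tab n 7 i j = x ∨ ∃ y z : ℝ, s.tab n 12 i v = y ∧ s.tab n 7 v j = z ∧
      y + z = x) hn h2 (by
      intro u i j τ hτ h16 h14 h15 q hq hh
      obtain ⟨a1, a2⟩ := hget τ hτ (a := 7) (by simp) h14 h15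
      obtain ⟨b1, b2⟩ := hget τ hτ (a := 12) (by simp) h14 h16
      obtain ⟨c1, c2⟩ := hget τ hτ (a := 7) (by simp) h16 h15
      simp only [List.mem_cons, List.not_mem_nil, or_false] at hq
      rcases hq with rfl | rfl
      · obtain ⟨c, hc⟩ := WithTop.ne_top_iff_exists.1 (a1.1 hh)
        left
        dsimp only
        rw [a2 c hc.symm, hc]
      · rw [and_holds, b1, c1] at hh
        obtain ⟨y, hy⟩ := WithTop.ne_top_iff_exists.1 hh.1
        obtain ⟨z, hz⟩ := WithTop.ne_top_iff_exists.1 hh.2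
        refine .inr ⟨u, y, z, hy.symm, hz.symm, ?_⟩
        dsimp only
        rw [RealExpr.eval, b2 y hy.symm, c2 z hz.symm]) (by
      rintro u i j c (hc | ⟨y, z, hy, hz, rfl⟩)
      · refine ⟨_, List.mem_cons_self .., fun τ hτ h16 h14 h15 => ?_⟩
        obtain ⟨a1, a2⟩ := hget τ hτ (a := 7) (by simp) h14 h15
        exact ⟨a1.2 (hc ▸ WithTop.coe_ne_top), (a2 c hc).le⟩
      · refine ⟨_, List.mem_cons_of_mem _ (List.mem_cons_self ..), fun τ hτ h16 h14 h15 => ?_⟩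
        obtain ⟨b1, b2⟩ := hget τ hτ (a := 12) (by simp) h14 h16
        obtain ⟨c1, c2⟩ := hget τ hτ (a := 7) (by simp) h16 h15
        refine ⟨⟨b1.2 (hy ▸ WithTop.coe_ne_top), c1.2 (hz ▸ WithTop.coe_ne_top)⟩, ?_⟩
        dsimp only
        rw [RealExpr.eval, b2 y hy, c2 z hz])
  refine ⟨h3, h4, fun i j => ⟨?_, fun v => ?_⟩⟩
  · by_cases htop : s.tab n 7 i j = ⊤
    · rw [htop]; exact le_top
    · obtain ⟨c, hc⟩ := WithTop.ne_top_iff_exists.1 htop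
      rw [← hc]
      -- Entries copied from table 7 are offered for every value of the third loop variable; i is
      -- one of them.
      exact h5 i i j c (.inl hc.symm)
  · by_cases htop : s.tab n 12 i v + s.tab n 7 v j = ⊤
    · rw [htop]; exact le_top
    · obtain ⟨y, hy⟩ := WithTop.ne_top_iff_exists.1 (WithTop.add_ne_top.1 htop).1
      obtain ⟨z, hz⟩ := WithTop.ne_top_iff_exists.1 (WithTop.add_ne_top.1 htop).2
      rw [← hy, ← hz, ← WithTop.coe_add]
      exact h5 v i j _ (.inr ⟨y, z, hy.symm, hz.symm, rfl⟩)

/-- The preparations: reachability, links, trees, and the test for cycles of negative edges. -/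
def prepProg : ForProg :=
  .seq reachProg (.seq linkProg (.seq treeProg (.seq (.setN 1 (.lit 1)) forestProg)))

/-- Everything that follows the computation of distances for pairs that no vertex separates. -/
def finishProg : ForProg :=
  .seq composeProg (.seq cycleProg (.seq leaveProg
    (.seq (floydWarshall 12 (.natEq (.lit 0) (.lit 0))) (.seq joinProg (.setN 0 (.var 1))))))

/-- The algorithm. -/
def apspProg : ForProg := .seq prepProg (.seq distProg finishProg)

/-- Bounds for the integer variables of the algorithm. -/
def varBound (x : ℕ) : Bd :=
  if x = 2 ∨ x = 13 then ⟨2, 0, 1⟩ else if x = 3 ∨ x = 25 then ⟨1, 1, 0⟩ else ⟨1, 0, 1⟩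

/-- Bounds for the integer arrays of the algorithm. -/
def arrBound (a : ℕ) : Bd := if a = 9 then ⟨1, 1, 0⟩ else ⟨1, 0, 0⟩

theorem apspProg_ok : apspProg.ok varBound arrBound = true := by decide +kernel

theorem apspProg_cap : (apspProg.cap varBound arrBound).a ≤ 1 ∧
    (apspProg.cap varBound arrBound).b ≤ 4 := by decide +kernel

/-- The decisive term comes from the loop over at most M sets of trees, inside two loops over pairs
and around two over vertices; the forest test and the reachability tables also take n ^ 4. -/
theorem apspProg_time : (apspProg.time varBound).a ≤ 1 ∧ (apspProg.time varBound).b ≤ 4 := by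
  decide +kernel

end ForProg

end RAM

/-! ### Correctness of the complete algorithm -/

namespace RAM

open MixedGraph

variable {n : ℕ} {G : MixedGraph (Fin n)} {s σ τ : State} {X A : List ℕ}

namespace ForProg

theorem run_prepProg (hG : HoldsGraph G s) (h5 : ∀ k, s.natArr 5 k = 0)
    (h6 : ∀ k, s.natArr 6 k = 0) :
    HoldsGraph G (prepProg.run s) ∧ HoldsReach G (prepProg.run s) ∧
      G.IsNonnegTable ((prepProg.run s).tab n 5) ∧ G.IsTreeTable ((prepProg.run s).tab n 6) ∧
      ((prepProg.run s).natVar 1 = 1 ∧ G.negEdges.IsAcyclic ∨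
        (prepProg.run s).natVar 1 = 0 ∧ ¬ G.negEdges.IsAcyclic) := by
  obtain ⟨a1, r1⟩ := run_reachProg hG
  set s1 := reachProg.run s
  have g1 := hG.of_agree a1 (by simp) (by simp) (by simp)
  obtain ⟨a2, l2⟩ := run_linkProg g1 (by rw [a1.2.1 5 (by simp)]; exact h5)
  set s2 := linkProg.run s1
  have g2 := g1.of_agree a2 (by simp) (by simp) (by simp)
  have r2 := HoldsReach.of_agree r1 a2 (by simp)
  obtain ⟨a3, t3⟩ := run_treeProg g2
    (by rw [a2.2.1 6 (by simp), a1.2.1 6 (by simp)]; exact h6)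
  set s3 := treeProg.run s2
  have g3 := g2.of_agree a3 (by simp) (by simp) (by simp)
  have r3 := HoldsReach.of_agree r2 a3 (by simp)
  have l3 : G.IsNonnegTable (s3.tab n 5) := by rw [a3.tab_eq (by simp)]; exact l2
  set s4 := (ForProg.setN 1 (.lit 1)).run s3
  have a4 : Agree [1] [] s3 s4 := agree_setVar s3 _ (by simp)
  have g4 := g3.of_agree a4 (by simp) (by simp) (by simp)
  have r4 := HoldsReach.of_agree r3 a4 (by simp)
  have l4 : G.IsNonnegTable (s4.tab n 5) := by rw [a4.tab_eq (by simp)]; exact l3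
  have t4 : G.IsTreeTable (s4.tab n 6) := by rw [a4.tab_eq (by simp)]; exact t3
  have f4 : s4.natVar 1 = 1 := setVar_natVar_self ..
  obtain ⟨h7, h8⟩ := run_forestProg g4
  have hrun : prepProg.run s = forestProg.run s4 := rfl
  rw [hrun]
  refine ⟨g4.of_agree h7.1 (by simp) (by simp) (by simp), HoldsReach.of_agree r4 h7.1 (by simp),
    by rw [h7.1.tab_eq (by simp)]; exact l4, by rw [h7.1.tab_eq (by simp)]; exact t4, ?_⟩
  rcases h7.2 with h9 | ⟨h9, h10⟩
  · left
    rw [f4] at h9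
    exact ⟨h9, t4.isAcyclic_of_test (h8 (by omega))⟩
  · exact .inr ⟨h9, fun hac => h10 (t4.test_of_isAcyclic hac)⟩

/-- If the negative edges contain a cycle, the flag has been cleared already and is never set again,
so nothing has to be known about the tables. Otherwise the completeness of table 7 makes the cycle
test exact. -/
theorem run_finishProg (hG : HoldsGraph G s) (hR : HoldsReach G s)
    (hL : G.IsNonnegTable (s.tab n 5))
    (h1 : s.natVar 1 = 1 ∧ G.negEdges.IsAcyclic ∨ s.natVar 1 = 0 ∧ ¬ G.negEdges.IsAcyclic)
    (h2 : ∀ k, s.natArr 2 k = 0) (h12 : ∀ k, s.natArr 12 k = 0)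
    (hsound : G.Conservative → G.PathSound (s.tab n 7))
    (hcomplete : G.negEdges.IsAcyclic → ∀ (a b : Fin n) l, G.Conn b a →
      (∀ c, ¬ G.Separates c a b) → G.Steps a l b → (a :: l.map Prod.snd).Nodup →
      G.ExcursionsHeavy l → s.tab n 7 a b ≤ (G.wt l : ℝ)) :
    (G.Conservative → (finishProg.run s).natVar 0 = 1 ∧ ∀ a b : Fin n,
      (G.Reachable a b → ∃ x : ℝ, (finishProg.run s).tab n 2 a b = x ∧ G.IsDistance a b x) ∧
      (¬ G.Reachable a b → (finishProg.run s).tab n 2 a b = ⊤)) ∧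
    (¬ G.Conservative → (finishProg.run s).natVar 0 = 0) := by
  obtain ⟨a1, c1⟩ := run_composeProg hG.size hR
  set s1 := composeProg.run s
  have g1 := hG.of_agree a1 (by simp) (by simp) (by simp)
  have r1 := HoldsReach.of_agree hR a1 (by simp)
  have l1 : G.IsNonnegTable (s1.tab n 5) := by rw [a1.tab_eq (by simp)]; exact hL
  obtain ⟨a2, f2⟩ := run_cycleProg g1.size
  set s2 := cycleProg.run s1
  have g2 := g1.of_agree a2.1 (by simp) (by simp) (by simp)
  have r2 := HoldsReach.of_agree r1 a2.1 (by simp)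
  have t2 : s2.tab n 7 = s1.tab n 7 := a2.1.tab_eq (by simp) n
  obtain ⟨a3, x3⟩ := run_leaveProg g2 r2
    (by rw [a2.1.2.1 12 (by simp), a1.2.1 12 (by simp)]; exact h12)
  set s3 := leaveProg.run s2
  have g3 := g2.of_agree a3 (by simp) (by simp) (by simp)
  have t3 : s3.tab n 7 = s1.tab n 7 := (a3.tab_eq (by simp) n).trans t2
  obtain ⟨a4, y4⟩ := run_floydWarshall (a := 12) (b := .natEq (.lit 0) (.lit 0))
    (Z := fun _ _ _ => True) g3.size (fun σ _ _ _ _ _ _ _ => by simp [Test.Holds, NatExpr.eval])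
  set s4 := (floydWarshall 12 (.natEq (.lit 0) (.lit 0))).run s3
  have g4 := g3.of_agree a4 (by simp) (by simp) (by simp)
  have t4 : s4.tab n 7 = s1.tab n 7 := (a4.tab_eq (by simp) n).trans t3
  obtain ⟨a5, o5⟩ := run_joinProg g4.size (by
    rw [a4.2.1 2 (by simp), a3.2.1 2 (by simp), a2.1.2.1 2 (by simp), a1.2.1 2 (by simp)]
    exact h2)
  set s5 := joinProg.run s4
  have hflag : (finishProg.run s).natVar 0 = s2.natVar 1 := by
    have : (finishProg.run s).natVar 0 = s5.natVar 1 := setVar_natVar_self ..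
    rw [this, a5.1 1 (by simp), a4.1 1 (by simp), a3.1 1 (by simp)]
  have htab : (finishProg.run s).tab n 2 = s5.tab n 2 := rfl
  rw [hflag, htab]
  rw [t2] at x3
  rw [t4] at o5
  have e1 : s1.natVar 1 = s.natVar 1 := a1.1 1 (by simp)
  constructor
  · intro hcons
    have hac := isAcyclic_of_conservative hcons
    have hs := pathSound_closure c1 (hsound hcons)
    have hc := pathComplete_closure c1 (hcomplete hac)
    refine ⟨?_, join_correct hcons hs hc x3 y4 o5⟩
    rcases a2.2 with h | ⟨-, h⟩
    · rw [h, e1]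
      exact (h1.resolve_right fun h => h.2 hac).1
    · exact absurd (cycleTest_of_conservative hcons hs l1) h
  · intro hcons
    by_contra hne
    have htest := f2 hne
    have hac : G.negEdges.IsAcyclic := by
      rcases h1 with h | h
      · exact h.2
      · exact absurd (a2.eq_zero (e1.trans h.1)) hne
    exact hcons (conservative_of_tests hac (pathComplete_closure c1 (hcomplete hac)) l1 htest)

theorem run_apspProg (hG : HoldsGraph G s) (h2 : ∀ k, s.natArr 2 k = 0)
    (h5 : ∀ k, s.natArr 5 k = 0) (h6 : ∀ k, s.natArr 6 k = 0) (h7 : ∀ k, s.natArr 7 k = 0)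
    (h12 : ∀ k, s.natArr 12 k = 0) :
    (G.Conservative → (apspProg.run s).natVar 0 = 1 ∧ ∀ a b : Fin n,
      (G.Reachable a b → ∃ x : ℝ, (apspProg.run s).tab n 2 a b = x ∧ G.IsDistance a b x) ∧
      (¬ G.Reachable a b → (apspProg.run s).tab n 2 a b = ⊤)) ∧
    (¬ G.Conservative → (apspProg.run s).natVar 0 = 0) := by
  obtain ⟨g1, r1, l1, t1, f1⟩ := run_prepProg hG h5 h6
  have a1 := prepProg.agree_run s
  set s1 := prepProg.run s
  have a2 : Agree [3, 20, 21, 22, 23, 24, 25, 26, 27, 28] [7, 8, 9, 10, 11] s1 (distProg.run s1) :=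
    (distProg.agree_run s1).mono (by decide) (by decide)
  have e7 : ∀ k, s1.val 7 k = ⊤ := by
    rw [a1.val_eq (by decide)]
    exact tab_eq_top h7
  refine run_finishProg (g1.of_agree a2 (by simp) (by simp) (by simp))
    (HoldsReach.of_agree r1 a2 (by simp)) (by rw [a2.tab_eq (by simp)]; exact l1)
    (by rw [a2.1 1 (by simp)]; exact f1) (by rw [a2.2.1 2 (by simp), a1.2.1 2 (by decide)]; exact h2)
    (by rw [a2.2.1 12 (by simp), a1.2.1 12 (by decide)]; exact h12) ?_ ?_
  · intro hcons
    have hac := isAcyclic_of_conservative hcons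
    -- Entries of table 7 are weights of walks that use no negative edge twice; by `exists_path_le`
    -- each of them is at least the weight of a path.
    obtain ⟨h3, -⟩ := run_distProg (P := fun k x => ∀ a b : Fin n, k = a * n + b → G.Conn b a ∧
      ∃ l, G.Steps a l b ∧ (a :: l.map Prod.snd).Nodup ∧ G.wt l ≤ x) hac g1.size r1 l1 t1
      (by
        intro u a b h
        obtain ⟨rfl, rfl⟩ := fin_index_inj h
        exact ⟨Conn.refl u, [], rfl, by simp, le_rfl⟩)
      (by
        rintro a b hba pw S _ ⟨l, hl, honce, rfl, -⟩ a' b' h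
        obtain ⟨rfl, rfl⟩ := fin_index_inj h
        exact ⟨hba, exists_path_le hcons hl honce⟩)
    intro a b x hx
    refine h3.2.2 ?_ _ x hx a b rfl
    intro k y hy
    rw [e7] at hy
    exact absurd hy WithTop.top_ne_coe
  · intro hac
    -- Only upper bounds are needed here, and they hold without conservativeness, so no property of
    -- the entries is tracked.
    exact (run_distProg (P := fun _ _ => True) hac g1.size r1 l1 t1 (by simp) (by simp)).2

end ForProg

end RAM

/-! ### The input memory, and the theorem -/

namespace MixedGraph

variable {n : ℕ}

theorem rowMajor_apply {α : Type} [Zero α] (f : Fin n → Fin n → α) (u v : Fin n) :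
    rowMajor f (u * n + v) = f u v := by
  have h : (finProdFinEquiv (u, v) : ℕ) = u * n + v := by
    simp [finProdFinEquiv, mul_comm, add_comm]
  have hlt : (u : ℕ) * n + v < n * n := h ▸ (finProdFinEquiv (u, v)).2
  have he : (⟨(u : ℕ) * n + v, hlt⟩ : Fin (n * n)) = finProdFinEquiv (u, v) := Fin.ext h.symm
  rw [rowMajor, dif_pos hlt, he, Equiv.symm_apply_apply]

theorem holdsGraph_input (G : MixedGraph (Fin n)) : RAM.HoldsGraph G G.input where
  size := by simp [input]
  edge u v := by simp [input, rowMajor_apply]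
  arc u v := by simp [input, rowMajor_apply]
  edgeWeight u v h := by simp [input, rowMajor_apply, h]
  arcWeight u v h := by simp [input, rowMajor_apply, h]

open RAM RAM.ForProg in
theorem bounded_input {M : ℕ} (hM : 1 ≤ M) (G : MixedGraph (Fin n)) :
    Bounded varBound arrBound M n G.input := by
  classical
  have hrow : ∀ (p : Fin n → Fin n → Prop) i, rowMajor (fun u v => if p u v then 1 else 0) i ≤ 1 := by
    intro p i
    unfold rowMajor
    split_ifs with h
    · dsimp only
      split_ifs <;> simp
    · simp
  have hone : ∀ a, 1 ≤ (arrBound a).val M n := by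
    intro a
    unfold arrBound
    split_ifs <;> simp [Bd.val, hM]
  refine ⟨fun x => ?_, fun a i => ?_⟩
  · by_cases hx : x = 0
    · subst hx; simp [input, varBound, Bd.val]
    · simp [input, hx]
  · refine le_trans ?_ (hone a)
    simp only [input]
    split_ifs
    · convert hrow _ i
    · convert hrow _ i
    · simp

end MixedGraph

open RAM RAM.ForProg in
theorem exists_program_solvesAPSP :
    ∃ (P : RAM.Program) (C : ℕ), ∀ (n : ℕ), 1 ≤ n → ∀ (G : MixedGraph (Fin n)) (k₂ : ℕ),
      (∀ K B : Set (Fin n), G.IsStrongComponent K → G.IsWeakBlock K B →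
        G.numNegTrees B ≤ k₂) →
      ∃ (t : ℕ) (σ : RAM.State),
        RAM.Runs (C * 2 ^ k₂ * n ^ 4) P G.input t σ ∧
        t ≤ C * 2 ^ k₂ * n ^ 4 ∧
        G.SolvesAPSP σ := by
  -- The coefficients for word size and running time are added to serve both; the extra 1 makes all
  -- integers strictly smaller than the word bound, as 2 ^ k * n ^ 4 is positive.
  refine ⟨apspProg.compile, (apspProg.cap varBound arrBound).c + (apspProg.time varBound).c + 1,
    fun n hn G k hk => ?_⟩
  have hM : 1 ≤ 2 ^ k := Nat.one_le_two_pow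
  have hG := G.holdsGraph_input
  have hB := MixedGraph.bounded_input hM G
  have hempty : ∀ a, 2 ≤ a → ∀ i, G.input.natArr a i = 0 := by
    intro a ha i
    simp [MixedGraph.input, show a ≠ 0 by omega, show a ≠ 1 by omega]
  have hpos : 1 ≤ 2 ^ k * n ^ 4 := Nat.mul_pos hM (Nat.pow_pos hn)
  have hval : ∀ p : Bd, p.a ≤ 1 → p.b ≤ 4 → p.val (2 ^ k) n ≤ p.c * (2 ^ k * n ^ 4) := by
    intro p ha hb
    refine (Bd.val_mono (p := p) (q := ⟨p.c, 1, 4⟩) hM hn le_rfl ha hb).trans (le_of_eq ?_)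
    simp only [Bd.val, pow_one]
    ring
  have hcap := hval _ apspProg_cap.1 apspProg_cap.2
  have htime := hval _ apspProg_time.1 apspProg_time.2
  have hsafe : apspProg.Safe varBound (2 ^ k) n G.input := by
    obtain ⟨g1, r1, -, t1, -⟩ := run_prepProg hG (hempty 5 (by simp)) (hempty 6 (by simp))
    exact ⟨safe_of_static _ (by decide +kernel) _, safe_distProg g1.size r1 t1 hk rfl,
      safe_of_static _ (by decide +kernel) _⟩
  obtain ⟨t, hrun, ht, hb⟩ := apspProg.runs (cv := varBound) (ca := arrBound) hM hn apspProg_ok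
    (W := ((apspProg.cap varBound arrBound).c + (apspProg.time varBound).c + 1) * 2 ^ k * n ^ 4)
    (by rw [mul_assoc, add_mul, add_mul, one_mul]; omega) hB hsafe
  refine ⟨t, apspProg.run G.input, hrun, ?_, ?_⟩
  · rw [mul_assoc, add_mul, add_mul, one_mul]
    omega
  obtain ⟨h1, h2⟩ := run_apspProg hG (hempty 2 (by simp)) (hempty 5 (by simp))
    (hempty 6 (by simp)) (hempty 7 (by simp)) (hempty 12 (by simp))
  refine ⟨fun hcons => ?_, h2⟩
  obtain ⟨h3, h4⟩ := h1 hcons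
  refine ⟨h3, fun a b => ⟨fun hab => ?_, fun hab => ?_⟩⟩
  · obtain ⟨x, hx, hd⟩ := (h4 a b).1 hab
    change (apspProg.run G.input).val 2 (a * n + b) = x at hx
    have hne : (apspProg.run G.input).natArr 2 (a * n + b) ≠ 0 :=
      val_ne_top_iff.1 (hx ▸ WithTop.coe_ne_top)
    rw [val_of_ne hne, WithTop.coe_eq_coe] at hx
    -- The static bound for the entries of integer array 2 is 1, so an entry that is not 0 equals 1.
    have hle := hb.2 2 (a * n + b)
    have : (arrBound 2).val (2 ^ k) n = 1 := by simp [arrBound, Bd.val]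
    rw [this] at hle
    exact ⟨by omega, hx ▸ hd⟩
  · by_contra hne
    exact val_ne_top_iff.2 hne ((h4 a b).2 hab)

theorem mainTheorem5 :
    ∃ (P : RAM.Program) (C : ℕ), ∀ (n : ℕ), 1 ≤ n → ∀ (G : MixedGraph (Fin n)) (k₂ : ℕ),
      (∀ K B : Set (Fin n), G.IsStrongComponent K → G.IsWeakBlock K B →
        G.numNegTrees B ≤ k₂) →
      ∃ (t : ℕ) (σ : RAM.State),
        RAM.Runs (C * 2 ^ k₂ * n ^ 4) P G.input t σ ∧
        t ≤ C * 2 ^ k₂ * n ^ 4 ∧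
        G.SolvesAPSP σ :=
  exists_program_solvesAPSP
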